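/- Let $K$ be a field of characteristic zero, $m,n\ge 0$, $d=m+n$, and let $\hat i=0$ for $i\le m$, $\hat i=1$ for $m<i\le d$. Let $q\in K^\times$ be such that $q=1$ or $q$ is not a root of unity. Let $p_{ij},q_{ij}\in K^\times$ $(1\le i,j\le d)$ satisfy $p_{ji}=p_{ij}^{-1}$, $q_{ji}=q_{ij}^{-1}$, $p_{ii}=q_{ii}=1$ and $p_{ij}q_{ij}=q$ for all $i<j$ (that is, $\varepsilon_{ij}=1$ for $i<j$), and put $$R^{kl}_{ij}=\frac{q-p_{ij}q_{ij}}{1+p_{ij}q_{ij}}\,\delta^k_i\delta^l_j+(-1)^{\hat i\hat j}\frac{p_{ij}(q+1)}{1+p_{ij}q_{ij}}\,\delta^l_i\delta^k_j .$$ A matrix $Z=(z^j_i)_{i,j=1}^{d}$ (row index $j$, column index $i$) over an associative unital $K$-algebra is called a quantum super matrix if for all $i,j,k,l$ $$\sum_{p,s}(-1)^{\hat s(\hat i+\hat p)}R^{kl}_{ps}z^p_iz^s_j=\sum_{u,v}(-1)^{\hat l(\hat u+\hat k)}z^k_uz^l_vR^{uv}_{ij}.\qquad(\ast)$$ The function algebra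 $K[GL_R(m|n)]$ on the quantum general linear super group is the $K$-algebra generated by $z^j_i,t^j_i$ $(1\le i,j\le d)$ subject to $(\ast)$ and $$\sum_k(-1)^{\hat i(\hat k+1)}z^j_kt^k_i=\sum_k(-1)^{\hat k(\hat j+1)}t^j_kz^k_i=\delta^j_i .$$ Write $Z=\begin{pmatrix}A&B\\ C&D\end{pmatrix}$, where $A$ is the $m\times m$ block and $D$ the $n\times n$ block. Let $R_e=(R^{kl}_{ij})_{i,j,k,l\le m}$ and $R_o=(R^{kl}_{ij})_{i,j,k,l>m}$, and let $P$ be the matrix with entries $P^{lk}_{ij}=p_{ij}\delta^k_i\delta^l_j$ for $i,k\le m<j,l$. For matrices $X,Y$ let $X_1Y_2$ be the matrix with entries $(X_1Y_2)^{kl}_{ij}=X^k_iY^l_j$. The block relations are $$\begin{array}{ll}R_eA_1A_2=A_1A_2R_e,& R_eB_1B_2=B_1B_2R_o,\\ C_1C_2R_e=R_oC_1C_2,& R_oD_1D_2=D_1D_2R_o,\\ R_eA_1B_2=B_1A_2P,& A_1C_2R_e=qP^{-1}C_1A_2,\\ R_oC_1D_2=-D_1C_2P,& -B_1D_2R_o=qP^{-1}D_1B_2,\\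 qA_1D_2P^{-1}-qP^{-1}D_1A_2=(q-1)B_1C_2,& B_1C_2P=-qP^{-1}C_1B_2.\end{array}$$ For an $m\times m$ matrix $A=(a^j_i)$, and for an $n\times n$ matrix $D=(d^j_i)$, with entries in a $K$-algebra, put $$\det{}_qA=\sum_{\sigma\in\mathfrak S_m}\Big(\prod_{i<j,\ \sigma(i)>\sigma(j)}\big(-p_{\sigma(i)\sigma(j)}\big)\Big)a^{\sigma(1)}_1\cdots a^{\sigma(m)}_m,$$ $$\det{}_qD=\sum_{\sigma\in\mathfrak S_n}\Big(\prod_{i<j,\ \sigma(i)>\sigma(j)}\big(-q^{-1}_{m+\sigma(i),\,m+\sigma(j)}\big)\Big)d^{\sigma(1)}_1\cdots d^{\sigma(n)}_n .$$ Then the following hold. 1. Over the algebra generated by the entries of $A,B,C,D$ and a two-sided inverse $\det_qA^{-1}$ of $\det_qA$, modulo the block relations, the matrix $A$ is invertible. The algebra $K[GL_R(m|n)]$ is isomorphic, by an isomorphism that is the identity on the generators $z^j_i$, to the algebra generated by the entries of $A,B,C,D$ and two-sided inverses $\det_qA^{-1}$ of $\det_qA$ and $\det_q(D-CA^{-1}B)^{-1}$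 of $\det_q(D-CA^{-1}B)$, modulo the block relations. 2. The algebra $K[GL_R(m|n)]$ is isomorphic, by an isomorphism that is the identity on the generators $z^j_i$, to the algebra generated by the entries of $A,B,C,D$ and two-sided inverses $\det_qA^{-1}$ of $\det_qA$ and $\det_qD^{-1}$ of $\det_qD$, modulo the block relations. 3. In particular, a quantum super matrix $Z=\begin{pmatrix}A&B\\ C&D\end{pmatrix}$ over any $K$-algebra is invertible if and only if both $A$ and $D$ are invertible. -/

import Mathlib

open scoped Kronecker

noncomputable section

namespace QSuper

universe u v

/-- Indices of a homogeneous basis in standard format: `m` even vectors followed by `n` odd ones. -/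
abbrev Idx (m n : ℕ) : Type := Fin m ⊕ Fin n

/-- The parity of a basis vector. -/
def par {m n : ℕ} : Idx m n → ℕ := Sum.elim (fun _ => 0) (fun _ => 1)

section Matrices

variable {K : Type u} [Field K] {m n : ℕ}

/-- The multiparameter `R`-matrix. The parameters `q_{ij}` are called `r i j`.
The entry in row `(k, l)` and column `(i, j)` is `R^{kl}_{ij}`. -/
def RMat (q : K) (p r : Idx m n → Idx m n → K) :
    Matrix (Idx m n × Idx m n) (Idx m n × Idx m n) K :=
  Matrix.of fun x y =>
    (q - p y.1 y.2 * r y.1 y.2) / (1 + p y.1 y.2 * r y.1 y.2) *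
        (if x.1 = y.1 ∧ x.2 = y.2 then 1 else 0) +
      (-1) ^ (par y.1 * par y.2) * (p y.1 y.2 * (q + 1) / (1 + p y.1 y.2 * r y.1 y.2)) *
        (if x.2 = y.1 ∧ x.1 = y.2 then 1 else 0)

/-- The even-even block of `R`. -/
def Re (q : K) (p r : Idx m n → Idx m n → K) : Matrix (Fin m × Fin m) (Fin m × Fin m) K :=
  (RMat q p r).submatrix (Prod.map Sum.inl Sum.inl) (Prod.map Sum.inl Sum.inl)

/-- The odd-odd block of `R`. -/
def Ro (q : K) (p r : Idx m n → Idx m n → K) : Matrix (Fin n × Fin n) (Fin n × Fin n) K :=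
  (RMat q p r).submatrix (Prod.map Sum.inr Sum.inr) (Prod.map Sum.inr Sum.inr)

/-- `P^{lk}_{ij} = p_{ij} δ^{kl}_{ij}` for `i, k` even and `j, l` odd. -/
def PMat (p : Idx m n → Idx m n → K) : Matrix (Fin n × Fin m) (Fin m × Fin n) K :=
  Matrix.of fun x y =>
    if x.2 = y.1 ∧ x.1 = y.2 then p (Sum.inl y.1) (Sum.inr y.2) else 0

/-- The inverse matrix of `P`. -/
def PInv (p : Idx m n → Idx m n → K) : Matrix (Fin m × Fin n) (Fin n × Fin m) K :=
  Matrix.of fun x y =>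
    if x.1 = y.2 ∧ x.2 = y.1 then (p (Sum.inl x.1) (Sum.inr x.2))⁻¹ else 0

theorem PMat_mul_PInv (p : Idx m n → Idx m n → K) (hp : ∀ i j, p i j ≠ 0) :
    PMat p * PInv p = 1 := by
  ext ⟨a, b⟩ ⟨c, d⟩
  rw [Matrix.mul_apply, Finset.sum_eq_single (b, a)]
  · simp only [PMat, PInv, Matrix.of_apply, Matrix.one_apply, Prod.mk.injEq]
    by_cases h1 : a = c <;> by_cases h2 : b = d <;> simp [h1, h2, hp]
  · rintro ⟨e, f⟩ - h
    have h' : ¬ (b = e ∧ a = f) := fun h'' => h (by rw [h''.1, h''.2])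
    simp [PMat, h']
  · simp

theorem PInv_mul_PMat (p : Idx m n → Idx m n → K) (hp : ∀ i j, p i j ≠ 0) :
    PInv p * PMat p = 1 := by
  ext ⟨a, b⟩ ⟨c, d⟩
  rw [Matrix.mul_apply, Finset.sum_eq_single (b, a)]
  · simp only [PMat, PInv, Matrix.of_apply, Matrix.one_apply, Prod.mk.injEq]
    by_cases h1 : a = c <;> by_cases h2 : b = d <;> simp [h1, h2, hp]
  · rintro ⟨e, f⟩ - h
    have h' : ¬ (a = f ∧ b = e) := fun h'' => h (by rw [h''.1, h''.2])
    simp [PInv, h']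
  · simp

/-- A matrix of scalars, viewed in a `K`-algebra. -/
abbrev sc (S : Type v) [Ring S] [Algebra K S] {a b : Type} (M : Matrix a b K) : Matrix a b S :=
  M.map (algebraMap K S)

variable {S : Type v} [Ring S] [Algebra K S]

/-- Left-hand side of the defining relations of a quantum super matrix; `Z k i` is `z^k_i`. -/
def zLHS (q : K) (p r : Idx m n → Idx m n → K) (Z : Matrix (Idx m n) (Idx m n) S)
    (i j k l : Idx m n) : S :=
  ∑ a, ∑ s, (-1) ^ (par s * (par i + par a)) *
    (algebraMap K S (RMat q p r (k, l) (a, s)) * (Z a i * Z s j))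

/-- Right-hand side of the defining relations of a quantum super matrix. -/
def zRHS (q : K) (p r : Idx m n → Idx m n → K) (Z : Matrix (Idx m n) (Idx m n) S)
    (i j k l : Idx m n) : S :=
  ∑ b, ∑ c, (-1) ^ (par l * (par b + par k)) *
    ((Z k b * Z l c) * algebraMap K S (RMat q p r (b, c) (i, j)))

/-- A quantum super matrix with entries in a `K`-algebra. -/
def IsQuantumSuperMatrix (q : K) (p r : Idx m n → Idx m n → K)
    (Z : Matrix (Idx m n) (Idx m n) S) : Prop :=
  ∀ i j k l, zLHS q p r Z i j k l = zRHS q p r Z i j k l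

/-- The polynomial `∑_σ (∏_{i<j, σ i > σ j} c_{σ i, σ j}) a_1^{σ 1} a_2^{σ 2} ⋯ a_k^{σ k}`,
the product of the (noncommuting) entries being taken in this order. -/
def detWith {k : ℕ} (c : Fin k → Fin k → K) (A : Matrix (Fin k) (Fin k) S) : S :=
  ∑ σ : Equiv.Perm (Fin k),
    algebraMap K S (∏ i, ∏ j, if i < j ∧ σ j < σ i then c (σ i) (σ j) else 1) *
      (List.ofFn fun i => A (σ i) i).prod

/-- The quantum determinant for the even block: the coefficients come from the relations
`x_i x_j = - p_{ij} x_j x_i` of the quantum exterior algebra on the even vectors. -/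
def detEven (p : Idx m n → Idx m n → K) (A : Matrix (Fin m) (Fin m) S) : S :=
  detWith (fun i j => -p (Sum.inl i) (Sum.inl j)) A

/-- The quantum determinant for the odd block: the coefficients come from the relations
`x_i x_j = - q_{ij}⁻¹ x_j x_i` of the quantum symmetric algebra on the odd vectors. -/
def detOdd (r : Idx m n → Idx m n → K) (D : Matrix (Fin n) (Fin n) S) : S :=
  detWith (fun i j => -(r (Sum.inr i) (Sum.inr j))⁻¹) D

end Matrices

section FunctionAlgebra

variable {K : Type u} [Field K] {m n : ℕ}

/-- The free algebra on the entries `z^j_i` and `t^j_i`. -/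
abbrev FreeZT (K : Type u) [Field K] (m n : ℕ) : Type u :=
  FreeAlgebra K ((Idx m n × Idx m n) ⊕ (Idx m n × Idx m n))

/-- The generic matrix `(z^j_i)` in the free algebra. -/
def freeZ : Matrix (Idx m n) (Idx m n) (FreeZT K m n) :=
  Matrix.of fun j i => FreeAlgebra.ι K (Sum.inl (j, i))

/-- The generic matrix `(t^j_i)` in the free algebra. -/
def freeT : Matrix (Idx m n) (Idx m n) (FreeZT K m n) :=
  Matrix.of fun j i => FreeAlgebra.ι K (Sum.inr (j, i))

/-- The defining relations of the function algebra on the quantum general linear super group. -/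
inductive GLRel (q : K) (p r : Idx m n → Idx m n → K) : FreeZT K m n → FreeZT K m n → Prop
  | z (i j k l : Idx m n) : GLRel q p r (zLHS q p r freeZ i j k l) (zRHS q p r freeZ i j k l)
  | zt (i j : Idx m n) : GLRel q p r
      (∑ k, (-1) ^ (par i * (par k + 1)) * (freeZ j k * freeT k i)) (if i = j then 1 else 0)
  | tz (i j : Idx m n) : GLRel q p r
      (∑ k, (-1) ^ (par k * (par j + 1)) * (freeT j k * freeZ k i)) (if i = j then 1 else 0)

/-- The function algebra on the quantum general linear super group `GL_R(m|n)`. -/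
def GLAlg (q : K) (p r : Idx m n → Idx m n → K) : Type u := RingQuot (GLRel q p r)

instance (q : K) (p r : Idx m n → Idx m n → K) : Ring (GLAlg q p r) :=
  inferInstanceAs (Ring (RingQuot (GLRel q p r)))

instance (q : K) (p r : Idx m n → Idx m n → K) : Algebra K (GLAlg q p r) :=
  inferInstanceAs (Algebra K (RingQuot (GLRel q p r)))

/-- The quotient map. -/
def GLAlg.mk (q : K) (p r : Idx m n → Idx m n → K) : FreeZT K m n →ₐ[K] GLAlg q p r :=
  RingQuot.mkAlgHom K (GLRel q p r)

/-- The generic quantum super matrix in the function algebra. -/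
def glZ (q : K) (p r : Idx m n → Idx m n → K) : Matrix (Idx m n) (Idx m n) (GLAlg q p r) :=
  freeZ.map (GLAlg.mk q p r)

end FunctionAlgebra

section BlockAlgebra

variable {K : Type u} [Field K] {m n : ℕ}

/-- The free algebra on the entries of the four blocks `A`, `B`, `C`, `D`. -/
abbrev FreeBlocks (K : Type u) [Field K] (m n : ℕ) : Type u :=
  FreeAlgebra K (Idx m n × Idx m n)

/-- The generic matrix in the free algebra. -/
def genZ : Matrix (Idx m n) (Idx m n) (FreeBlocks K m n) :=
  Matrix.of fun j i => FreeAlgebra.ι K (j, i)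

/-- The generic block `A` (even rows, even columns). -/
abbrev gA : Matrix (Fin m) (Fin m) (FreeBlocks K m n) := genZ.toBlocks₁₁
/-- The generic block `B` (even rows, odd columns). -/
abbrev gB : Matrix (Fin m) (Fin n) (FreeBlocks K m n) := genZ.toBlocks₁₂
/-- The generic block `C` (odd rows, even columns). -/
abbrev gC : Matrix (Fin n) (Fin m) (FreeBlocks K m n) := genZ.toBlocks₂₁
/-- The generic block `D` (odd rows, odd columns). -/
abbrev gD : Matrix (Fin n) (Fin n) (FreeBlocks K m n) := genZ.toBlocks₂₂

/-- Two elements are related if they are the same entry of `M` and of `N`. -/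
inductive EntryRel {S : Type v} {a b : Type} (M N : Matrix a b S) : S → S → Prop
  | mk (x : a) (y : b) : EntryRel M N (M x y) (N x y)

/-- The block relations. Here `X ⊗ₖ Y` is the matrix `X₁ Y₂`, whose entry in row `(k, l)` and
column `(i, j)` is the product `X k i * Y l j`. -/
inductive BlockRel (q : K) (p r : Idx m n → Idx m n → K) (u v : FreeBlocks K m n) : Prop
  | aa (h : EntryRel (sc _ (Re q p r) * (gA ⊗ₖ gA)) ((gA ⊗ₖ gA) * sc _ (Re q p r)) u v)
  | bb (h : EntryRel (sc _ (Re q p r) * (gB ⊗ₖ gB)) ((gB ⊗ₖ gB) * sc _ (Ro q p r)) u v)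
  | cc (h : EntryRel ((gC ⊗ₖ gC) * sc _ (Re q p r)) (sc _ (Ro q p r) * (gC ⊗ₖ gC)) u v)
  | dd (h : EntryRel (sc _ (Ro q p r) * (gD ⊗ₖ gD)) ((gD ⊗ₖ gD) * sc _ (Ro q p r)) u v)
  | ab (h : EntryRel (sc _ (Re q p r) * (gA ⊗ₖ gB)) ((gB ⊗ₖ gA) * sc _ (PMat p)) u v)
  | ac (h : EntryRel ((gA ⊗ₖ gC) * sc _ (Re q p r)) (sc _ (q • PInv p) * (gC ⊗ₖ gA)) u v)
  | cd (h : EntryRel (sc _ (Ro q p r) * (gC ⊗ₖ gD)) (-((gD ⊗ₖ gC) * sc _ (PMat p))) u v)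
  | bd (h : EntryRel (-((gB ⊗ₖ gD) * sc _ (Ro q p r))) (sc _ (q • PInv p) * (gD ⊗ₖ gB)) u v)
  | ad (h : EntryRel
      ((gA ⊗ₖ gD) * sc _ (q • PInv p) - sc _ (q • PInv p) * (gD ⊗ₖ gA))
      ((q - 1) • (gB ⊗ₖ gC)) u v)
  | bc (h : EntryRel ((gB ⊗ₖ gC) * sc _ (PMat p)) (-(sc _ (q • PInv p) * (gC ⊗ₖ gB))) u v)

/-- The algebra generated by the entries of `A`, `B`, `C`, `D` modulo the block relations. -/
def BlockAlg (q : K) (p r : Idx m n → Idx m n → K) : Type u := RingQuot (BlockRel q p r)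

instance (q : K) (p r : Idx m n → Idx m n → K) : Ring (BlockAlg q p r) :=
  inferInstanceAs (Ring (RingQuot (BlockRel q p r)))

instance (q : K) (p r : Idx m n → Idx m n → K) : Algebra K (BlockAlg q p r) :=
  inferInstanceAs (Algebra K (RingQuot (BlockRel q p r)))

/-- The quotient map. -/
def BlockAlg.mk (q : K) (p r : Idx m n → Idx m n → K) : FreeBlocks K m n →ₐ[K] BlockAlg q p r :=
  RingQuot.mkAlgHom K (BlockRel q p r)

/-- The matrix of generators of `BlockAlg`. -/
def blockZ (q : K) (p r : Idx m n → Idx m n → K) : Matrix (Idx m n) (Idx m n) (BlockAlg q p r) :=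
  genZ.map (BlockAlg.mk q p r)

end BlockAlgebra

section Adjoin

variable (K : Type u) [Field K] {S : Type v} [Ring S] [Algebra K S]

/-- The relations of the algebra obtained from `S` by adding one generator `none`, a two-sided
inverse of `x`. The generator `some s` stands for the element `s` of `S`. -/
inductive AdjoinInvRel (x : S) : FreeAlgebra K (Option S) → FreeAlgebra K (Option S) → Prop
  | add (s t : S) : AdjoinInvRel x
      (FreeAlgebra.ι K (some (s + t))) (FreeAlgebra.ι K (some s) + FreeAlgebra.ι K (some t))
  | mul (s t : S) : AdjoinInvRel x
      (FreeAlgebra.ι K (some (s * t))) (FreeAlgebra.ι K (some s) * FreeAlgebra.ι K (some t))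
  | scalar (c : K) : AdjoinInvRel x
      (FreeAlgebra.ι K (some (algebraMap K S c))) (algebraMap K (FreeAlgebra K (Option S)) c)
  | mul_inv : AdjoinInvRel x (FreeAlgebra.ι K (some x) * FreeAlgebra.ι K none) 1
  | inv_mul : AdjoinInvRel x (FreeAlgebra.ι K none * FreeAlgebra.ι K (some x)) 1

/-- The algebra `S[x⁻¹]`, generated by `S` and a two-sided inverse of `x`. -/
def AdjoinInv (x : S) : Type (max u v) := RingQuot (AdjoinInvRel K x)

instance (x : S) : Ring (AdjoinInv K x) := inferInstanceAs (Ring (RingQuot (AdjoinInvRel K x)))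

instance (x : S) : Algebra K (AdjoinInv K x) :=
  inferInstanceAs (Algebra K (RingQuot (AdjoinInvRel K x)))

/-- The quotient map. -/
def AdjoinInv.mk (x : S) : FreeAlgebra K (Option S) →ₐ[K] AdjoinInv K x :=
  RingQuot.mkAlgHom K (AdjoinInvRel K x)

theorem AdjoinInv.mk_rel (x : S) {u v : FreeAlgebra K (Option S)} (h : AdjoinInvRel K x u v) :
    AdjoinInv.mk K x u = AdjoinInv.mk K x v :=
  RingQuot.mkAlgHom_rel K h

/-- The canonical homomorphism `S → S[x⁻¹]`. -/
def AdjoinInv.of (x : S) : S →ₐ[K] AdjoinInv K x :=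
  AlgHom.ofLinearMap
    { toFun := fun s => AdjoinInv.mk K x (FreeAlgebra.ι K (some s))
      map_add' := fun s t => by
        rw [AdjoinInv.mk_rel K x (AdjoinInvRel.add s t), map_add]
      map_smul' := fun c s => by
        rw [RingHom.id_apply, Algebra.smul_def, Algebra.smul_def,
          AdjoinInv.mk_rel K x (AdjoinInvRel.mul (algebraMap K S c) s), map_mul,
          AdjoinInv.mk_rel K x (AdjoinInvRel.scalar c), AlgHom.commutes] }
    (by
      have h := AdjoinInv.mk_rel K x (AdjoinInvRel.scalar (1 : K))
      rw [map_one, map_one, map_one] at h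
      exact h)
    (fun s t => by
      have h := AdjoinInv.mk_rel K x (AdjoinInvRel.mul s t)
      rw [map_mul] at h
      exact h)

end Adjoin

section Localizations

variable {K : Type u} [Field K] {m n : ℕ}

/-- The algebra generated by the entries of the blocks and `det_q A⁻¹`. -/
abbrev LocA (q : K) (p r : Idx m n → Idx m n → K) : Type u :=
  AdjoinInv K (detEven p (blockZ q p r).toBlocks₁₁)

/-- The matrix of generators in `LocA`. -/
def zA (q : K) (p r : Idx m n → Idx m n → K) : Matrix (Idx m n) (Idx m n) (LocA q p r) :=
  (blockZ q p r).map (AdjoinInv.of K _)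

/-- The matrix `D - C A⁻¹ B` over `LocA`; `Ring.inverse` is the two-sided inverse of a unit. -/
def schurA (q : K) (p r : Idx m n → Idx m n → K) : Matrix (Fin n) (Fin n) (LocA q p r) :=
  (zA q p r).toBlocks₂₂ -
    (zA q p r).toBlocks₂₁ * Ring.inverse (zA q p r).toBlocks₁₁ * (zA q p r).toBlocks₁₂

/-- The algebra generated by the entries of the blocks, `det_q A⁻¹` and
`det_q (D - C A⁻¹ B)⁻¹`. -/
abbrev LocSchur (q : K) (p r : Idx m n → Idx m n → K) : Type u :=
  AdjoinInv K (detOdd r (schurA q p r))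

/-- The matrix of generators in `LocSchur`. -/
def zSchur (q : K) (p r : Idx m n → Idx m n → K) :
    Matrix (Idx m n) (Idx m n) (LocSchur q p r) :=
  (zA q p r).map (AdjoinInv.of K _)

/-- The algebra generated by the entries of the blocks, `det_q A⁻¹` and `det_q D⁻¹`. -/
abbrev LocAD (q : K) (p r : Idx m n → Idx m n → K) : Type u :=
  AdjoinInv K (detOdd r (zA q p r).toBlocks₂₂)

/-- The matrix of generators in `LocAD`. -/
def zAD (q : K) (p r : Idx m n → Idx m n → K) : Matrix (Idx m n) (Idx m n) (LocAD q p r) :=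
  (zA q p r).map (AdjoinInv.of K _)

end Localizations

end QSuper

end

/-! The three algebras `GLAlg`, `LocSchur` and `LocAD` turn out to represent the same functor,
sending an algebra to its invertible quantum super matrices, so they are isomorphic over the generic
matrix. For `GLAlg` this holds by construction, up to the signs relating `T` to the inverse of `Z`.
For the two localizations it rests on four facts about matrices over an arbitrary algebra.

Quantum determinants detect invertibility. Alternating row vectors `f` are those with `f (R + 1) =
0`, so `R A₁ A₂ = A₁ A₂ R` makes `f A₁ ⋯ A_k` alternating again. In degree `k` on `k` letters such
vectors form a line, on which `A₁ ⋯ A_k` acts by the determinant; Laplace expansion then gives a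
left inverse of `A` when the determinant is a unit. A right inverse comes from the transpose, a
quantum matrix for the parameters `r`. That its determinant is the same follows by cancelling the
factorial `[k]!` at `q⁻¹`, nonzero because `q` is `1` or not a root of unity. Conversely, an inverse
of `A` is a quantum matrix over the opposite algebra, and its determinant inverts that of `A`. The
odd block is covered because `-q⁻¹ R_o` is a standard Hecke matrix for `q⁻¹`.

The relations `(∗)` are equivalent to the block relations: ten of the sixteen parity patterns are
the block relations, and the other six follow from these.

The Schur complement `D - C A⁻¹ B` satisfies the same relation as `D`. Hence its determinant is a
unit exactly when it is invertible, which for invertible `A` means that `Z` is invertible.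

Finally `Z` is invertible if and only if `A` and `D` are. The entries of `B`, and likewise those of
`C`, can be straightened like odd variables, so all sufficiently long products of them vanish. If
`T` is the inverse of `Z`, then `A T₁₁ = 1 - B T₂₁`, and exchange relations move the entries of
`T₂₁` past those of `B`, so the error term is nilpotent; the other three products are treated alike.
Conversely `D - C A⁻¹ B = D (1 - D⁻¹ C A⁻¹ B)`, and the entries of `C` can be collected on the left,
which again gives a nilpotent error. -/

open scoped Kronecker

noncomputable section

namespace QSuper

universe u v w

/-! ### Coefficients of the standard Hecke `R`-matrix -/

section OrdCoeff

variable {K : Type u} [Field K] {ι : Type w} [LinearOrder ι]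

/-- The diagonal coefficient of a Hecke `R`-matrix in standard form. -/
def ordCoeff (q : K) (i j : ι) : K := if i < j then 0 else if j < i then q - 1 else (q - 1) / 2

theorem ordCoeff_of_lt (q : K) {i j : ι} (h : i < j) : ordCoeff q i j = 0 := by
  simp [ordCoeff, h]

theorem ordCoeff_of_gt (q : K) {i j : ι} (h : j < i) : ordCoeff q i j = q - 1 := by
  simp [ordCoeff, h, not_lt_of_gt h]

theorem ordCoeff_self (q : K) (i : ι) : ordCoeff q i i = (q - 1) / 2 := by
  simp [ordCoeff]

theorem one_add_ordCoeff_self [CharZero K] (q : K) (i : ι) :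
    1 + ordCoeff q i i = (q + 1) / 2 := by
  rw [ordCoeff_self]; ring

theorem one_add_ordCoeff_ne_zero [CharZero K] {q : K} (hq0 : q ≠ 0) (hq1 : 1 + q ≠ 0) (i j : ι) :
    1 + ordCoeff q i j ≠ 0 := by
  rcases lt_trichotomy i j with h | rfl | h
  · simp [ordCoeff_of_lt q h]
  · rw [one_add_ordCoeff_self, add_comm]
    exact div_ne_zero hq1 two_ne_zero
  · simpa [ordCoeff_of_gt q h] using hq0

theorem ordCoeff_add_swap [CharZero K] (q : K) (i j : ι) :
    ordCoeff q i j + ordCoeff q j i = q - 1 := by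
  rcases lt_trichotomy i j with h | rfl | h
  · simp [ordCoeff_of_lt q h, ordCoeff_of_gt q h]
  · rw [ordCoeff_self]; ring
  · simp [ordCoeff_of_lt q h, ordCoeff_of_gt q h]

theorem ordCoeff_hecke [CharZero K] (q : K) (i j : ι) :
    (1 + ordCoeff q i j) * (1 + ordCoeff q j i) - ordCoeff q i j * ordCoeff q j i = q := by
  linear_combination ordCoeff_add_swap q i j

end OrdCoeff

/-! ### Alternating functions on words -/

section Words

variable {K : Type u} [Field K] {ι : Type w}

/-- Functions on words that change by `-p_{yx}` when adjacent letters `x, y` are exchanged. -/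
def IsAlt {M : Type v} [AddCommGroup M] [Module K M] (p : ι → ι → K) (f : List ι → M) : Prop :=
  ∀ (pre : List ι) (x y : ι) (post : List ι),
    f (pre ++ y :: x :: post) = -(p y x) • f (pre ++ x :: y :: post)

variable {M : Type v} [AddCommGroup M] [Module K M] {p : ι → ι → K} {f : List ι → M}

theorem IsAlt.cons (h : IsAlt p f) (a : ι) : IsAlt p (fun l => f (a :: l)) :=
  fun pre x y post => h (a :: pre) x y post

theorem IsAlt.cons_cons_eq_zero [CharZero K] (hp1 : ∀ i, p i i = 1) (h : IsAlt p f) (x : ι)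
    (post : List ι) : f (x :: x :: post) = 0 := by
  have := h [] x x post
  rw [hp1, neg_smul, one_smul] at this
  have h2 : (2 : K) • f (x :: x :: post) = 0 := by
    rw [two_smul]; nth_rewrite 1 [← List.nil_append (x :: x :: post), this]; simp
  exact (smul_eq_zero.1 h2).resolve_left two_ne_zero

theorem IsAlt.cons_append_cons_eq_zero [CharZero K] (hp1 : ∀ i, p i i = 1) (h : IsAlt p f) (x : ι)
    (t u : List ι) : f (x :: t ++ x :: u) = 0 := by
  induction t generalizing f with
  | nil => exact h.cons_cons_eq_zero hp1 x u
  | cons y t ih =>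
    have h1 := h [] y x (t ++ x :: u)
    have h2 := ih (h.cons y)
    simp only [List.nil_append, List.cons_append] at h1 h2 ⊢
    rw [h1, h2, smul_zero]

theorem IsAlt.eq_zero_of_not_nodup [CharZero K] (hp1 : ∀ i, p i i = 1) (h : IsAlt p f)
    {l : List ι} (hl : ¬ l.Nodup) : f l = 0 := by
  classical
  induction l generalizing f with
  | nil => simp at hl
  | cons x l ih =>
    by_cases hx : x ∈ l
    · obtain ⟨t, u, rfl⟩ := List.append_of_mem hx
      exact h.cons_append_cons_eq_zero hp1 x t u
    · exact ih (h.cons x) fun hn => hl (List.nodup_cons.2 ⟨hx, hn⟩)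

variable [LinearOrder ι]

/-- The contribution of a pair of letters to the weight of a word. -/
def pairWt (c : ι → ι → K) (x y : ι) : K := if x < y then 1 else if y < x then c x y else 0

/-- The weight of a word: the product over its inversions, and `0` if a letter is repeated. -/
def wt (c : ι → ι → K) : List ι → K
  | [] => 1
  | x :: l => (l.map (pairWt c x)).prod * wt c l

theorem wt_cons (c : ι → ι → K) (x : ι) (l : List ι) :
    wt c (x :: l) = (l.map (pairWt c x)).prod * wt c l := rfl

theorem pairWt_swap (hp : ∀ i j, p i j * p j i = 1) (x y : ι) :
    pairWt (fun i j => -p i j) y x = -p y x * pairWt (fun i j => -p i j) x y := by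
  rcases lt_trichotomy x y with h | rfl | h
  · simp [pairWt, h, not_lt_of_gt h]
  · simp [pairWt]
  · simp [pairWt, h, not_lt_of_gt h, hp]

theorem wt_isAlt (hp : ∀ i j, p i j * p j i = 1) : IsAlt p (wt fun i j => -p i j) := by
  intro pre x y post
  induction pre with
  | nil =>
    simp only [List.nil_append, wt_cons, List.map_cons, List.prod_cons, smul_eq_mul,
      pairWt_swap hp x y]
    ring
  | cons a pre ih =>
    have hperm : (pre ++ y :: x :: post).Perm (pre ++ x :: y :: post) :=
      List.Perm.append_left _ (List.Perm.swap x y post)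
    simp only [List.cons_append, wt_cons, ih, (hperm.map _).prod_eq, smul_eq_mul]
    ring

theorem pairWt_ne_zero {c : ι → ι → K} (hc : ∀ i j, c i j ≠ 0) {x y : ι} (h : x ≠ y) :
    pairWt c x y ≠ 0 := by
  rcases lt_or_gt_of_ne h with h | h <;> simp [pairWt, h, not_lt_of_gt h, hc]

theorem wt_ne_zero {c : ι → ι → K} (hc : ∀ i j, c i j ≠ 0) {l : List ι} (hl : l.Nodup) :
    wt c l ≠ 0 := by
  induction l with
  | nil => simp [wt]
  | cons x l ih =>
    rw [List.nodup_cons] at hl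
    rw [wt_cons]
    refine mul_ne_zero (fun h0 => ?_) (ih hl.2)
    rw [List.prod_eq_zero_iff, List.mem_map] at h0
    obtain ⟨y, hy, h0⟩ := h0
    exact pairWt_ne_zero hc (by rintro rfl; exact hl.1 hy) h0

theorem wt_eq_zero (c : ι → ι → K) {l : List ι} (hl : ¬ l.Nodup) : wt c l = 0 := by
  induction l with
  | nil => simp at hl
  | cons x l ih =>
    rw [wt_cons]
    by_cases hx : x ∈ l
    · rw [List.prod_eq_zero (List.mem_map.2 ⟨x, hx, by simp [pairWt]⟩), zero_mul]
    · rw [ih fun hn => hl (List.nodup_cons.2 ⟨hx, hn⟩), mul_zero]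

theorem wt_eq_one (c : ι → ι → K) {l : List ι} (hl : l.Pairwise (· < ·)) : wt c l = 1 := by
  induction l with
  | nil => rfl
  | cons x l ih =>
    rw [List.pairwise_cons] at hl
    rw [wt_cons, ih hl.2, mul_one]
    refine List.prod_eq_one fun a ha => ?_
    obtain ⟨y, hy, rfl⟩ := List.mem_map.1 ha
    simp [pairWt, hl.1 y hy]

/-- Both `f` and the weight are alternating, so they change by the same factor under each adjacent
swap. The cross-multiplied form avoids dividing by a weight that may vanish. The prefix `pre` lets
the induction pass under a common first letter. -/
theorem IsAlt.wt_smul_eq_of_perm [CharZero K] (hp : ∀ i j, p i j * p j i = 1) {l l' : List ι}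
    (hl : l.Perm l') (h : IsAlt p f) (pre : List ι) :
    wt (fun i j => -p i j) (pre ++ l') • f (pre ++ l) =
      wt (fun i j => -p i j) (pre ++ l) • f (pre ++ l') := by
  have hc : ∀ i j, -p i j ≠ 0 := fun i j h0 => by
    have := hp i j
    rw [neg_eq_zero.1 h0, zero_mul] at this
    exact zero_ne_one this
  induction hl generalizing pre with
  | nil => rfl
  | @cons x l l' _ ih => simpa using ih (pre ++ [x])
  | swap x y l =>
    rw [h pre x y l, wt_isAlt hp pre x y l, smul_smul, smul_eq_mul, mul_comm]
  | @trans l₁ l₂ l₃ h₁ h₂ ih₁ ih₂ =>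
    -- The weight of the middle word can be cancelled only when it is nonzero; if a letter repeats
    -- there, it repeats in all three words and both sides vanish.
    by_cases hn : (pre ++ l₂).Nodup
    · have h2 := wt_ne_zero hc hn
      refine smul_right_injective M h2 ?_
      simp only
      rw [smul_comm, ih₁, smul_comm, ih₂, smul_comm]
    · have e1 : ¬ (pre ++ l₁).Nodup := fun h' => hn ((h₁.append_left pre).nodup_iff.1 h')
      have e3 : ¬ (pre ++ l₃).Nodup := fun h' => hn ((h₂.append_left pre).nodup_iff.2 h')
      rw [wt_eq_zero _ e1, wt_eq_zero _ e3, zero_smul, zero_smul]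

end Words

theorem finRange_perm_of_nodup {k : ℕ} {l : List (Fin k)} (hl : l.Nodup) (hk : l.length = k) :
    l.Perm (List.finRange k) := by
  refine (List.perm_ext_iff_of_nodup hl (List.nodup_finRange k)).2 fun a => ?_
  simp only [List.mem_finRange, iff_true]
  have : l.toFinset = Finset.univ := by
    rw [← Finset.card_eq_iff_eq_univ, List.toFinset_card_of_nodup hl, hk, Fintype.card_fin]
  simpa using (this ▸ Finset.mem_univ a : a ∈ l.toFinset)

/-- The top exterior power is a line: a word of length `k` in `k` letters either repeats a letter or
rearranges the increasing word, whose weight is `1`. -/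
theorem IsAlt.eq_wt_smul {K : Type u} [Field K] [CharZero K] {M : Type v} [AddCommGroup M]
    [Module K M] {k : ℕ} {p : Fin k → Fin k → K} (hp : ∀ i j, p i j * p j i = 1)
    (hp1 : ∀ i, p i i = 1) {f : List (Fin k) → M} (h : IsAlt p f) {l : List (Fin k)}
    (hl : l.length = k) : f l = wt (fun i j => -p i j) l • f (List.finRange k) := by
  by_cases hn : l.Nodup
  · have := h.wt_smul_eq_of_perm hp (finRange_perm_of_nodup hn hl) []
    simp only [List.nil_append] at this
    rwa [wt_eq_one _ (List.pairwise_lt_finRange k), one_smul] at this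
  · rw [h.eq_zero_of_not_nodup hp1 hn, wt_eq_zero _ hn, zero_smul]


/-! ### Quantum matrices acting on alternating functions -/

section QMat

variable {K : Type u} [Field K] {ι : Type w} [Fintype ι] {S : Type v} [Ring S] [Algebra K S]

/-- The sum over all words `w` of `f w` times the product of the entries `A_{w_i, j_i}`. -/
def wordSum (A : Matrix ι ι S) : List ι → (List ι → K) → S
  | [], f => algebraMap K S (f [])
  | j :: js, f => ∑ x, A x j * wordSum A js (fun l => f (x :: l))

theorem wordSum_cons (A : Matrix ι ι S) (j : ι) (js : List ι) (f : List ι → K) :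
    wordSum A (j :: js) f = ∑ x, A x j * wordSum A js (fun l => f (x :: l)) := rfl

theorem wordSum_smul (A : Matrix ι ι S) (js : List ι) (c : K) (f : List ι → K) :
    wordSum A js (fun l => c * f l) = c • wordSum A js f := by
  induction js generalizing f with
  | nil => simp [wordSum, Algebra.smul_def]
  | cons j js ih => simp [wordSum_cons, ih, Finset.smul_sum]

theorem wordSum_append_singleton (A : Matrix ι ι S) (js : List ι) (j : ι) (f : List ι → K) :
    wordSum A (js ++ [j]) f = ∑ x, wordSum A js (fun l => f (l ++ [x])) * A x j := by
  induction js generalizing f with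
  | nil =>
    simp only [List.nil_append, wordSum]
    exact Finset.sum_congr rfl fun x _ => (Algebra.commutes _ _).symm
  | cons i js ih =>
    simp only [List.cons_append, wordSum_cons, ih, Finset.mul_sum, Finset.sum_mul]
    rw [Finset.sum_comm]
    simp only [mul_assoc]

variable [LinearOrder ι]

/-- Matrices satisfying `R A₁ A₂ = A₁ A₂ R` for the standard multiparameter Hecke matrix `R`. -/
def IsQMat (q : K) (p : ι → ι → K) (A : Matrix ι ι S) : Prop :=
  ∀ i j k l, ordCoeff q k l • (A k i * A l j) + (p l k * (1 + ordCoeff q l k)) • (A l i * A k j) =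
    ordCoeff q i j • (A k i * A l j) + (p i j * (1 + ordCoeff q i j)) • (A k j * A l i)

variable [CharZero K] {q : K} {p : ι → ι → K} {A : Matrix ι ι S}

/-- Since `1 + ordCoeff q i j` never vanishes, being alternating in two adjacent places means being
killed by `R + 1` there. From `f (R + 1) = 0` it follows that `f A₁ A₂ (R + 1) = f (R + 1) A₁ A₂ =
0`. -/
theorem IsQMat.wordSum_isAlt (hq0 : q ≠ 0) (hq1 : 1 + q ≠ 0) (hp : ∀ i j, p i j * p j i = 1)
    (hA : IsQMat q p A) {f : List ι → K} (hf : IsAlt p f) :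
    IsAlt p (fun js => wordSum A js f) := by
  intro pre c d post
  induction pre generalizing f with
  | cons a pre ih =>
    simp only [List.cons_append, wordSum_cons, Finset.smul_sum]
    refine Finset.sum_congr rfl fun x _ => ?_
    have := ih (hf.cons x)
    simp only at this
    rw [this, mul_smul_comm]
  | nil =>
    simp only [List.nil_append, wordSum_cons]
    set g : ι → ι → S := fun x y => wordSum A post (fun l => f (x :: y :: l)) with hg
    have hgs : ∀ x y, g y x = -(p y x) • g x y := by
      intro x y
      simp only [hg]
      rw [← wordSum_smul]
      congr 1
      funext l
      exact hf [] x y l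
    -- One entry of `A₁ A₂ (R + 1) = (R + 1) A₁ A₂`, multiplied on the right by the remaining
    -- letters' contribution `g x y`.
    have key : ∀ x y, (1 + ordCoeff q d c) • (A x d * (A y c * g x y)) +
        ((1 + ordCoeff q d c) * p d c) • (A x c * (A y d * g x y)) =
        (1 + ordCoeff q x y) • (A x d * (A y c * g x y)) +
          (p y x * (1 + ordCoeff q y x)) • (A y d * (A x c * g x y)) := by
      intro x y
      have h := congrArg (· * g x y) (hA d c x y)
      simp only [add_mul, smul_mul_assoc, mul_assoc] at h
      rw [add_smul, add_smul, one_smul, mul_comm (1 + _) (p d c), add_assoc, ← h, add_assoc]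
    have hsum : (1 + ordCoeff q d c) • (∑ x, ∑ y, A x d * (A y c * g x y)) +
        ((1 + ordCoeff q d c) * p d c) • (∑ x, ∑ y, A x c * (A y d * g x y)) = 0 := by
      simp only [Finset.smul_sum, ← Finset.sum_add_distrib, key]
      simp only [Finset.sum_add_distrib]
      -- Exchanging the names of `x` and `y` in one of the two sums brings both to the same product
      -- of entries; the alternation `hgs` of `g` then cancels the coefficients.
      rw [add_comm, Finset.sum_comm, ← Finset.sum_add_distrib]
      refine Finset.sum_eq_zero fun x _ => ?_
      rw [← Finset.sum_add_distrib]
      refine Finset.sum_eq_zero fun y _ => ?_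
      rw [hgs x y, mul_smul_comm, mul_smul_comm, smul_smul, ← add_smul]
      have : p x y * (1 + ordCoeff q x y) * -p y x + (1 + ordCoeff q x y) = 0 := by
        linear_combination -(1 + ordCoeff q x y) * hp x y
      rw [this, zero_smul]
    rw [mul_smul, ← smul_add] at hsum
    have := (smul_eq_zero.1 hsum).resolve_left (one_add_ordCoeff_ne_zero hq0 hq1 d c)
    simp only [Finset.mul_sum]
    rw [neg_smul]
    exact eq_neg_of_add_eq_zero_left this

/-- The transpose of the Hecke matrix for `p` is the one for `r`: by `p i j * r i j = q` the
off-diagonal coefficients correspond, which is `hc`. -/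
theorem IsQMat.transpose {ι : Type w} [LinearOrder ι] {q : K} {p : ι → ι → K} {A : Matrix ι ι S}
    {r : ι → ι → K} (hp : ∀ i j, p i j * p j i = 1) (hp1 : ∀ i, p i i = 1)
    (hr : ∀ i j, r i j * r j i = 1) (hr1 : ∀ i, r i i = 1) (hpr : ∀ i j, i < j → p i j * r i j = q)
    (hA : IsQMat q p A) : IsQMat q r A.transpose := by
  have hc : ∀ k l, r l k * (1 + ordCoeff q l k) = p k l * (1 + ordCoeff q k l) := by
    intro k l
    rcases lt_trichotomy k l with h | rfl | h
    · rw [ordCoeff_of_lt q h, ordCoeff_of_gt q h]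
      linear_combination p k l * hr k l - r l k * hpr k l h
    · rw [hp1, hr1]
    · rw [ordCoeff_of_lt q h, ordCoeff_of_gt q h]
      linear_combination p k l * hpr l k h - r l k * hp k l
  intro i j k l
  simp only [Matrix.transpose_apply]
  rw [hc k l, hc j i]
  exact (hA k l i j).symm

end QMat

/-! ### Pairing of word sums and the quantum factorial -/

section Pairing

variable {K : Type u} [Field K] {S : Type v} [Ring S] [Algebra K S]

/-- The sum of the values of a function over all words of a given length. -/
def lenSum {M : Type*} [AddCommMonoid M] (ι : Type w) [Fintype ι] : ℕ → (List ι → M) → M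
  | 0, f => f []
  | n + 1, f => ∑ x, lenSum ι n (fun l => f (x :: l))

theorem lenSum_succ {M : Type*} [AddCommMonoid M] {ι : Type w} [Fintype ι] (n : ℕ)
    (f : List ι → M) : lenSum ι (n + 1) f = ∑ x, lenSum ι n (fun l => f (x :: l)) := rfl

theorem lenSum_congr {M : Type*} [AddCommMonoid M] {ι : Type w} [Fintype ι] {n : ℕ}
    {f g : List ι → M} (h : ∀ l, l.length = n → f l = g l) : lenSum ι n f = lenSum ι n g := by
  induction n generalizing f g with
  | zero => exact h [] rfl
  | succ n ih =>
    rw [lenSum_succ, lenSum_succ]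
    exact Finset.sum_congr rfl fun x _ => ih fun l hl => h (x :: l) (by simp [hl])

theorem lenSum_sum {M : Type*} [AddCommMonoid M] {ι : Type w} [Fintype ι] {κ : Type*} (t : Finset κ)
    (n : ℕ) (f : κ → List ι → M) :
    lenSum ι n (fun l => ∑ x ∈ t, f x l) = ∑ x ∈ t, lenSum ι n (f x) := by
  induction n generalizing f with
  | zero => rfl
  | succ n ih => simp only [lenSum_succ, ih]; rw [Finset.sum_comm]

theorem map_lenSum {M N : Type*} [AddCommMonoid M] [AddCommMonoid N] {ι : Type w}
    [Fintype ι] (n : ℕ) (φ : M →+ N) (f : List ι → M) :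
    lenSum ι n (fun l => φ (f l)) = φ (lenSum ι n f) := by
  induction n generalizing f with
  | zero => rfl
  | succ n ih => simp only [lenSum_succ, ih, map_sum]

theorem lenSum_eq_zero {M : Type*} [AddCommMonoid M] {ι : Type w} [Fintype ι] {n : ℕ}
    {f : List ι → M} (h : ∀ l, f l = 0) : lenSum ι n f = 0 := by
  induction n generalizing f with
  | zero => exact h []
  | succ n ih => exact Finset.sum_eq_zero fun x _ => ih fun l => h (x :: l)

/-- Both sides are the sum over pairs of words `w`, `j` of `f w`, `g j` and the product of the `A (w
i) (j i)`; the order of the factors is the same in both. -/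
theorem lenSum_smul_wordSum {ι : Type w} [Fintype ι] (A : Matrix ι ι S) (n : ℕ)
    (f g : List ι → K) :
    lenSum ι n (fun js => g js • wordSum A js f) =
      lenSum ι n (fun ws => f ws • wordSum A.transpose ws g) := by
  induction n generalizing f g with
  | zero => simp only [lenSum, wordSum, Algebra.smul_def, ← map_mul, mul_comm]
  | succ n ih =>
    simp only [lenSum_succ, wordSum_cons, Finset.smul_sum, ← mul_smul_comm, lenSum_sum]
    rw [Finset.sum_comm]
    refine Finset.sum_congr rfl fun x _ => Finset.sum_congr rfl fun j _ => ?_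
    exact (map_lenSum n (AddMonoidHom.mulLeft (A x j)) _).trans
      ((congrArg _ (ih _ _)).trans (map_lenSum n (AddMonoidHom.mulLeft (A x j)) _).symm)

theorem lenSum_succAbove {M : Type*} [AddCommMonoid M] {k : ℕ} (x : Fin (k + 1)) (n : ℕ)
    {f : List (Fin (k + 1)) → M} (hf : ∀ l, x ∈ l → f l = 0) :
    lenSum (Fin (k + 1)) n f = lenSum (Fin k) n (fun l => f (l.map x.succAbove)) := by
  induction n generalizing f with
  | zero => rfl
  | succ n ih =>
    rw [lenSum_succ, Fin.sum_univ_succAbove _ x, lenSum_eq_zero fun l => hf _ (by simp),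
      zero_add, lenSum_succ]
    exact Finset.sum_congr rfl fun y _ => ih fun l hl => hf _ (by simp [hl])

theorem pairWt_mul {ι : Type w} [LinearOrder ι] (c d : ι → ι → K) (x y : ι) :
    pairWt c x y * pairWt d x y = pairWt (fun i j => c i j * d i j) x y := by
  unfold pairWt; split_ifs <;> simp

theorem wt_mul {ι : Type w} [LinearOrder ι] (c d : ι → ι → K) (l : List ι) :
    wt c l * wt d l = wt (fun i j => c i j * d i j) l := by
  induction l with
  | nil => simp [wt]
  | cons x l ih =>
    have : (fun y => pairWt (fun i j => c i j * d i j) x y) =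
      fun y => pairWt c x y * pairWt d x y := funext fun y => (pairWt_mul c d x y).symm
    rw [wt_cons, wt_cons, wt_cons, ← ih]
    change _ = (l.map fun y => pairWt (fun i j => c i j * d i j) x y).prod * _
    rw [this, List.prod_map_mul]
    ring

theorem pairWt_congr {ι : Type w} [LinearOrder ι] {c d : ι → ι → K}
    (h : ∀ i j, j < i → c i j = d i j) : pairWt c = pairWt d := by
  funext x y
  unfold pairWt
  split_ifs with h1 h2
  · rfl
  · exact h x y h2
  · rfl

theorem wt_congr {ι : Type w} [LinearOrder ι] {c d : ι → ι → K}
    (h : ∀ i j, j < i → c i j = d i j) (l : List ι) : wt c l = wt d l := by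
  induction l with
  | nil => rfl
  | cons x l ih => rw [wt_cons, wt_cons, ih, pairWt_congr h]

theorem wt_const_map {k : ℕ} (t : K) (x : Fin (k + 1)) (l : List (Fin k)) :
    wt (fun _ _ => t) (l.map x.succAbove) = wt (fun _ _ => t) l := by
  induction l with
  | nil => rfl
  | cons y l ih =>
    rw [List.map_cons, wt_cons, wt_cons, ih, List.map_map]
    congr 3
    funext z
    simp [pairWt, Fin.succAbove_lt_succAbove_iff]

theorem prod_pairWt_succAbove {k : ℕ} (t : K) (x : Fin (k + 1)) :
    ((List.finRange k).map fun y => pairWt (fun _ _ => t) x (x.succAbove y)).prod =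
      t ^ (x : ℕ) := by
  have h : ∀ y, pairWt (fun _ _ => t) x (x.succAbove y) = if (y : ℕ) < x then t else 1 := by
    intro y
    by_cases hy : (y : ℕ) < x
    · have h2 : x.succAbove y < x := by
        rw [Fin.succAbove_lt_iff_castSucc_lt]; exact hy
      simp [pairWt, hy, h2, not_lt_of_gt h2]
    · have h2 : x < x.succAbove y := by
        rw [Fin.lt_succAbove_iff_le_castSucc]; exact not_lt.1 hy
      simp [pairWt, hy, h2]
  rw [funext h, ← List.ofFn_eq_map, List.prod_ofFn, Finset.prod_ite, Finset.prod_const,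
    Finset.prod_const_one, mul_one]
  congr 1
  rw [Fin.card_filter_val_lt]
  omega

/-- The recursion of the quantum factorial. A first letter `x` of a permutation forms an inversion
with each of the `x` smaller letters, and deleting it leaves a permutation of `k` letters with its
inversions unchanged. -/
theorem lenSum_wt_const_succ (t : K) (k : ℕ) :
    lenSum (Fin (k + 1)) (k + 1) (wt fun _ _ => t) =
      (∑ i ∈ Finset.range (k + 1), t ^ i) * lenSum (Fin k) k (wt fun _ _ => t) := by
  rw [lenSum_succ, ← Fin.sum_univ_eq_sum_range, Finset.sum_mul]
  refine Finset.sum_congr rfl fun x _ => ?_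
  have hx : ∀ l : List (Fin (k + 1)), x ∈ l → wt (fun _ _ => t) (x :: l) = 0 :=
    fun l hl => wt_eq_zero _ fun h => (List.nodup_cons.1 h).1 hl
  rw [lenSum_succAbove x k hx]
  refine Eq.trans (lenSum_congr fun l hl => ?_) (map_lenSum k (AddMonoidHom.mulLeft (t ^ (x : ℕ))) _)
  rw [wt_cons, wt_const_map, List.map_map]
  by_cases hn : l.Nodup
  · rw [((finRange_perm_of_nodup hn hl).map _).prod_eq]
    exact congrArg (· * _) (prod_pairWt_succAbove t x)
  · rw [wt_eq_zero _ hn]; simp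

/-- A vanishing factor `1 + t + ⋯ + t ^ k` would give `t ^ (k + 1) = 1`, hence `t = 1`, and then the
factor is `k + 1`, nonzero in characteristic zero. -/
theorem lenSum_wt_const_ne_zero [CharZero K] {t : K} (ht : ∀ k : ℕ, 0 < k → t ^ k = 1 → t = 1)
    (k : ℕ) : lenSum (Fin k) k (wt fun _ _ => t) ≠ 0 := by
  induction k with
  | zero => simp [lenSum, wt]
  | succ k ih =>
    rw [lenSum_wt_const_succ]
    refine mul_ne_zero (fun h0 => ?_) ih
    have h1 := ht (k + 1) k.succ_pos (by
      rw [← sub_eq_zero, ← geom_sum_mul, h0, zero_mul])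
    rw [h1] at h0
    simp at h0
    exact absurd h0 (by exact_mod_cast k.succ_ne_zero)

end Pairing

/-! ### Quantum determinants and Laplace expansion -/

section QDet

variable {K : Type u} [Field K] {S : Type v} [Ring S] [Algebra K S] {k : ℕ}

/-- The quantum determinant, as a sum over words. -/
def qdet (p : Fin k → Fin k → K) (A : Matrix (Fin k) (Fin k) S) : S :=
  wordSum A (List.finRange k) (wt fun i j => -p i j)

theorem wordSum_ofFn {ι : Type w} [Fintype ι] (A : Matrix ι ι S) {n : ℕ} (j : Fin n → ι)
    (f : List ι → K) : wordSum A (List.ofFn j) f =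
      ∑ w : Fin n → ι, algebraMap K S (f (List.ofFn w)) *
        (List.ofFn fun i => A (w i) (j i)).prod := by
  induction n generalizing f with
  | zero => simp [wordSum]
  | succ n ih =>
    rw [List.ofFn_succ, wordSum_cons, ← (Fin.consEquiv fun _ => ι).sum_comp,
      Fintype.sum_prod_type]
    refine Finset.sum_congr rfl fun x _ => ?_
    rw [ih, Finset.mul_sum]
    refine Finset.sum_congr rfl fun w _ => ?_
    simp only [Fin.consEquiv, Equiv.coe_fn_mk, List.ofFn_succ, Fin.cons_zero, Fin.cons_succ,
      List.prod_cons]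
    rw [← mul_assoc, ← mul_assoc, Algebra.commutes]

theorem wt_ofFn {ι : Type w} [LinearOrder ι] (c : ι → ι → K) {n : ℕ} (j : Fin n → ι) :
    wt c (List.ofFn j) = ∏ a, ∏ b, if a < b then pairWt c (j a) (j b) else 1 := by
  induction n with
  | zero => simp [wt]
  | succ n ih =>
    rw [List.ofFn_succ, wt_cons, ih, Fin.prod_univ_succ, Fin.prod_univ_succ, List.map_ofFn,
      List.prod_ofFn]
    simp [Fin.prod_univ_succ]

/-- Words that are not permutations have weight zero, so the sum over all words reduces to one over
permutations. -/
theorem detWith_eq_qdet (p : Fin k → Fin k → K) (A : Matrix (Fin k) (Fin k) S) :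
    detWith (fun i j => -p i j) A = qdet p A := by
  rw [qdet, ← List.ofFn_id, wordSum_ofFn, detWith]
  refine Fintype.sum_of_injective (fun σ : Equiv.Perm (Fin k) => (σ : Fin k → Fin k))
    DFunLike.coe_injective _ _ (fun w hw => ?_) fun σ => ?_
  · rw [wt_eq_zero, map_zero, zero_mul]
    rw [List.nodup_ofFn]
    exact fun h => hw ⟨Equiv.ofBijective w (Finite.injective_iff_bijective.1 h), rfl⟩
  · rw [wt_ofFn]
    congr 2
    refine Finset.prod_congr rfl fun a _ => Finset.prod_congr rfl fun b _ => ?_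
    by_cases hab : a < b
    · rcases lt_or_gt_of_ne (σ.injective.ne hab.ne) with h | h
      · simp [pairWt, hab, h, not_lt_of_gt h]
      · simp [pairWt, hab, h, not_lt_of_gt h]
    · simp [hab]

variable [CharZero K] {q : K} {p : Fin k → Fin k → K} {A : Matrix (Fin k) (Fin k) S}

theorem IsQMat.wordSum_wt (hq0 : q ≠ 0) (hq1 : 1 + q ≠ 0) (hp : ∀ i j, p i j * p j i = 1)
    (hp1 : ∀ i, p i i = 1) (hA : IsQMat q p A) {js : List (Fin k)} (hl : js.length = k) :
    wordSum A js (wt fun i j => -p i j) = wt (fun i j => -p i j) js • qdet p A :=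
  (hA.wordSum_isAlt hq0 hq1 hp (wt_isAlt hp)).eq_wt_smul hp hp1 hl

theorem length_filter_ne_finRange (i : Fin k) :
    ((List.finRange k).filter (· ≠ i)).length + 1 = k := by
  have h := (List.nodup_finRange k).filter (· ≠ i)
  rw [← List.toFinset_card_of_nodup h]
  have : ((List.finRange k).filter (· ≠ i)).toFinset = Finset.univ.erase i := by
    ext; simp
  rw [this, Finset.card_erase_of_mem (Finset.mem_univ i), Finset.card_univ, Fintype.card_fin]
  have := i.pos
  omega

/-- Laplace expansion along the last column. The word with the letter `i` omitted and `j` appended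
has a repeated letter unless `j = i`, so only the diagonal survives. -/
theorem IsQMat.exists_left (hq0 : q ≠ 0) (hq1 : 1 + q ≠ 0) (hp : ∀ i j, p i j * p j i = 1)
    (hp1 : ∀ i, p i i = 1) (hA : IsQMat q p A) :
    ∃ (Y : Matrix (Fin k) (Fin k) S) (w : Fin k → K), (∀ i, w i ≠ 0) ∧
      Y * A = Matrix.diagonal fun i => w i • qdet p A := by
  have hc : ∀ i j, -p i j ≠ 0 := fun i j h0 => by
    have := hp i j
    rw [neg_eq_zero.1 h0, zero_mul] at this
    exact zero_ne_one this
  let pre : Fin k → List (Fin k) := fun i => (List.finRange k).filter (· ≠ i)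
  refine ⟨Matrix.of fun i x => wordSum A (pre i) fun l => wt (fun i j => -p i j) (l ++ [x]),
    fun i => wt (fun i j => -p i j) (pre i ++ [i]), fun i => wt_ne_zero hc ?_, ?_⟩
  · simp [pre, List.nodup_append, (List.nodup_finRange k).filter]
  · ext i j
    rw [Matrix.mul_apply]
    simp only [Matrix.of_apply]
    rw [← wordSum_append_singleton, hA.wordSum_wt hq0 hq1 hp hp1
      (by rw [List.length_append, List.length_singleton]; exact length_filter_ne_finRange i)]
    by_cases hij : i = j
    · subst hij; rw [Matrix.diagonal_apply_eq]
    · rw [Matrix.diagonal_apply_ne _ hij, wt_eq_zero, zero_smul]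
      simp [pre, List.nodup_append, Ne.symm hij]

/-- Laplace expansion of the transpose along its first column, so that the row of `A` stands to the
left of its cofactors. -/
theorem IsQMat.exists_right {A : Matrix (Fin k) (Fin k) S} (hq0 : q ≠ 0) (hq1 : 1 + q ≠ 0)
    (hp : ∀ i j, p i j * p j i = 1)
    (hp1 : ∀ i, p i i = 1) (hA : IsQMat q p A.transpose) :
    ∃ (X : Matrix (Fin k) (Fin k) S) (w : Fin k → K), (∀ i, w i ≠ 0) ∧
      A * X = Matrix.diagonal fun i => w i • qdet p A.transpose := by
  have hc : ∀ i j, -p i j ≠ 0 := fun i j h0 => by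
    have := hp i j
    rw [neg_eq_zero.1 h0, zero_mul] at this
    exact zero_ne_one this
  let post : Fin k → List (Fin k) := fun i => (List.finRange k).filter (· ≠ i)
  refine ⟨Matrix.of fun x i =>
      wordSum A.transpose (post i) fun l => wt (fun i j => -p i j) (x :: l),
    fun i => wt (fun i j => -p i j) (i :: post i), fun i => wt_ne_zero hc ?_, ?_⟩
  · simp [post, (List.nodup_finRange k).filter]
  · ext j i
    have := hA.wordSum_wt hq0 hq1 hp hp1 (js := j :: post i)
      (by rw [List.length_cons]; exact length_filter_ne_finRange i)
    rw [wordSum_cons] at this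
    refine Eq.trans this ?_
    by_cases hij : j = i
    · subst hij; rw [Matrix.diagonal_apply_eq]
    · rw [Matrix.diagonal_apply_ne _ hij, wt_eq_zero, zero_smul]
      simp [post, hij]

theorem isUnit_diagonal_smul {d : S} (hd : IsUnit d) {w : Fin k → K} (hw : ∀ i, w i ≠ 0) :
    IsUnit (Matrix.diagonal fun i => w i • d) := by
  obtain ⟨u, rfl⟩ := hd
  refine ⟨⟨Matrix.diagonal fun i => w i • (u : S), Matrix.diagonal fun i => (w i)⁻¹ • (↑u⁻¹ : S),
    ?_, ?_⟩, rfl⟩ <;>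
  · rw [Matrix.diagonal_mul_diagonal, ← Matrix.diagonal_one]
    congr 1
    funext i
    simp [smul_smul, hw i]

/-- Pairing the two weight functions through `A` gives either determinant, times the sum over
permutations of `q⁻¹` to the number of inversions. This factorial is nonzero and cancels. -/
theorem IsQMat.qdet_transpose {r : Fin k → Fin k → K} (hq0 : q ≠ 0)
    (hq : ∀ k : ℕ, 0 < k → q ^ k = 1 → q = 1) (hq1 : 1 + q ≠ 0)
    (hp : ∀ i j, p i j * p j i = 1) (hp1 : ∀ i, p i i = 1)
    (hr : ∀ i j, r i j * r j i = 1) (hr1 : ∀ i, r i i = 1) (hpr : ∀ i j, i < j → p i j * r i j = q)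
    (hA : IsQMat q p A) : qdet r A.transpose = qdet p A := by
  have hA' := hA.transpose hp hp1 hr hr1 hpr
  have h := lenSum_smul_wordSum A k (wt fun i j => -p i j) (wt fun i j => -r i j)
  have h1 : ∀ l : List (Fin k), l.length = k →
      wt (fun i j => -r i j) l • wordSum A l (wt fun i j => -p i j) =
        wt (fun i j => -r i j * -p i j) l • qdet p A := fun l hl => by
    rw [hA.wordSum_wt hq0 hq1 hp hp1 hl, smul_smul, wt_mul]
  have h2 : ∀ l : List (Fin k), l.length = k →
      wt (fun i j => -p i j) l • wordSum A.transpose l (wt fun i j => -r i j) =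
        wt (fun i j => -p i j * -r i j) l • qdet r A.transpose := fun l hl => by
    rw [hA'.wordSum_wt hq0 hq1 hr hr1 hl, smul_smul, wt_mul]
  rw [lenSum_congr h1, lenSum_congr h2] at h
  -- An inversion has `j < i`, where `r i j * p i j` is the inverse of `p j i * r j i = q`.
  have e1 : ∀ l, wt (fun i j => -r i j * -p i j) l = wt (fun _ _ => q⁻¹) l := fun l =>
    wt_congr (fun i j hij => by
      have h1 := hp i j
      have h2 := hr i j
      have h3 := hpr j i hij
      field_simp
      linear_combination (-(p i j * r i j)) * h3 + h1 * (r i j * r j i) + h2) l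
  have e2 : ∀ l, wt (fun i j => -p i j * -r i j) l = wt (fun _ _ => q⁻¹) l := fun l => by
    rw [← e1]; simp only [mul_comm]
  simp only [e1, e2] at h
  have hsum : ∀ d : S, lenSum (Fin k) k (fun l => wt (fun _ _ => q⁻¹) l • d) =
      lenSum (Fin k) k (fun l => wt (fun _ _ => q⁻¹) l) • d := fun d =>
    map_lenSum k (LinearMap.toSpanSingleton K S d).toAddMonoidHom _
  rw [hsum, hsum] at h
  refine (smul_right_injective S (lenSum_wt_const_ne_zero (t := q⁻¹) (fun n hn h1 => ?_) k) h).symm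
  rw [inv_pow, inv_eq_one] at h1
  rw [hq n hn h1, inv_one]

end QDet

/-! ### Row vectors with noncommuting entries -/

section RowAction

variable {K : Type u} [Field K] {S : Type v} [Ring S] [Algebra K S] {ι : Type w} [Fintype ι]

/-- The row vector `f A₁ A₂ ⋯`, where `f` is a row vector on words with entries in `S`. -/
def rowAct (A : Matrix ι ι S) : (List ι → S) → List ι → S
  | f, [] => f []
  | f, j :: js => rowAct A (fun l => ∑ x, f (x :: l) * A x j) js

/-- The row vector `g ⋯ B₂ B₁`, where `g` is a row vector on words with entries in `S`. -/
def rowCoact (B : Matrix ι ι S) : (List ι → S) → List ι → S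
  | g, [] => g []
  | g, j :: js => ∑ x, rowCoact B (fun l => g (x :: l)) js * B x j

theorem rowAct_cons (A : Matrix ι ι S) (f : List ι → S) (j : ι) (js : List ι) :
    rowAct A f (j :: js) = rowAct A (fun l => ∑ x, f (x :: l) * A x j) js := rfl

theorem rowCoact_cons (B : Matrix ι ι S) (g : List ι → S) (j : ι) (js : List ι) :
    rowCoact B g (j :: js) = ∑ x, rowCoact B (fun l => g (x :: l)) js * B x j := rfl

theorem rowAct_sum {κ : Type*} (t : Finset κ) (A : Matrix ι ι S) (f : κ → List ι → S)
    (js : List ι) : rowAct A (fun l => ∑ x ∈ t, f x l) js = ∑ x ∈ t, rowAct A (f x) js := by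
  induction js generalizing f with
  | nil => rfl
  | cons j js ih =>
    simp only [rowAct_cons, Finset.sum_mul]
    rw [← ih]
    congr 1
    funext l
    rw [Finset.sum_comm]

theorem rowAct_congr (A : Matrix ι ι S) {f g : List ι → S} {js : List ι}
    (h : ∀ l, l.length = js.length → f l = g l) : rowAct A f js = rowAct A g js := by
  induction js generalizing f g with
  | nil => exact h [] rfl
  | cons j js ih =>
    refine ih fun l hl => Finset.sum_congr rfl fun x _ => ?_
    rw [h (x :: l) (by simp [hl])]

theorem rowCoact_congr (A : Matrix ι ι S) {f g : List ι → S} {js : List ι}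
    (h : ∀ l, l.length = js.length → f l = g l) : rowCoact A f js = rowCoact A g js := by
  induction js generalizing f g with
  | nil => exact h [] rfl
  | cons j js ih =>
    refine Finset.sum_congr rfl fun x _ => ?_
    rw [ih fun l hl => h (x :: l) (by simp [hl])]

theorem rowAct_algebraMap (A : Matrix ι ι S) (s : S) (f : List ι → K) (js : List ι) :
    rowAct A (fun l => s * algebraMap K S (f l)) js = s * wordSum A js f := by
  induction js generalizing f s with
  | nil => rfl
  | cons j js ih =>
    rw [rowAct_cons, rowAct_sum, wordSum_cons, Finset.mul_sum]
    refine Finset.sum_congr rfl fun x _ => ?_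
    rw [← mul_assoc, ← ih]
    simp only [mul_assoc, Algebra.commutes]

theorem rowCoact_algebraMap (B : Matrix ι ι S) (s : S) (f : List ι → K) (js : List ι) :
    rowCoact B (fun l => s * algebraMap K S (f l)) js =
      s * MulOpposite.unop (wordSum (B.map MulOpposite.op) js f) := by
  induction js generalizing f with
  | nil => rfl
  | cons j js ih =>
    rw [rowCoact_cons, wordSum_cons, Finset.unop_sum, Finset.mul_sum]
    refine Finset.sum_congr rfl fun x _ => ?_
    rw [ih, MulOpposite.unop_mul, mul_assoc]
    rfl

variable [DecidableEq ι]

/-- The factors of `B` appear in reverse order, so the innermost pair `A * B` cancels first and no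
commutation of entries is needed. -/
theorem rowCoact_rowAct {A B : Matrix ι ι S} (h : A * B = 1) (f : List ι → S) (js : List ι) :
    rowCoact B (rowAct A f) js = f js := by
  induction js generalizing f with
  | nil => rfl
  | cons j js ih =>
    rw [rowCoact_cons]
    have : ∀ x, rowCoact B (fun l => rowAct A f (x :: l)) js = ∑ y, f (y :: js) * A y x :=
      fun x => ih _
    simp only [this, Finset.sum_mul, mul_assoc]
    rw [Finset.sum_comm]
    simp only [← Finset.mul_sum]
    simp only [← Matrix.mul_apply, h]
    simp [Matrix.one_apply]

theorem rowAct_rowCoact {A B : Matrix ι ι S} (h : B * A = 1) (f : List ι → S) (js : List ι) :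
    rowAct A (rowCoact B f) js = f js := by
  induction js generalizing f with
  | nil => rfl
  | cons j js ih =>
    rw [rowAct_cons, ← ih fun l => f (j :: l)]
    congr 1
    funext l
    simp only [rowCoact_cons, Finset.sum_mul, mul_assoc]
    rw [Finset.sum_comm]
    simp only [← Finset.mul_sum]
    simp only [← Matrix.mul_apply, h]
    simp [Matrix.one_apply]

end RowAction

/-! ### Tensor legs of matrices -/

section Legs

variable {S : Type v} [Ring S] {a b c d e f : Type}

theorem kronecker_mul_kronecker_of_commute [Fintype b] [Fintype e] (X : Matrix a b S)
    (X' : Matrix b c S) (Y : Matrix d e S) (Y' : Matrix e f S)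
    (h : ∀ i j k l, Commute (Y i j) (X' k l)) :
    (X ⊗ₖ Y) * (X' ⊗ₖ Y') = (X * X') ⊗ₖ (Y * Y') := by
  ext ⟨i, j⟩ ⟨k, l⟩
  simp only [Matrix.mul_apply, Matrix.kroneckerMap_apply, Fintype.sum_prod_type,
    Finset.sum_mul_sum]
  refine Finset.sum_congr rfl fun x _ => Finset.sum_congr rfl fun y _ => ?_
  rw [mul_assoc, ← mul_assoc (Y j y), (h j y x k).eq, mul_assoc, mul_assoc]

/-- The matrix `X₁`. -/
def leg₁ (X : Matrix a b S) (c : Type) [DecidableEq c] : Matrix (a × c) (b × c) S :=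
  X ⊗ₖ (1 : Matrix c c S)

/-- The matrix `Y₂`. -/
def leg₂ (c : Type) [DecidableEq c] (Y : Matrix a b S) : Matrix (c × a) (c × b) S :=
  (1 : Matrix c c S) ⊗ₖ Y

theorem commute_one_apply [DecidableEq a] (i j : a) (x : S) : Commute ((1 : Matrix a a S) i j) x := by
  rw [Matrix.one_apply]
  split_ifs
  · exact Commute.one_left x
  · exact Commute.zero_left x

theorem leg₁_mul_leg₂ [Fintype b] [Fintype c] [DecidableEq b] [DecidableEq c] (X : Matrix a b S)
    (Y : Matrix c d S) : leg₁ X c * leg₂ b Y = X ⊗ₖ Y := by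
  unfold leg₁ leg₂
  rw [kronecker_mul_kronecker_of_commute _ _ _ _ fun i j k l => commute_one_apply i j _,
    Matrix.mul_one, Matrix.one_mul]

theorem leg₁_mul [Fintype b] [Fintype d] [DecidableEq d] (X : Matrix a b S) (Y : Matrix b c S) :
    leg₁ (X * Y) d = leg₁ X d * leg₁ Y d := by
  unfold leg₁
  rw [kronecker_mul_kronecker_of_commute _ _ _ _ fun i j k l => commute_one_apply i j _,
    Matrix.one_mul]

theorem leg₂_mul [Fintype b] [Fintype d] [DecidableEq d] (X : Matrix a b S) (Y : Matrix b c S) :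
    leg₂ d (X * Y) = leg₂ d X * leg₂ d Y := by
  unfold leg₂
  rw [kronecker_mul_kronecker_of_commute _ _ _ _ fun i j k l =>
    ((commute_one_apply k l (X i j)).symm : Commute _ ((1 : Matrix d d S) k l)), Matrix.one_mul]

theorem leg₁_one [DecidableEq a] [DecidableEq c] : leg₁ (1 : Matrix a a S) c = 1 :=
  Matrix.kroneckerMap_one_one _ (by simp) (by simp) (by simp)

theorem leg₂_one [DecidableEq a] [DecidableEq c] : leg₂ c (1 : Matrix a a S) = 1 :=
  Matrix.kroneckerMap_one_one _ (by simp) (by simp) (by simp)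

theorem leg₂_mul_leg₁_apply [Fintype a] [Fintype c] [DecidableEq a] [DecidableEq d] [Fintype d]
    (X : Matrix a b S) (Y : Matrix c d S) (k : a) (l : c) (i : b) (j : d) :
    (leg₂ a Y * leg₁ X d) (k, l) (i, j) = Y l j * X k i := by
  rw [Matrix.mul_apply, Finset.sum_eq_single (k, j)]
  · simp [leg₁, leg₂]
  · rintro ⟨x, y⟩ - h
    by_cases hx : k = x
    · subst hx
      have hy : y ≠ j := fun hy => h (by rw [hy])
      simp [leg₁, hy]
    · simp [leg₂, hx]
  · simp

end Legs

/-! ### Matrix form of the quantum matrix relations -/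

section TwoTerm

variable {K : Type u} [Field K] {S : Type v} [Ring S] [Algebra K S] {ι : Type} [Fintype ι]
  [DecidableEq ι]

/-- The matrix with entries `e_{ij} δ^k_i δ^l_j + f_{ij} δ^l_i δ^k_j`. -/
def twoTerm (e f : ι → ι → K) : Matrix (ι × ι) (ι × ι) K :=
  Matrix.of fun x y => e y.1 y.2 * (if x.1 = y.1 ∧ x.2 = y.2 then 1 else 0) +
    f y.1 y.2 * (if x.2 = y.1 ∧ x.1 = y.2 then 1 else 0)

theorem sum_twoTerm_mul (e f : ι → ι → K) (k l : ι) (g : ι → ι → S) :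
    ∑ a, ∑ s, algebraMap K S (twoTerm e f (k, l) (a, s)) * g a s =
      e k l • g k l + f l k • g l k := by
  have h1 : ∀ a s, algebraMap K S (twoTerm e f (k, l) (a, s)) * g a s =
      (if k = a then if l = s then e a s • g a s else 0 else 0) +
        (if l = a then if k = s then f a s • g a s else 0 else 0) := by
    intro a s
    simp only [twoTerm, Matrix.of_apply, map_add, map_mul, add_mul, ite_and, ← Algebra.smul_def]
    congr 1 <;> split_ifs <;> simp [Algebra.smul_def]
  simp only [h1, Finset.sum_add_distrib]
  congr 1
  · rw [Finset.sum_eq_single k (fun b _ hb => by simp [hb.symm]) (by simp)]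
    simp
  · rw [Finset.sum_eq_single l (fun b _ hb => by simp [hb.symm]) (by simp)]
    simp

theorem sum_mul_twoTerm (e f : ι → ι → K) (i j : ι) (g : ι → ι → S) :
    ∑ a, ∑ s, g a s * algebraMap K S (twoTerm e f (a, s) (i, j)) =
      e i j • g i j + f i j • g j i := by
  have h1 : ∀ a s, g a s * algebraMap K S (twoTerm e f (a, s) (i, j)) =
      (if a = i then if s = j then e i j • g a s else 0 else 0) +
        (if a = j then if s = i then f i j • g a s else 0 else 0) := by
    intro a s
    rw [← Algebra.commutes, ← Algebra.smul_def]
    simp only [twoTerm, Matrix.of_apply, add_smul]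
    congr 1
    · by_cases h1 : a = i <;> by_cases h2 : s = j <;> simp [h1, h2]
    · by_cases h1 : a = j <;> by_cases h2 : s = i <;> simp [h1, h2]
  simp only [h1, Finset.sum_add_distrib]
  congr 1
  · rw [Finset.sum_eq_single i (fun b _ hb => by simp [hb]) (by simp)]
    simp
  · rw [Finset.sum_eq_single j (fun b _ hb => by simp [hb]) (by simp)]
    simp

theorem twoTerm_mul_apply {b : Type} (e f : ι → ι → K) (M : Matrix (ι × ι) b S) (k l : ι) (y : b) :
    (sc S (twoTerm e f) * M) (k, l) y = e k l • M (k, l) y + f l k • M (l, k) y := by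
  rw [Matrix.mul_apply, Fintype.sum_prod_type]
  exact sum_twoTerm_mul e f k l fun a s => M (a, s) y

theorem mul_twoTerm_apply {b : Type} (e f : ι → ι → K) (M : Matrix b (ι × ι) S) (x : b) (i j : ι) :
    (M * sc S (twoTerm e f)) x (i, j) = e i j • M x (i, j) + f i j • M x (j, i) := by
  rw [Matrix.mul_apply, Fintype.sum_prod_type]
  exact sum_mul_twoTerm e f i j fun a s => M x (a, s)

/-- The standard multiparameter Hecke matrix. -/
abbrev heckeMat [LinearOrder ι] (q : K) (p : ι → ι → K) : Matrix (ι × ι) (ι × ι) K :=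
  twoTerm (ordCoeff q) fun i j => p i j * (1 + ordCoeff q i j)

theorem isQMat_iff [LinearOrder ι] {q : K} {p : ι → ι → K} {A : Matrix ι ι S} :
    IsQMat q p A ↔ sc S (heckeMat q p) * (A ⊗ₖ A) = (A ⊗ₖ A) * sc S (heckeMat q p) := by
  constructor
  · intro h
    ext ⟨k, l⟩ ⟨i, j⟩
    rw [twoTerm_mul_apply, mul_twoTerm_apply]
    exact h i j k l
  · intro h i j k l
    have := congrFun (congrFun h (k, l)) (i, j)
    rw [twoTerm_mul_apply, mul_twoTerm_apply] at this
    exact this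

theorem commute_of_mul_eq_one {T : Type*} [Monoid T] {x y z : T} (h : x * y = y * x)
    (h1 : y * z = 1) (h2 : z * y = 1) : z * x = x * z := by
  calc z * x = z * (x * y) * z := by rw [mul_assoc, mul_assoc, h1, mul_one]
    _ = x * z := by rw [h, ← mul_assoc, h2, one_mul]

/-- The inverse of `A₁ A₂` is `B₂ B₁`, which also commutes with `R`. Its entries are the products of
entries of `B` in reverse order, hence the opposite algebra. -/
theorem IsQMat.inv [LinearOrder ι] {q : K} {p : ι → ι → K} {A B : Matrix ι ι S}
    (hA : IsQMat q p A) (hAB : A * B = 1) (hBA : B * A = 1) :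
    IsQMat q p (B.map MulOpposite.op) := by
  rw [isQMat_iff, ← leg₁_mul_leg₂] at hA
  set R := sc S (heckeMat q p)
  have h : leg₂ ι B * leg₁ B ι * R = R * (leg₂ ι B * leg₁ B ι) := by
    have h1 : leg₁ A ι * leg₂ ι A * (leg₂ ι B * leg₁ B ι) = 1 := by
      rw [mul_assoc, ← mul_assoc (leg₂ ι A), ← leg₂_mul, hAB, leg₂_one, one_mul, ← leg₁_mul, hAB,
        leg₁_one]
    have h2 : leg₂ ι B * leg₁ B ι * (leg₁ A ι * leg₂ ι A) = 1 := by
      rw [mul_assoc, ← mul_assoc (leg₁ B ι), ← leg₁_mul, hBA, leg₁_one, one_mul, ← leg₂_mul, hBA,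
        leg₂_one]
    exact commute_of_mul_eq_one hA h1 h2
  intro i j k l
  have := congrFun (congrFun h.symm (k, l)) (i, j)
  rw [twoTerm_mul_apply, mul_twoTerm_apply] at this
  simp only [leg₂_mul_leg₁_apply] at this
  apply MulOpposite.unop_injective
  simpa using this

end TwoTerm

/-! ### Invertibility of a quantum matrix and of its determinant -/

section UnitDet

variable {K : Type u} [Field K] [CharZero K] {S : Type v} [Ring S] [Algebra K S] {k : ℕ}
  {q : K} {p r : Fin k → Fin k → K} {A B : Matrix (Fin k) (Fin k) S}

theorem IsQMat.isUnit_of_isUnit_qdet (hq0 : q ≠ 0)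
    (hq : ∀ k : ℕ, 0 < k → q ^ k = 1 → q = 1) (hq1 : 1 + q ≠ 0)
    (hp : ∀ i j, p i j * p j i = 1) (hp1 : ∀ i, p i i = 1)
    (hr : ∀ i j, r i j * r j i = 1) (hr1 : ∀ i, r i i = 1) (hpr : ∀ i j, i < j → p i j * r i j = q)
    (hA : IsQMat q p A) (hd : IsUnit (qdet p A)) : IsUnit A := by
  obtain ⟨Y, w, hw, hY⟩ := hA.exists_left hq0 hq1 hp hp1
  obtain ⟨X, w', hw', hX⟩ :=
    (hA.transpose hp hp1 hr hr1 hpr).exists_right hq0 hq1 hr hr1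
  rw [hA.qdet_transpose hq0 hq hq1 hp hp1 hr hr1 hpr] at hX
  obtain ⟨u, hu⟩ := isUnit_diagonal_smul hd hw
  obtain ⟨u', hu'⟩ := isUnit_diagonal_smul hd hw'
  rw [← hu] at hY
  rw [← hu'] at hX
  refine isUnit_iff_exists_and_exists.2 ⟨⟨X * (↑u'⁻¹ : Matrix (Fin k) (Fin k) S), ?_⟩, ⟨(↑u⁻¹ : Matrix (Fin k) (Fin k) S) * Y, ?_⟩⟩
  · rw [← mul_assoc, hX, Units.mul_inv]
  · rw [mul_assoc, hY, Units.inv_mul]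

/-- The weight vector is an eigenvector of `A₁ ⋯ A_k` and of the inverse operator `B_k ⋯ B₁`, with
eigenvalues the two determinants. Evaluating the composites at the increasing word, of weight `1`,
shows that these are inverse to each other. -/
theorem IsQMat.isUnit_qdet_of_isUnit (hq0 : q ≠ 0) (hq1 : 1 + q ≠ 0)
    (hp : ∀ i j, p i j * p j i = 1) (hp1 : ∀ i, p i i = 1) (hA : IsQMat q p A) (hu : IsUnit A) :
    IsUnit (qdet p A) := by
  obtain ⟨u, rfl⟩ := hu
  set B : Matrix (Fin k) (Fin k) S := ↑u⁻¹ with hB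
  have hB' : IsQMat q p (B.map MulOpposite.op) := hA.inv u.mul_inv u.inv_mul
  set A : Matrix (Fin k) (Fin k) S := ↑u with hA_def
  have hone : wt (fun i j => -p i j) (List.finRange k) = 1 :=
    wt_eq_one _ (List.pairwise_lt_finRange k)
  set W : List (Fin k) → S := fun l => algebraMap K S (wt (fun i j => -p i j) l) with hW
  set d := MulOpposite.unop (qdet p (B.map MulOpposite.op)) with hd
  have hact : ∀ l : List (Fin k), l.length = (List.finRange k).length →
      rowAct A W l = qdet p A * W l := fun l hl => by
    have h := rowAct_algebraMap A 1 (wt fun i j => -p i j) l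
    simp only [one_mul] at h
    rw [h, hA.wordSum_wt hq0 hq1 hp hp1 (by simpa using hl), hW, Algebra.smul_def,
      Algebra.commutes]
  have hcoact : ∀ l : List (Fin k), l.length = (List.finRange k).length →
      rowCoact B W l = d * W l := fun l hl => by
    have h := rowCoact_algebraMap B 1 (wt fun i j => -p i j) l
    simp only [one_mul] at h
    rw [h, hB'.wordSum_wt hq0 hq1 hp hp1 (by simpa using hl), hW, MulOpposite.unop_smul,
      Algebra.smul_def, Algebra.commutes]
  refine isUnit_iff_exists.2 ⟨d, ?_, ?_⟩
  · have h := rowCoact_rowAct u.mul_inv W (List.finRange k)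
    rw [rowCoact_congr _ hact, rowCoact_algebraMap, hW] at h
    simp only [hone, map_one] at h
    exact h
  · have h := rowAct_rowCoact u.inv_mul W (List.finRange k)
    rw [rowAct_congr _ hcoact, rowAct_algebraMap, hW] at h
    simp only [hone, map_one] at h
    exact h

end UnitDet

/-! ### The Schur complement -/

section Schur

theorem mul_right_cancel_of_mul_eq_one {S : Type v} [Ring S] {a b c : Type} [Fintype b] [Fintype c]
    [DecidableEq b] {M N : Matrix a b S} {U : Matrix b c S} {V : Matrix c b S}
    (hUV : U * V = 1) (h : M * U = N * U) : M = N := by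
  rw [← Matrix.mul_one M, ← hUV, ← Matrix.mul_assoc, h, Matrix.mul_assoc, hUV, Matrix.mul_one]

/-- The block relations for matrices `A, B, C, D` over a `K`-algebra, with `Q = q P⁻¹`. -/
structure BlockRelations {K : Type u} [Field K] {S : Type v} [Ring S] [Algebra K S]
    {e o : Type} [Fintype e] [Fintype o] [DecidableEq e] [DecidableEq o] (q : K)
    (R : Matrix (e × e) (e × e) S) (R' : Matrix (o × o) (o × o) S)
    (P : Matrix (o × e) (e × o) S) (Q : Matrix (e × o) (o × e) S)
    (A : Matrix e e S) (B : Matrix e o S) (C : Matrix o e S) (D : Matrix o o S) : Prop where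
  aa : R * (A ⊗ₖ A) = (A ⊗ₖ A) * R
  bb : R * (B ⊗ₖ B) = (B ⊗ₖ B) * R'
  cc : (C ⊗ₖ C) * R = R' * (C ⊗ₖ C)
  dd : R' * (D ⊗ₖ D) = (D ⊗ₖ D) * R'
  ab : R * (A ⊗ₖ B) = (B ⊗ₖ A) * P
  ac : (A ⊗ₖ C) * R = Q * (C ⊗ₖ A)
  cd : R' * (C ⊗ₖ D) = -((D ⊗ₖ C) * P)
  bd : -((B ⊗ₖ D) * R') = Q * (D ⊗ₖ B)
  ad : (A ⊗ₖ D) * Q - Q * (D ⊗ₖ A) = (q - 1) • (B ⊗ₖ C)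
  bc : (B ⊗ₖ C) * P = -(Q * (C ⊗ₖ B))

variable {K : Type u} [Field K] {S : Type v} [Ring S] [Algebra K S]
  {e o : Type} [Fintype e] [Fintype o] [DecidableEq e] [DecidableEq o] {q : K}
  {R Ri : Matrix (e × e) (e × e) S} {R' : Matrix (o × o) (o × o) S}
  {P : Matrix (o × e) (e × o) S} {Q : Matrix (e × o) (o × e) S}
  {A A' : Matrix e e S} {B : Matrix e o S} {C G : Matrix o e S} {D : Matrix o o S}

/-- The Schur complement `D - C A⁻¹ B` satisfies the same relations as `D`. -/
theorem BlockRelations.schur (h : BlockRelations q R R' P Q A B C D) (hq0 : q ≠ 0)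
    (hRRi : R * Ri = 1) (hRiR : Ri * R = 1) (hR : (q - 1) • Ri + q • (Ri * Ri) = 1)
    (hR' : R' * R' = (q - 1) • R' + q • 1) (hPQ : P * Q = q • 1)
    (hAA : A * A' = 1) (hCG : C = G * A) :
    R' * ((D - G * B) ⊗ₖ (D - G * B)) = ((D - G * B) ⊗ₖ (D - G * B)) * R' := by
  obtain ⟨aa, bb, cc, dd, ab, ac, cd, bd, ad, bc⟩ := h
  simp only [← leg₁_mul_leg₂] at *
  set T := D - G * B with hT
  have hT₁ : ∀ (c : Type) [DecidableEq c] [Fintype c], leg₁ T c = leg₁ D c - leg₁ G c * leg₁ B c := by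
    intro c _ _
    rw [← leg₁_mul, hT]
    ext ⟨i, j⟩ ⟨k, l⟩
    simp [leg₁, sub_mul]
  have hT₂ : ∀ (c : Type) [DecidableEq c] [Fintype c], leg₂ c T = leg₂ c D - leg₂ c G * leg₂ c B := by
    intro c _ _
    rw [← leg₂_mul, hT]
    ext ⟨i, j⟩ ⟨k, l⟩
    simp [leg₂, mul_sub]
  have hC₁ : ∀ (c : Type) [DecidableEq c] [Fintype c], leg₁ C c = leg₁ G c * leg₁ A c := by
    intro c _ _; rw [hCG, leg₁_mul]
  have hC₂ : ∀ (c : Type) [DecidableEq c] [Fintype c], leg₂ c C = leg₂ c G * leg₂ c A := by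
    intro c _ _; rw [hCG, leg₂_mul]
  have hA₁ : ∀ (c : Type) [DecidableEq c] [Fintype c], leg₁ A c * leg₁ A' c = 1 := by
    intro c _ _; rw [← leg₁_mul, hAA, leg₁_one]
  have hA₂ : ∀ (c : Type) [DecidableEq c] [Fintype c], leg₂ c A * leg₂ c A' = 1 := by
    intro c _ _; rw [← leg₂_mul, hAA, leg₂_one]
  have hAinv : (leg₁ A e * leg₂ e A) * (leg₂ e A' * leg₁ A' e) = 1 := by
    rw [Matrix.mul_assoc, ← Matrix.mul_assoc (leg₂ e A), hA₂, Matrix.one_mul, hA₁]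
  -- exchanging `G` with `A` and with `B`
  have ag : leg₁ A o * leg₂ e G = Q * (leg₁ G e * (Ri * leg₁ A e)) := by
    refine mul_right_cancel_of_mul_eq_one (hA₂ e) (mul_right_cancel_of_mul_eq_one hRRi ?_)
    rw [Matrix.mul_assoc (leg₁ A o), ← hC₂, ac, hC₁]
    simp only [Matrix.mul_assoc] at aa ⊢
    rw [← aa, ← Matrix.mul_assoc Ri, hRiR, Matrix.one_mul]
  have bg : leg₁ B o * leg₂ o G = -(Q * (leg₁ G e * (Ri * leg₁ B e))) := by
    refine mul_right_cancel_of_mul_eq_one (hA₂ o) ?_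
    have hPQ' : P * (q⁻¹ • Q) = 1 := by
      rw [Matrix.mul_smul, hPQ, smul_smul, inv_mul_cancel₀ hq0, one_smul]
    refine mul_right_cancel_of_mul_eq_one hPQ' ?_
    rw [Matrix.mul_assoc (leg₁ B o), ← hC₂, bc, hC₁]
    simp only [Matrix.mul_assoc, Matrix.neg_mul] at ab ⊢
    rw [← ab, ← Matrix.mul_assoc Ri, hRiR, Matrix.one_mul]
  -- exchanging the Schur complement with `A`, `B` and `G`
  have at' : leg₁ A o * leg₂ e T * Q = Q * (leg₁ T e * leg₂ o A) := by
    have h1 : leg₁ A o * leg₂ e G * leg₂ e B * Q =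
        q • (Q * (leg₁ G e * (Ri * (Ri * (leg₁ B e * leg₂ o A))))) := by
      rw [ag]
      simp only [Matrix.mul_assoc] at ab ⊢
      rw [← Matrix.one_mul (leg₁ A e * _), ← hRiR, Matrix.mul_assoc Ri,
        ← Matrix.mul_assoc (leg₁ A e), ← Matrix.mul_assoc R, ab]
      simp only [Matrix.mul_assoc, hPQ, Matrix.mul_smul, Matrix.mul_one]
    have h2 : leg₁ B o * leg₂ o C = -(Q * (leg₁ G e * (Ri * (leg₁ B e * leg₂ o A)))) := by
      rw [hC₂, ← Matrix.mul_assoc, bg]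
      simp only [Matrix.mul_assoc, Matrix.neg_mul]
    rw [hT₁, hT₂, Matrix.mul_sub, Matrix.sub_mul, Matrix.sub_mul, Matrix.mul_sub,
      ← Matrix.mul_assoc (leg₁ A o), h1]
    rw [h2] at ad
    -- The Hecke relation in the form `(q - 1) R⁻¹ + q R⁻² = 1` makes the correction term `(q - 1)
    -- B₁ C₂` of the relation between `A` and `D` disappear.
    have h3 : Q * (leg₁ G e * (leg₁ B e * leg₂ o A)) =
        (q - 1) • (Q * (leg₁ G e * (Ri * (leg₁ B e * leg₂ o A)))) +
          q • (Q * (leg₁ G e * (Ri * (Ri * (leg₁ B e * leg₂ o A))))) := by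
      conv_lhs => rw [← Matrix.one_mul (leg₁ B e * leg₂ o A), ← hR]
      simp only [Matrix.add_mul, Matrix.mul_add, Matrix.smul_mul, Matrix.mul_smul, Matrix.mul_assoc]
    rw [Matrix.mul_assoc (leg₁ G e), h3, sub_eq_iff_eq_add.1 ad, smul_neg]
    abel
  have bt : leg₁ B o * leg₂ o T * R' = -(Q * (leg₁ T e * leg₂ o B)) := by
    have h1 : leg₁ B o * leg₂ o G * leg₂ o B * R' =
        -(Q * (leg₁ G e * (leg₁ B e * leg₂ o B))) := by
      rw [bg]
      simp only [Matrix.mul_assoc, Matrix.neg_mul] at bb ⊢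
      rw [← bb, ← Matrix.mul_assoc Ri, hRiR, Matrix.one_mul]
    rw [hT₁, hT₂, Matrix.mul_sub, Matrix.sub_mul, Matrix.sub_mul, Matrix.mul_sub,
      ← Matrix.mul_assoc (leg₁ B o), h1, ← bd, Matrix.mul_assoc (leg₁ G e)]
    abel
  have gc : leg₁ G o * (Q * leg₁ C e) = R' * (leg₁ C o * leg₂ e G) := by
    refine mul_right_cancel_of_mul_eq_one (hA₂ e) ?_
    have h1 := congrArg (leg₁ G o * ·) ac
    rw [← Matrix.mul_assoc, ← Matrix.mul_assoc (leg₁ G o), ← hC₁, cc] at h1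
    simp only [Matrix.mul_assoc] at h1 ⊢
    rw [← h1, ← hC₂]
  have tc : leg₁ T o * leg₂ o C * P = -(R' * (leg₁ C o * leg₂ e T)) := by
    rw [hT₁, hT₂, Matrix.sub_mul, Matrix.sub_mul, Matrix.mul_sub, Matrix.mul_sub,
      Matrix.mul_assoc (leg₁ G o), Matrix.mul_assoc (leg₁ G o), bc, cd, Matrix.mul_neg,
      ← Matrix.mul_assoc Q, ← Matrix.mul_assoc (leg₁ G o), gc]
    simp only [Matrix.mul_assoc]
    abel
  have tg : q • (leg₁ T o * leg₂ o G) = -(R' * (leg₁ G o * (Q * leg₁ T e))) := by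
    refine mul_right_cancel_of_mul_eq_one (hA₂ o) ?_
    have h1 := congrArg (· * Q) tc
    rw [Matrix.mul_assoc _ P, hPQ, Matrix.mul_smul, Matrix.mul_one, hC₂, hC₁] at h1
    simp only [Matrix.mul_assoc, Matrix.neg_mul, Matrix.smul_mul] at h1 at' ⊢
    rw [h1, at']
  -- The relation `cc` with `C = G A` substituted, and `A₁ A₂` cancelled.
  have gg : R' * (leg₁ G o * (Q * leg₁ G e)) * Ri = leg₁ G o * (Q * leg₁ G e) := by
    refine mul_right_cancel_of_mul_eq_one hAinv ?_
    have h1 : leg₁ C o * leg₂ e C = leg₁ G o * (Q * leg₁ G e) * Ri * (leg₁ A e * leg₂ e A) := by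
      rw [hC₁, hC₂, Matrix.mul_assoc (leg₁ G o), ← Matrix.mul_assoc (leg₁ A o), ag]
      simp only [Matrix.mul_assoc]
    rw [h1, Matrix.mul_assoc _ _ R, ← aa, ← Matrix.mul_assoc, Matrix.mul_assoc _ Ri R, hRiR,
      Matrix.mul_one] at cc
    rw [cc]
    simp only [Matrix.mul_assoc]
  -- In these terms `q T₁ T₂ = q D₁ D₂ - (q Y + R' Y R') + R' W R'`, and each of the three summands
  -- commutes with `R'`.
  set Y := leg₁ G o * (leg₁ B o * leg₂ o D) with hY
  set W := leg₁ G o * (leg₁ B o * leg₂ o G * leg₂ o B) with hW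
  have hWR : R' * W = W * R' := by
    have h1 : W = -(leg₁ G o * (Q * leg₁ G e) * Ri * (leg₁ B e * leg₂ o B)) := by
      rw [hW, bg]
      simp only [Matrix.mul_assoc, Matrix.neg_mul, Matrix.mul_neg]
    rw [h1, Matrix.mul_neg, Matrix.neg_mul, ← Matrix.mul_assoc R', ← Matrix.mul_assoc R', gg,
      Matrix.mul_assoc _ _ R', ← bb, Matrix.mul_assoc _ Ri, ← Matrix.mul_assoc Ri,
      hRiR, Matrix.one_mul]
  have hX : q • (leg₁ T o * leg₂ o T) =
      q • (leg₁ D o * leg₂ o D) - q • Y - R' * Y * R' + R' * W * R' := by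
    have h1 : q • (leg₁ T o * leg₂ o G * leg₂ o B) =
        R' * (leg₁ G o * (leg₁ B o * leg₂ o T * R')) := by
      rw [← Matrix.smul_mul, tg, bt]
      simp only [Matrix.mul_assoc, Matrix.neg_mul, Matrix.mul_neg]
    have h2 : leg₁ T o * leg₂ o D = leg₁ D o * leg₂ o D - Y := by
      rw [hT₁, Matrix.sub_mul, Matrix.mul_assoc]
    have h3 : R' * (leg₁ G o * (leg₁ B o * leg₂ o T * R')) = R' * Y * R' - R' * W * R' := by
      rw [hT₂, hY, hW]
      simp only [Matrix.mul_sub, Matrix.sub_mul, Matrix.mul_assoc]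
    conv_lhs => rw [hT₂ o, Matrix.mul_sub, ← Matrix.mul_assoc, smul_sub, h1, h2, h3]
    rw [smul_sub]
    abel
  refine smul_right_injective _ hq0 ?_
  simp only
  rw [← Matrix.mul_smul, ← Matrix.smul_mul q (leg₁ T o * leg₂ o T), hX]
  -- This holds for every `Y`, by the quadratic relation of `R'` alone: it is an averaging over the
  -- Hecke algebra of rank two.
  have hYR : R' * (q • Y + R' * Y * R') = (q • Y + R' * Y * R') * R' := by
    have h1 : R' * (R' * Y * R') = (q - 1) • (R' * Y * R') + q • (Y * R') := by
      rw [← mul_assoc, ← mul_assoc, hR']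
      simp only [add_mul, smul_mul_assoc, one_mul]
    have h2 : R' * Y * R' * R' = (q - 1) • (R' * Y * R') + q • (R' * Y) := by
      rw [mul_assoc, hR']
      simp only [mul_add, mul_smul_comm, mul_one]
    rw [mul_add, add_mul, h1, h2, mul_smul_comm, smul_mul_assoc]
    abel
  have hDR : R' * (q • (leg₁ D o * leg₂ o D)) = q • (leg₁ D o * leg₂ o D) * R' := by
    rw [mul_smul_comm, dd, smul_mul_assoc]
  have hWR' : R' * (R' * W * R') = R' * W * R' * R' := by
    rw [hWR, mul_assoc, mul_assoc, ← mul_assoc R', hWR, mul_assoc, mul_assoc]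
  rw [sub_sub, mul_add, add_mul, mul_sub, sub_mul, hYR, hDR, hWR']

end Schur

/-- The standing hypotheses on the parameters. -/
structure IsParam {K : Type u} [Field K] {m n : ℕ} (q : K) (p r : Idx m n → Idx m n → K) : Prop where
  q0 : q ≠ 0
  hq : ∀ k : ℕ, 0 < k → q ^ k = 1 → q = 1
  p0 : ∀ i j, p i j ≠ 0
  pinv : ∀ i j, p j i = (p i j)⁻¹
  p1 : ∀ i, p i i = 1
  r0 : ∀ i j, r i j ≠ 0
  rinv : ∀ i j, r j i = (r i j)⁻¹
  r1 : ∀ i, r i i = 1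
  pr : ∀ i j, toLex i < toLex j → p i j * r i j = q

/-! ### The super `R`-matrix and the equivalence of `(∗)` with the block relations -/

section

variable {K : Type u} [Field K] [CharZero K] {m n : ℕ} {q : K} {p r : Idx m n → Idx m n → K}

theorem ordCoeff_swap {ι : Type w} [LinearOrder ι] (q : K) (i j : ι) :
    ordCoeff q j i = q - 1 - ordCoeff q i j :=
  eq_sub_of_add_eq' (ordCoeff_add_swap q i j)

theorem IsParam.one_add_ne (h : IsParam q p r) : 1 + q ≠ 0 := by
  intro h0
  have h1 : q = -1 := by linear_combination h0
  have h2 := h.hq 2 two_pos (by rw [h1]; norm_num)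
  rw [h2] at h1
  norm_num at h1

theorem IsParam.p_mul (h : IsParam q p r) (i j : Idx m n) : p i j * p j i = 1 := by
  rw [h.pinv i j, mul_inv_cancel₀ (h.p0 i j)]

theorem IsParam.r_mul (h : IsParam q p r) (i j : Idx m n) : r i j * r j i = 1 := by
  rw [h.rinv i j, mul_inv_cancel₀ (h.r0 i j)]

/-- The diagonal coefficients of `RMat`. -/
def superCoeff (q : K) (i j : Idx m n) : K := ordCoeff q (toLex i) (toLex j)

@[simp] theorem superCoeff_inl_inl (q : K) (i j : Fin m) :
    superCoeff q (Sum.inl i : Idx m n) (Sum.inl j) = ordCoeff q i j := by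
  simp [superCoeff, ordCoeff]

@[simp] theorem superCoeff_inr_inr (q : K) (i j : Fin n) :
    superCoeff q (Sum.inr i : Idx m n) (Sum.inr j) = ordCoeff q i j := by
  simp [superCoeff, ordCoeff]

@[simp] theorem superCoeff_inl_inr (q : K) (i : Fin m) (j : Fin n) :
    superCoeff q (Sum.inl i : Idx m n) (Sum.inr j) = 0 := by
  simp [superCoeff, ordCoeff]

@[simp] theorem superCoeff_inr_inl (q : K) (i : Fin m) (j : Fin n) :
    superCoeff q (Sum.inr j : Idx m n) (Sum.inl i) = q - 1 := by
  simp [superCoeff, ordCoeff]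

/-- The product `p i j * r i j` is `q`, `1` or `q⁻¹` according to the order of `i` and `j`, so the
fractions simplify. -/
theorem IsParam.coeff_eq (h : IsParam q p r) (i j : Idx m n) :
    (q - p i j * r i j) / (1 + p i j * r i j) = superCoeff q i j ∧
      p i j * (q + 1) / (1 + p i j * r i j) = p i j * (1 + superCoeff q i j) := by
  have h1 := h.one_add_ne
  have h0 := h.q0
  rcases lt_trichotomy (toLex i) (toLex j) with hij | hij | hij
  · rw [h.pr i j hij, superCoeff, ordCoeff_of_lt q hij]
    constructor <;> field_simp <;> ring
  · obtain rfl : i = j := toLex.injective hij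
    rw [superCoeff, ordCoeff_self, h.p1, h.r1]
    constructor <;> norm_num <;> ring
  · have h2 : p i j * r i j = q⁻¹ := by
      rw [h.pinv j i, h.rinv j i, ← mul_inv, h.pr j i hij]
    rw [h2, superCoeff, ordCoeff_of_gt q hij]
    have h3 : q + 1 ≠ 0 := by rwa [add_comm]
    constructor <;> field_simp <;> ring

theorem IsParam.RMat_eq (h : IsParam q p r) : RMat q p r =
    twoTerm (superCoeff q) fun i j => (-1) ^ (par i * par j) * (p i j * (1 + superCoeff q i j)) := by
  ext ⟨k, l⟩ ⟨i, j⟩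
  simp only [RMat, twoTerm, Matrix.of_apply]
  rw [(h.coeff_eq i j).1, (h.coeff_eq i j).2]

theorem IsParam.Re_eq (h : IsParam q p r) :
    Re q p r = heckeMat q fun i j => p (Sum.inl i) (Sum.inl j) := by
  ext ⟨k, l⟩ ⟨i, j⟩
  simp [Re, h.RMat_eq, twoTerm, par]

theorem IsParam.Ro_eq (h : IsParam q p r) : Ro q p r = twoTerm (ordCoeff q) fun i j =>
    -(p (Sum.inr i) (Sum.inr j) * (1 + ordCoeff q i j)) := by
  ext ⟨k, l⟩ ⟨i, j⟩
  simp [Ro, h.RMat_eq, twoTerm, par]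

variable {S : Type v} [Ring S] [Algebra K S]

theorem mul_PMat_apply {b : Type} (M : Matrix b (Fin n × Fin m) S) (x : b) (i : Fin m) (j : Fin n) :
    (M * sc S (PMat p)) x (i, j) = p (Sum.inl i) (Sum.inr j) • M x (j, i) := by
  rw [Matrix.mul_apply, Finset.sum_eq_single (j, i)]
  · simp [PMat, Algebra.smul_def, Algebra.commutes]
  · rintro ⟨a, c⟩ - hac
    have : ¬ (c = i ∧ a = j) := fun h => hac (by rw [h.1, h.2])
    simp [PMat, this]
  · simp

theorem PInv_mul_apply {b : Type} (M : Matrix (Fin n × Fin m) b S) (k : Fin m) (l : Fin n) (y : b) :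
    (sc S (q • PInv p) * M) (k, l) y = (q * (p (Sum.inl k) (Sum.inr l))⁻¹) • M (l, k) y := by
  rw [Matrix.mul_apply, Finset.sum_eq_single (l, k)]
  · simp [PInv, Algebra.smul_def]
  · rintro ⟨a, c⟩ - hac
    have : ¬ (k = c ∧ l = a) := fun h => hac (by rw [h.1, h.2])
    simp [PInv, this]
  · simp

theorem mul_PInv_apply {b : Type} (M : Matrix b (Fin m × Fin n) S) (x : b) (i : Fin m) (j : Fin n) :
    (M * sc S (q • PInv p)) x (j, i) = (q * (p (Sum.inl i) (Sum.inr j))⁻¹) • M x (i, j) := by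
  rw [Matrix.mul_apply, Finset.sum_eq_single (i, j)]
  · simp only [PInv, Matrix.map_apply, Matrix.smul_apply, Matrix.of_apply, and_self, if_true,
      smul_eq_mul]
    rw [← Algebra.commutes, Algebra.smul_def]
  · rintro ⟨a, c⟩ - hac
    have : ¬ (a = i ∧ c = j) := fun h => hac (by rw [h.1, h.2])
    simp [PInv, this]
  · simp

theorem IsParam.zLHS_eq (h : IsParam q p r) (Z : Matrix (Idx m n) (Idx m n) S) (i j k l : Idx m n) :
    zLHS q p r Z i j k l =
      ((-1) ^ (par l * (par i + par k)) * superCoeff q k l) • (Z k i * Z l j) +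
      ((-1) ^ (par k * (par i + par l)) * ((-1) ^ (par l * par k) *
        (p l k * (1 + superCoeff q l k)))) • (Z l i * Z k j) := by
  have h1 : ∀ a s, ((-1) ^ (par s * (par i + par a)) *
      (algebraMap K S (RMat q p r (k, l) (a, s)) * (Z a i * Z s j)) : S) =
      algebraMap K S (RMat q p r (k, l) (a, s)) *
        (((-1) ^ (par s * (par i + par a)) : K) • (Z a i * Z s j)) := by
    intro a s
    rw [mul_smul_comm, Algebra.smul_def]
    simp
  simp only [zLHS, h1]
  rw [h.RMat_eq, sum_twoTerm_mul, smul_smul, smul_smul]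
  congr 2 <;> ring

theorem IsParam.zRHS_eq (h : IsParam q p r) (Z : Matrix (Idx m n) (Idx m n) S) (i j k l : Idx m n) :
    zRHS q p r Z i j k l =
      ((-1) ^ (par l * (par i + par k)) * superCoeff q i j) • (Z k i * Z l j) +
      ((-1) ^ (par l * (par j + par k)) * ((-1) ^ (par i * par j) *
        (p i j * (1 + superCoeff q i j)))) • (Z k j * Z l i) := by
  have h1 : ∀ a s, ((-1) ^ (par l * (par a + par k)) *
      ((Z k a * Z l s) * algebraMap K S (RMat q p r (a, s) (i, j))) : S) =
        (((-1) ^ (par l * (par a + par k)) : K) • (Z k a * Z l s)) *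
      algebraMap K S (RMat q p r (a, s) (i, j)) := by
    intro a s
    rw [smul_mul_assoc, Algebra.smul_def]
    simp
  simp only [zRHS, h1]
  rw [h.RMat_eq, sum_mul_twoTerm, smul_smul, smul_smul]
  congr 2 <;> ring

theorem IsQuantumSuperMatrix.blockRelations (h : IsParam q p r)
    {Z : Matrix (Idx m n) (Idx m n) S} (hZ : IsQuantumSuperMatrix q p r Z) :
    BlockRelations q (sc S (Re q p r)) (sc S (Ro q p r)) (sc S (PMat p)) (sc S (q • PInv p))
      Z.toBlocks₁₁ Z.toBlocks₁₂ Z.toBlocks₂₁ Z.toBlocks₂₂ := by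
  have hZ' : ∀ i j k l, _ = _ := fun i j k l =>
    ((h.zLHS_eq Z i j k l).symm.trans (hZ i j k l)).trans (h.zRHS_eq Z i j k l)
  have hp : ∀ (k : Fin m) (l : Fin n), p (Sum.inr l) (Sum.inl k) =
    (p (Sum.inl k) (Sum.inr l))⁻¹ := fun k l => h.pinv _ _
  rw [h.Re_eq, h.Ro_eq]
  constructor
  · ext ⟨k, l⟩ ⟨i, j⟩
    have h1 := hZ' (Sum.inl i) (Sum.inl j) (Sum.inl k) (Sum.inl l)
    simp [par] at h1
    rw [twoTerm_mul_apply, mul_twoTerm_apply]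
    simpa [Matrix.toBlocks₁₁] using h1
  · ext ⟨k, l⟩ ⟨i, j⟩
    have h1 := hZ' (Sum.inr i) (Sum.inr j) (Sum.inl k) (Sum.inl l)
    simp [par] at h1
    rw [twoTerm_mul_apply, mul_twoTerm_apply]
    simpa [Matrix.toBlocks₁₂] using h1
  · ext ⟨k, l⟩ ⟨i, j⟩
    have h1 := hZ' (Sum.inl i) (Sum.inl j) (Sum.inr k) (Sum.inr l)
    simp [par] at h1
    rw [twoTerm_mul_apply, mul_twoTerm_apply]
    simp [Matrix.toBlocks₂₁]
    linear_combination (norm := module) h1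
  · ext ⟨k, l⟩ ⟨i, j⟩
    have h1 := hZ' (Sum.inr i) (Sum.inr j) (Sum.inr k) (Sum.inr l)
    simp [par] at h1
    rw [twoTerm_mul_apply, mul_twoTerm_apply]
    simp [Matrix.toBlocks₂₂]
    linear_combination (norm := module) h1
  · ext ⟨k, l⟩ ⟨i, j⟩
    have h1 := hZ' (Sum.inl i) (Sum.inr j) (Sum.inl k) (Sum.inl l)
    simp [par] at h1
    rw [twoTerm_mul_apply, mul_PMat_apply]
    simpa [Matrix.toBlocks₁₂, Matrix.toBlocks₁₁] using h1
  · ext ⟨k, l⟩ ⟨i, j⟩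
    have h1 := hZ' (Sum.inl i) (Sum.inl j) (Sum.inl k) (Sum.inr l)
    simp [par, hp] at h1
    rw [mul_twoTerm_apply, PInv_mul_apply]
    simp [Matrix.toBlocks₂₁, Matrix.toBlocks₁₁]
    linear_combination (norm := module) -h1
  · ext ⟨k, l⟩ ⟨i, j⟩
    have h1 := hZ' (Sum.inl i) (Sum.inr j) (Sum.inr k) (Sum.inr l)
    simp [par] at h1
    rw [twoTerm_mul_apply, Matrix.neg_apply, mul_PMat_apply]
    simp [Matrix.toBlocks₂₁, Matrix.toBlocks₂₂]
    linear_combination (norm := module) -h1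
  · ext ⟨k, l⟩ ⟨i, j⟩
    have h1 := hZ' (Sum.inr i) (Sum.inr j) (Sum.inl k) (Sum.inr l)
    simp [par, hp] at h1
    rw [Matrix.neg_apply, mul_twoTerm_apply, PInv_mul_apply]
    simp [Matrix.toBlocks₁₂, Matrix.toBlocks₂₂]
    linear_combination (norm := module) -h1
  · ext ⟨k, l⟩ ⟨j, i⟩
    have h1 := hZ' (Sum.inr j) (Sum.inl i) (Sum.inl k) (Sum.inr l)
    simp [par, hp] at h1
    rw [Matrix.sub_apply, mul_PInv_apply, PInv_mul_apply]
    simp [Matrix.toBlocks₁₂, Matrix.toBlocks₂₂, Matrix.toBlocks₁₁, Matrix.toBlocks₂₁]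
    linear_combination (norm := module) -h1
  · ext ⟨k, l⟩ ⟨i, j⟩
    have h1 := hZ' (Sum.inl i) (Sum.inr j) (Sum.inl k) (Sum.inr l)
    simp [par, hp] at h1
    rw [Matrix.neg_apply, mul_PMat_apply, PInv_mul_apply]
    simp [Matrix.toBlocks₁₂, Matrix.toBlocks₂₁]
    linear_combination (norm := module) h1

/-- Ten parity patterns of `(k, l, i, j)` are block relations up to sign and side. The other six
have an odd index before an even one in `(k, l)` or `(i, j)`, and are linear combinations of one or
two entries of block relations. -/
theorem BlockRelations.isQuantumSuperMatrix (h : IsParam q p r)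
    {Z : Matrix (Idx m n) (Idx m n) S}
    (hZ : BlockRelations q (sc S (Re q p r)) (sc S (Ro q p r)) (sc S (PMat p)) (sc S (q • PInv p))
      Z.toBlocks₁₁ Z.toBlocks₁₂ Z.toBlocks₂₁ Z.toBlocks₂₂) : IsQuantumSuperMatrix q p r Z := by
  obtain ⟨aa, bb, cc, dd, ab, ac, cd, bd, ad, bc⟩ := hZ
  have hp : ∀ (k : Fin m) (l : Fin n), p (Sum.inr l) (Sum.inl k) =
    (p (Sum.inl k) (Sum.inr l))⁻¹ := fun k l => h.pinv _ _
  have hq0 := h.q0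
  rw [h.Re_eq] at aa bb cc ab ac
  rw [h.Ro_eq] at bb cc dd cd bd
  intro i j k l
  rw [h.zLHS_eq, h.zRHS_eq]
  rcases k with k | k <;> rcases l with l | l <;> rcases i with i | i <;> rcases j with j | j
  · have h1 := congrFun (congrFun aa (k, l)) (i, j)
    rw [twoTerm_mul_apply, mul_twoTerm_apply] at h1
    simp [Matrix.toBlocks₁₁] at h1
    simp [par]
    linear_combination (norm := module) h1
  · have h1 := congrFun (congrFun ab (k, l)) (i, j)
    rw [twoTerm_mul_apply, mul_PMat_apply] at h1
    simp [Matrix.toBlocks₁₁, Matrix.toBlocks₁₂] at h1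
    simp [par]
    linear_combination (norm := module) h1
  -- The pattern with `i` odd and `j` even solves `ab` for the product in the other order, which
  -- amounts to inverting `R_e` on the two rows `(k, l)` and `(l, k)`.
  · have h1 := congrFun (congrFun ab (k, l)) (j, i)
    have h2 := congrFun (congrFun ab (l, k)) (j, i)
    rw [twoTerm_mul_apply, mul_PMat_apply] at h1 h2
    simp [Matrix.toBlocks₁₁, Matrix.toBlocks₁₂] at h1 h2
    simp [par, hp]
    have ha := h.p0 (Sum.inl k) (Sum.inl l)
    have hb := h.p0 (Sum.inl j) (Sum.inr i)
    rw [h.pinv (Sum.inl k) (Sum.inl l), ordCoeff_swap q k l]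
      at h1 ⊢
    rw [ordCoeff_swap q k l] at h2
    linear_combination (norm := (match_scalars <;> field_simp <;> ring))
      (-((ordCoeff q k l - (q - 1)) * (p (Sum.inl j) (Sum.inr i))⁻¹)) • h1 -
        ((p (Sum.inl k) (Sum.inl l))⁻¹ * (q - ordCoeff q k l) *
          (p (Sum.inl j) (Sum.inr i))⁻¹) • h2
  · have h1 := congrFun (congrFun bb (k, l)) (i, j)
    rw [twoTerm_mul_apply, mul_twoTerm_apply] at h1
    simp [Matrix.toBlocks₁₂] at h1
    simp [par]
    linear_combination (norm := module) h1
  · have h1 := congrFun (congrFun ac (k, l)) (i, j)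
    rw [mul_twoTerm_apply, PInv_mul_apply] at h1
    simp [Matrix.toBlocks₂₁, Matrix.toBlocks₁₁] at h1
    simp [par, hp]
    linear_combination (norm := module) -h1
  · have h1 := congrFun (congrFun bc (k, l)) (i, j)
    rw [Matrix.neg_apply, mul_PMat_apply, PInv_mul_apply] at h1
    simp [Matrix.toBlocks₁₂, Matrix.toBlocks₂₁] at h1
    simp [par, hp]
    linear_combination (norm := module) h1
  · have h1 := congrFun (congrFun ad (k, l)) (i, j)
    rw [Matrix.sub_apply, mul_PInv_apply, PInv_mul_apply] at h1
    simp [Matrix.toBlocks₁₂, Matrix.toBlocks₂₂, Matrix.toBlocks₁₁, Matrix.toBlocks₂₁] at h1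
    simp [par, hp]
    linear_combination (norm := module) -h1
  · have h1 := congrFun (congrFun bd (k, l)) (i, j)
    rw [Matrix.neg_apply, mul_twoTerm_apply, PInv_mul_apply] at h1
    simp [Matrix.toBlocks₁₂, Matrix.toBlocks₂₂] at h1
    simp [par, hp]
    linear_combination (norm := module) -h1
  · have h1 := congrFun (congrFun ac (l, k)) (i, j)
    have h2 := congrFun (congrFun ac (l, k)) (j, i)
    rw [mul_twoTerm_apply, PInv_mul_apply] at h1 h2
    simp [Matrix.toBlocks₂₁, Matrix.toBlocks₁₁] at h1 h2
    simp [par]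
    have ha := h.p0 (Sum.inl i) (Sum.inl j)
    have hb := h.p0 (Sum.inl l) (Sum.inr k)
    rw [h.pinv (Sum.inl i) (Sum.inl j), ordCoeff_swap q i j] at h2
    linear_combination (norm := (match_scalars <;> field_simp <;> ring))
      (-((q - 1 - ordCoeff q i j) * p (Sum.inl l) (Sum.inr k) / q)) • h1 +
        (p (Sum.inl i) (Sum.inl j) * (1 + ordCoeff q i j) * p (Sum.inl l) (Sum.inr k) / q) • h2
  -- Here the `B C` term of `ad` has to be rewritten by `bc`.
  · have h1 := congrFun (congrFun ad (l, k)) (j, i)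
    have h2 := congrFun (congrFun bc (l, k)) (i, j)
    rw [Matrix.sub_apply, mul_PInv_apply, PInv_mul_apply] at h1
    rw [Matrix.neg_apply, mul_PMat_apply, PInv_mul_apply] at h2
    simp [Matrix.toBlocks₁₂, Matrix.toBlocks₂₂, Matrix.toBlocks₁₁, Matrix.toBlocks₂₁] at h1 h2
    simp [par]
    have ha := h.p0 (Sum.inl i) (Sum.inr j)
    have hb := h.p0 (Sum.inl l) (Sum.inr k)
    linear_combination (norm := (match_scalars <;> field_simp <;> ring))
      (p (Sum.inl l) (Sum.inr k) * p (Sum.inl i) (Sum.inr j) / q) • h1 +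
        ((q - 1) * p (Sum.inl l) (Sum.inr k) / q) • h2
  · have h1 := congrFun (congrFun bc (l, k)) (j, i)
    rw [Matrix.neg_apply, mul_PMat_apply, PInv_mul_apply] at h1
    simp [Matrix.toBlocks₁₂, Matrix.toBlocks₂₁] at h1
    simp [par, hp]
    have ha := h.p0 (Sum.inl j) (Sum.inr i)
    have hb := h.p0 (Sum.inl l) (Sum.inr k)
    linear_combination (norm := (match_scalars <;> field_simp <;> ring))
      (-(p (Sum.inl l) (Sum.inr k) / p (Sum.inl j) (Sum.inr i))) • h1
  · have h1 := congrFun (congrFun bd (l, k)) (i, j)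
    have h2 := congrFun (congrFun bd (l, k)) (j, i)
    rw [Matrix.neg_apply, mul_twoTerm_apply, PInv_mul_apply] at h1 h2
    simp [Matrix.toBlocks₁₂, Matrix.toBlocks₂₂] at h1 h2
    simp [par]
    have ha := h.p0 (Sum.inr i) (Sum.inr j)
    have hb := h.p0 (Sum.inl l) (Sum.inr k)
    rw [h.pinv (Sum.inr i) (Sum.inr j), ordCoeff_swap q i j] at h2
    linear_combination (norm := (match_scalars <;> field_simp <;> ring))
      (-((q - 1 - ordCoeff q i j) * p (Sum.inl l) (Sum.inr k) / q)) • h1 -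
        (p (Sum.inr i) (Sum.inr j) * (1 + ordCoeff q i j) * p (Sum.inl l) (Sum.inr k) / q) • h2
  · have h1 := congrFun (congrFun cc (k, l)) (i, j)
    rw [twoTerm_mul_apply, mul_twoTerm_apply] at h1
    simp [Matrix.toBlocks₂₁] at h1
    simp [par]
    linear_combination (norm := module) h1
  · have h1 := congrFun (congrFun cd (k, l)) (i, j)
    rw [twoTerm_mul_apply, Matrix.neg_apply, mul_PMat_apply] at h1
    simp [Matrix.toBlocks₂₁, Matrix.toBlocks₂₂] at h1
    simp [par]
    linear_combination (norm := module) -h1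
  · have h1 := congrFun (congrFun cd (k, l)) (j, i)
    have h2 := congrFun (congrFun cd (l, k)) (j, i)
    rw [twoTerm_mul_apply, Matrix.neg_apply, mul_PMat_apply] at h1 h2
    simp [Matrix.toBlocks₂₁, Matrix.toBlocks₂₂] at h1 h2
    simp [par, hp]
    have ha := h.p0 (Sum.inr k) (Sum.inr l)
    have hb := h.p0 (Sum.inl j) (Sum.inr i)
    rw [h.pinv (Sum.inr k) (Sum.inr l), ordCoeff_swap q k l]
      at h1 ⊢
    rw [ordCoeff_swap q k l] at h2
    linear_combination (norm := (match_scalars <;> field_simp <;> ring))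
      ((ordCoeff q k l - (q - 1)) * (p (Sum.inl j) (Sum.inr i))⁻¹) • h1 -
        ((p (Sum.inr k) (Sum.inr l))⁻¹ * (q - ordCoeff q k l) *
          (p (Sum.inl j) (Sum.inr i))⁻¹) • h2
  · have h1 := congrFun (congrFun dd (k, l)) (i, j)
    rw [twoTerm_mul_apply, mul_twoTerm_apply] at h1
    simp [Matrix.toBlocks₂₂] at h1
    simp [par]
    linear_combination (norm := module) h1

end

/-! ### Straightening and nilpotency -/

section Nilpotency

variable {K : Type u} [Field K] {S : Type v} [Ring S] [Algebra K S]

theorem exists_adjacent_of_not_pairwise {ι : Type*} [LinearOrder ι] {l : List ι}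
    (h : ¬ l.Pairwise (· < ·)) : ∃ pre s t post, t ≤ s ∧ l = pre ++ s :: t :: post := by
  induction l with
  | nil => simp at h
  | cons a l ih =>
    by_cases hl : l.Pairwise (· < ·)
    · cases l with
      | nil => simp at h
      | cons b l =>
        refine ⟨[], a, b, l, ?_, rfl⟩
        by_contra hab
        rw [not_le] at hab
        refine h (List.pairwise_cons.2 ⟨fun c hc => ?_, hl⟩)
        rcases List.mem_cons.1 hc with rfl | hc
        · exact hab
        · exact hab.trans ((List.pairwise_cons.1 hl).1 c hc)
    · obtain ⟨pre, s, t, post, hts, rfl⟩ := ih hl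
      exact ⟨a :: pre, s, t, post, hts, rfl⟩

/-- If every product of two generators in non-increasing order is a combination of
lexicographically smaller ones, then all long products vanish. -/
theorem prod_eq_zero_of_straightening {ι : Type*} [Fintype ι] [LinearOrder ι] (x : ι → S)
    (h : ∀ s t, t ≤ s → x s * x t ∈
      Submodule.span K {y | ∃ u v, (u < s ∨ u = s ∧ v < t) ∧ y = x u * x v})
    {l : List ι} (hl : Fintype.card ι < l.length) : (l.map x).prod = 0 := by
  obtain ⟨N, hN⟩ : ∃ N, l.length = N := ⟨_, rfl⟩
  -- Words of a fixed length are finite in number, so the lexicographic order on them is well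
  -- founded. No word longer than the alphabet is strictly increasing, so the rewriting never meets
  -- an irreducible word.
  have : Finite {l : List ι // l.length = N} := (List.finite_length_eq ι N).to_subtype
  have key : ∀ l : {l : List ι // l.length = N}, (l.1.map x).prod = 0 := by
    intro l
    induction l using WellFoundedLT.induction with
    | ind l ih =>
    obtain ⟨l, hlN⟩ := l
    have hnp : ¬ l.Pairwise (· < ·) := fun hp => by
      have := List.Nodup.length_le_card (hp.imp fun h => h.ne : l.Nodup)
      omega
    obtain ⟨pre, s, t, post, hts, rfl⟩ := exists_adjacent_of_not_pairwise hnp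
    have hlin : ∀ y ∈ Submodule.span K {y | ∃ u v, (u < s ∨ u = s ∧ v < t) ∧ y = x u * x v},
        (pre.map x).prod * (y * (post.map x).prod) = 0 := by
      intro y hy
      induction hy using Submodule.span_induction with
      | mem y hy =>
        obtain ⟨u, v, huv, rfl⟩ := hy
        have := ih ⟨pre ++ u :: v :: post, by simpa using hlN⟩ (by
          change pre ++ u :: v :: post < pre ++ s :: t :: post
          refine List.append_left_lt ?_
          rw [List.cons_lt_cons_iff, List.cons_lt_cons_iff]
          tauto)
        simpa [mul_assoc] using this
      | zero => simp
      | add y z _ _ hy hz => rw [add_mul, mul_add, hy, hz, add_zero]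
      | smul c y _ hy => rw [smul_mul_assoc, mul_smul_comm, hy, smul_zero]
    simpa [mul_assoc] using hlin _ (h s t hts)
  exact key ⟨l, hN⟩

theorem span_range_pow_eq_bot {ι : Type*} [Fintype ι] [LinearOrder ι] (x : ι → S)
    (h : ∀ s t, t ≤ s → x s * x t ∈
      Submodule.span K {y | ∃ u v, (u < s ∨ u = s ∧ v < t) ∧ y = x u * x v}) :
    Submodule.span K (Set.range x) ^ (Fintype.card ι + 1) = ⊥ := by
  rw [Submodule.span_pow, Submodule.span_eq_bot]
  intro y hy
  obtain ⟨f, rfl⟩ := Set.mem_pow.1 hy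
  choose g hg using fun i => (f i).2
  have : (List.ofFn fun i => (f i : S)) = (List.ofFn g).map x := by
    rw [List.map_ofFn]
    congr 1
    funext i
    exact (hg i).symm
  rw [this]
  exact prod_eq_zero_of_straightening x h (by simp)

/-- The span of the entries of a matrix. -/
def entrySpan (K : Type u) [Field K] [Algebra K S] {a b : Type} (M : Matrix a b S) :
    Submodule K S :=
  Submodule.span K (Set.range fun x : a × b => M x.1 x.2)

theorem apply_mem_entrySpan {a b : Type} (M : Matrix a b S) (i : a) (j : b) :
    M i j ∈ entrySpan K M := Submodule.subset_span ⟨(i, j), rfl⟩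

theorem entrySpan_mul_le {a b c d : Type} {M : Matrix a b S} {N : Matrix c d S}
    {X : Submodule K S} (h : ∀ i j k l, M i j * N k l ∈ X) :
    entrySpan K M * entrySpan K N ≤ X := by
  rw [entrySpan, entrySpan, Submodule.span_mul_span, Submodule.span_le]
  rintro _ ⟨_, ⟨x, rfl⟩, _, ⟨y, rfl⟩, rfl⟩
  exact h _ _ _ _

theorem matrix_mul_mem {a b c : Type} [Fintype b] {M : Matrix a b S} {N : Matrix b c S}
    {X Y : Submodule K S} (hM : ∀ i j, M i j ∈ X) (hN : ∀ i j, N i j ∈ Y) (i : a) (j : c) :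
    (M * N) i j ∈ X * Y := by
  rw [Matrix.mul_apply]
  exact Submodule.sum_mem _ fun k _ => Submodule.mul_mem_mul (hM i k) (hN k j)

theorem isNilpotent_of_mem {a : Type} [Fintype a] [DecidableEq a] {M : Matrix a a S}
    {X : Submodule K S} (hM : ∀ i j, M i j ∈ X) {N : ℕ} (hX : X ^ N = ⊥) : IsNilpotent M := by
  have h : ∀ N i j, (M ^ N) i j ∈ X ^ N := by
    intro N
    induction N with
    | zero =>
      intro i j
      rw [pow_zero, pow_zero, Matrix.one_apply]
      split_ifs
      · exact Submodule.one_le.1 le_rfl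
      · exact Submodule.zero_mem _
    | succ N ih => rw [pow_succ, pow_succ]; exact matrix_mul_mem ih hM
  refine ⟨N, ?_⟩
  ext i j
  have := h N i j
  rw [hX, Submodule.mem_bot] at this
  exact this

/-- The factors `X` are collected on the left; consequently a product `X Y` inherits nilpotency from
`X`. -/
theorem mul_pow_le_of_mul_le {X Y : Submodule K S} (h : Y * X ≤ X * Y) (N : ℕ) :
    (X * Y) ^ N ≤ X ^ N * Y ^ N := by
  have h1 : ∀ N, Y * X ^ N ≤ X ^ N * Y := by
    intro N
    induction N with
    | zero => simp
    | succ N ih =>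
      calc Y * X ^ (N + 1) = Y * X ^ N * X := by rw [pow_succ, mul_assoc]
        _ ≤ X ^ N * Y * X := by gcongr
        _ = X ^ N * (Y * X) := mul_assoc _ _ _
        _ ≤ X ^ N * (X * Y) := by gcongr
        _ = _ := by rw [pow_succ, mul_assoc]
  induction N with
  | zero => simp
  | succ N ih =>
    calc (X * Y) ^ (N + 1) = X * Y * (X * Y) ^ N := pow_succ' _ _
      _ ≤ X * Y * (X ^ N * Y ^ N) := by gcongr
      _ = X * (Y * X ^ N) * Y ^ N := by simp only [mul_assoc]
      _ ≤ X * (X ^ N * Y) * Y ^ N := mul_le_mul_left (mul_le_mul_right (h1 N) _) _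
      _ = _ := by rw [pow_succ', pow_succ']; simp only [mul_assoc]

theorem mul_pow_eq_bot {X Y : Submodule K S} (h : Y * X ≤ X * Y) {N : ℕ} (hX : X ^ N = ⊥) :
    (X * Y) ^ N = ⊥ := by
  rw [eq_bot_iff]
  refine (mul_pow_le_of_mul_le h N).trans ?_
  rw [hX, Submodule.bot_mul]

/-- Inversion of a triangular system modulo a submodule. -/
theorem mem_of_triangular {ι : Type*} [Fintype ι] [DecidableEq ι] {y : ι → ι → S}
    {X : Submodule K S} {φ e : ι → ι → K} (ρ : ι → ℕ) (h0 : ∀ l j, l ≠ j → φ l j ≠ 0)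
    (h1 : ∀ j, φ j j + e j j ≠ 0) (h2 : ∀ a j, a ≠ j → e a j ≠ 0 → ρ a < ρ j)
    (h : ∀ j l, φ l j • y j l + (if l = j then ∑ a, e a j • y a a else 0) ∈ X) (j l : ι) :
    y j l ∈ X := by
  -- Only the diagonal unknowns `y a a` are coupled, and triangularly with respect to `ρ`; each
  -- off-diagonal one is isolated in its own relation.
  have hdiag : ∀ N j, ρ j = N → y j j ∈ X := by
    intro N
    induction N using Nat.strong_induction_on with
    | _ N ih =>
      intro j hj
      have h3 := h j j
      rw [if_pos rfl, ← Finset.add_sum_erase _ _ (Finset.mem_univ j), ← add_assoc,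
        ← add_smul] at h3
      have h4 : ∑ a ∈ Finset.univ.erase j, e a j • y a a ∈ X := by
        refine Submodule.sum_mem _ fun a ha => ?_
        by_cases hea : e a j = 0
        · rw [hea, zero_smul]; exact X.zero_mem
        · exact X.smul_mem _ (ih _ (hj ▸ h2 a j (Finset.ne_of_mem_erase ha) hea) a rfl)
      exact (X.smul_mem_iff (h1 j)).1 ((X.add_mem_iff_left h4).1 h3)
  by_cases hlj : l = j
  · subst hlj; exact hdiag _ _ rfl
  · have h3 := h j l
    rw [if_neg hlj, add_zero] at h3
    exact (X.smul_mem_iff (h0 l j hlj)).1 h3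

/-- The entries are ordered by row and then by column. The opposite sign of the flip term on the
column side makes them behave like odd variables: squares vanish, since `1 + q ≠ 0`, and each
product in decreasing order reduces to lexicographically smaller ones. -/
theorem entrySpan_pow_eq_bot [CharZero K] {a b : Type} [Fintype a] [Fintype b] [LinearOrder a]
    [LinearOrder b] {q : K} (hq0 : q ≠ 0) (hq1 : 1 + q ≠ 0) {B : Matrix a b S} {f : a → a → K}
    {g : b → b → K} (hf : ∀ k, f k k = (q + 1) / 2) (hg0 : ∀ i j, g i j ≠ 0)
    (hg : ∀ i, g i i = (q + 1) / 2)
    (h : ∀ k l i j, ordCoeff q k l • (B k i * B l j) + f k l • (B l i * B k j) =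
      ordCoeff q i j • (B k i * B l j) - g i j • (B k j * B l i)) :
    ∃ N, entrySpan K B ^ N = ⊥ := by
  have hx := span_range_pow_eq_bot (K := K) (fun x : a ×ₗ b => B (ofLex x).1 (ofLex x).2) ?_
  · exact ⟨_, hx⟩
  intro s t hts
  obtain ⟨⟨k, i⟩, rfl⟩ := toLex.surjective s
  obtain ⟨⟨l, j⟩, rfl⟩ := toLex.surjective t
  simp only [ofLex_toLex]
  have hmem : ∀ k' i' l' j' (c : K), k' < k ∨ k' = k ∧ i' < i → c • (B k' i' * B l' j') ∈
      Submodule.span K {y | ∃ u v : a ×ₗ b, (u < toLex (k, i) ∨ u = toLex (k, i) ∧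
        v < toLex (l, j)) ∧ y = B (ofLex u).1 (ofLex u).2 * B (ofLex v).1 (ofLex v).2} := by
    intro k' i' l' j' c hk
    refine Submodule.smul_mem _ _ (Submodule.subset_span
      ⟨toLex (k', i'), toLex (l', j'), Or.inl ?_, rfl⟩)
    rw [Prod.Lex.toLex_lt_toLex]
    exact hk
  rw [Prod.Lex.toLex_le_toLex] at hts
  rcases hts with hlk | ⟨hlk, hji⟩
  · simp only at hlk
    -- The relation is used with the columns exchanged, so that `B k i * B l j` appears with the
    -- nonzero coefficient `g j i`.
    rcases lt_trichotomy j i with hji | rfl | hji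
    · have h1 := h k l j i
      rw [ordCoeff_of_gt q hlk, ordCoeff_of_lt q hji] at h1
      have : B k i * B l j = ((g j i)⁻¹ * (1 - q)) • (B k j * B l i) +
          (-((g j i)⁻¹ * f k l)) • (B l j * B k i) := by
        have := hg0 j i
        linear_combination (norm := (match_scalars <;> field_simp <;> ring)) (g j i)⁻¹ • h1
      rw [this]
      exact Submodule.add_mem _ (hmem _ _ _ _ _ (Or.inr ⟨rfl, hji⟩)) (hmem _ _ _ _ _ (Or.inl hlk))
    · have h1 := h k l j j
      rw [ordCoeff_of_gt q hlk, ordCoeff_self, hg] at h1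
      have : B k j * B l j = (-(q⁻¹ * f k l)) • (B l j * B k j) := by
        linear_combination (norm := (match_scalars <;> field_simp <;> ring)) q⁻¹ • h1
      rw [this]
      exact hmem _ _ _ _ _ (Or.inl hlk)
    · have h1 := h k l j i
      rw [ordCoeff_of_gt q hlk, ordCoeff_of_gt q hji] at h1
      have : B k i * B l j = (-((g j i)⁻¹ * f k l)) • (B l j * B k i) := by
        have := hg0 j i
        linear_combination (norm := (match_scalars <;> field_simp <;> ring)) (g j i)⁻¹ • h1
      rw [this]
      exact hmem _ _ _ _ _ (Or.inl hlk)
  · simp only at hlk hji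
    subst hlk
    have h1 := h l l i j
    rw [ordCoeff_self, hf] at h1
    rcases hji.lt_or_eq with hji | rfl
    · rw [ordCoeff_of_gt q hji] at h1
      have : B l i * B l j = (-g i j) • (B l j * B l i) := by
        linear_combination (norm := (match_scalars <;> field_simp <;> ring)) h1
      rw [this]
      exact hmem _ _ _ _ _ (Or.inr ⟨rfl, hji⟩)
    · rw [ordCoeff_self, hg] at h1
      have : (1 + q) • (B l j * B l j) = 0 := by
        linear_combination (norm := (match_scalars <;> field_simp <;> ring)) h1
      rw [(smul_eq_zero.1 this).resolve_left hq1]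
      exact Submodule.zero_mem _

end Nilpotency

/-! ### Exchange relations with the inverse matrix -/

section LegApply

variable {S : Type v} [Ring S] {a b c d : Type}

theorem leg₁_mul_apply [Fintype b] [Fintype c] [DecidableEq c] (X : Matrix a b S)
    (M : Matrix (b × c) d S) (k : a) (l : c) (y : d) :
    (leg₁ X c * M) (k, l) y = ∑ x, X k x * M (x, l) y := by
  rw [Matrix.mul_apply, Fintype.sum_prod_type]
  refine Finset.sum_congr rfl fun x _ => ?_
  rw [Finset.sum_eq_single l]
  · simp [leg₁]
  · intro z _ hz; simp [leg₁, hz.symm]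
  · simp

theorem leg₂_mul_apply [Fintype b] [Fintype c] [DecidableEq c] (X : Matrix a b S)
    (M : Matrix (c × b) d S) (k : c) (l : a) (y : d) :
    (leg₂ c X * M) (k, l) y = ∑ x, X l x * M (k, x) y := by
  rw [Matrix.mul_apply, Fintype.sum_prod_type, Finset.sum_eq_single k]
  · simp [leg₂]
  · intro z _ hz; simp [leg₂, hz.symm]
  · simp

theorem leg₁_apply [DecidableEq c] (X : Matrix a b S) (k : a) (l : c) (i : b) (j : c) :
    leg₁ X c (k, l) (i, j) = if l = j then X k i else 0 := by
  simp [leg₁, Matrix.one_apply]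

theorem leg₂_apply [DecidableEq c] (X : Matrix a b S) (k : c) (l : a) (i : c) (j : b) :
    leg₂ c X (k, l) (i, j) = if k = i then X l j else 0 := by
  simp [leg₂, Matrix.one_apply]

end LegApply

section Units

variable {K : Type u} [Field K] [CharZero K] {m n : ℕ} {q : K} {p r : Idx m n → Idx m n → K}
  {S : Type v} [Ring S] [Algebra K S]

/-- Exchange relations between the entries of a quantum super matrix and of its inverse. -/
theorem IsQuantumSuperMatrix.exchange (h : IsParam q p r) {Z T : Matrix (Idx m n) (Idx m n) S}
    (hZ : IsQuantumSuperMatrix q p r Z) (hZT : Z * T = 1) (hTZ : T * Z = 1) (i j k l : Idx m n) :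
    ((-1) ^ (par i * par j) : K) • ((if l = j then ∑ a, superCoeff q a j • (T k a * Z a i) else 0) +
      ((-1) ^ (par l * par j) * (p l j * (1 + superCoeff q l j))) • (T k j * Z l i)) =
    ((-1) ^ (par k * par l) : K) • ((if k = i then ∑ c, superCoeff q i c • (Z l c * T c j) else 0) +
      ((-1) ^ (par i * par k) * (p i k * (1 + superCoeff q i k))) • (Z l i * T k j)) := by
  set e : Idx m n → Idx m n → K := superCoeff q with he
  set f : Idx m n → Idx m n → K :=
    fun i j => (-1) ^ (par i * par j) * (p i j * (1 + superCoeff q i j)) with hf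
  set R := sc S (twoTerm e f) with hR
  -- The sign of the super flip. It absorbs all signs of `(∗)`, which becomes `R Z₁ θ Z₂ = Z₁ θ Z₂
  -- R`.
  set θ : Matrix (Idx m n × Idx m n) (Idx m n × Idx m n) S :=
    Matrix.diagonal fun x => algebraMap K S ((-1) ^ (par x.1 * par x.2)) with hθ
  have hsq : ∀ a : ℕ, ((-1) ^ a * (-1) ^ a : K) = 1 := fun a => by
    rw [← mul_pow]; simp
  have hN : ∀ k l i j, (leg₁ Z (Idx m n) * θ * leg₂ (Idx m n) Z) (k, l) (i, j) =
      ((-1) ^ (par i * par l) : K) • (Z k i * Z l j) := by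
    intro k l i j
    rw [Matrix.mul_assoc, leg₁_mul_apply, Finset.sum_eq_single i]
    · rw [hθ, Matrix.diagonal_mul, leg₂_apply, if_pos rfl, ← Algebra.smul_def, mul_smul_comm]
    · intro x _ hx
      rw [hθ, Matrix.diagonal_mul, leg₂_apply, if_neg hx, mul_zero, mul_zero]
    · simp
  have h1 : R * (leg₁ Z (Idx m n) * θ * leg₂ (Idx m n) Z) =
      leg₁ Z (Idx m n) * θ * leg₂ (Idx m n) Z * R := by
    ext ⟨k, l⟩ ⟨i, j⟩
    rw [hR, twoTerm_mul_apply, mul_twoTerm_apply, hN, hN, hN]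
    have h2 := ((h.zLHS_eq Z i j k l).symm.trans (hZ i j k l)).trans (h.zRHS_eq Z i j k l)
    have h3 := congrArg (((-1) ^ (par k * par l) : K) • ·) h2
    simp only [smul_add, smul_smul] at h3 ⊢
    have e1 : ((-1) ^ (par k * par l) * ((-1) ^ (par l * (par i + par k)) * superCoeff q k l) : K) =
        e k l * (-1) ^ (par i * par l) := by
      rw [he, mul_comm (par k), mul_add, pow_add, mul_comm (par i)]
      linear_combination ((-1) ^ (par l * par i) * superCoeff q k l) * hsq (par l * par k)
    have e2 : ((-1) ^ (par k * par l) * ((-1) ^ (par k * (par i + par l)) * ((-1) ^ (par l * par k) *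
        (p l k * (1 + superCoeff q l k)))) : K) = f l k * (-1) ^ (par i * par k) := by
      rw [hf, mul_comm (par l) (par k), mul_add, pow_add, mul_comm (par i)]
      linear_combination ((-1) ^ (par k * par i) * (-1) ^ (par k * par l) *
        (p l k * (1 + superCoeff q l k))) * hsq (par k * par l)
    have e3 : ((-1) ^ (par k * par l) * ((-1) ^ (par l * (par i + par k)) * superCoeff q i j) : K) =
        e i j * (-1) ^ (par i * par l) := by
      rw [he, mul_comm (par k), mul_add, pow_add, mul_comm (par i)]
      linear_combination ((-1) ^ (par l * par i) * superCoeff q i j) * hsq (par l * par k)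
    have e4 : ((-1) ^ (par k * par l) * ((-1) ^ (par l * (par j + par k)) * ((-1) ^ (par i * par j) *
        (p i j * (1 + superCoeff q i j)))) : K) = f i j * (-1) ^ (par j * par l) := by
      rw [hf, mul_comm (par k), mul_add, pow_add, mul_comm (par j) (par l)]
      linear_combination ((-1) ^ (par l * par j) * (-1) ^ (par i * par j) *
        (p i j * (1 + superCoeff q i j))) * hsq (par l * par k)
    rw [e1, e2, e3, e4] at h3
    exact h3
  have hT₁ : leg₁ T (Idx m n) * leg₁ Z (Idx m n) = 1 := by rw [← leg₁_mul, hTZ, leg₁_one]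
  have hT₂ : leg₂ (Idx m n) Z * leg₂ (Idx m n) T = 1 := by rw [← leg₂_mul, hZT, leg₂_one]
  -- Multiplication by `T₁` on the left and by `T₂` on the right gives `T₁ R Z₁ θ = θ Z₂ R T₂`.
  have h2 : leg₁ T (Idx m n) * (R * leg₁ Z (Idx m n)) * θ =
      θ * (leg₂ (Idx m n) Z * (R * leg₂ (Idx m n) T)) := by
    calc _ = leg₁ T (Idx m n) * (R * (leg₁ Z (Idx m n) * θ * leg₂ (Idx m n) Z)) *
          leg₂ (Idx m n) T := by simp only [mul_assoc, hT₂, mul_one]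
      _ = leg₁ T (Idx m n) * leg₁ Z (Idx m n) * θ * leg₂ (Idx m n) Z * R * leg₂ (Idx m n) T := by
          rw [h1]; simp only [mul_assoc]
      _ = _ := by rw [hT₁]; simp only [mul_assoc, one_mul]
  have h3 := congrFun (congrFun h2 (k, l)) (i, j)
  rw [hθ, Matrix.mul_diagonal, Matrix.diagonal_mul, ← Algebra.commutes, ← Algebra.smul_def,
    ← Algebra.smul_def, leg₁_mul_apply, leg₂_mul_apply] at h3
  simp only [hR, twoTerm_mul_apply, leg₁_apply, leg₂_apply, mul_add, mul_smul_comm, mul_ite,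
    mul_zero, Finset.sum_add_distrib] at h3
  convert h3 using 2
  · congr 1
    · split_ifs with hlj
      · subst hlj; rfl
      · simp
    · rw [Finset.sum_eq_single j]
      · simp [hf, he]
      · intro x _ hx; simp [hx]
      · simp
  · congr 1
    · split_ifs with hki
      · subst hki; rfl
      · simp
    · rw [Finset.sum_eq_single i]
      · simp [hf, he]
      · intro x _ hx; simp [hx]
      · simp

theorem sum_idx_mul {T Z : Matrix (Idx m n) (Idx m n) S} (h : T * Z = 1) (k i : Idx m n) :
    (∑ a : Fin m, T k (Sum.inl a) * Z (Sum.inl a) i) +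
      (∑ a : Fin n, T k (Sum.inr a) * Z (Sum.inr a) i) = if k = i then 1 else 0 := by
  rw [← Fintype.sum_sum_type fun a => T k a * Z a i, ← Matrix.mul_apply, h, Matrix.one_apply]

/-- Used with `x - ∑ a, y a` standing for the sum over indices of the other parity, as given by `T *
Z = 1` or `Z * T = 1`; `ordCoeff q a j + ordCoeff q j a = q - 1` does the rest. -/
theorem sum_ordCoeff_sub {ι : Type} [Fintype ι] [LinearOrder ι] (q : K) (y : ι → S) (x : S) (j : ι) :
    (q - 1) • (x - ∑ a, y a) + ∑ a, ordCoeff q a j • y a =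
      (q - 1) • x - ∑ a, ordCoeff q j a • y a := by
  rw [smul_sub, Finset.smul_sum, sub_add, ← Finset.sum_sub_distrib]
  congr 1
  refine Finset.sum_congr rfl fun a _ => ?_
  rw [ordCoeff_swap q a j, ← sub_smul]

theorem sum_ordCoeff_sub' {ι : Type} [Fintype ι] [LinearOrder ι] (q : K) (y : ι → S) (x : S)
    (i : ι) : (q - 1) • (x - ∑ a, y a) + ∑ a, ordCoeff q i a • y a =
      (q - 1) • x - ∑ a, ordCoeff q a i • y a := by
  rw [eq_sub_iff_add_eq, ← eq_sub_iff_add_eq', ← sub_eq_iff_eq_add'.2 (sum_ordCoeff_sub q y x i).symm]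
  abel

/-- Lets the products `B T₂₁` and `T₂₁ B` inherit nilpotency from `B`. The exchange relations couple
the products `T₂₁ B` among themselves, so a triangular system has to be inverted. -/
theorem IsQuantumSuperMatrix.exchange_B (h : IsParam q p r) {Z T : Matrix (Idx m n) (Idx m n) S}
    (hZ : IsQuantumSuperMatrix q p r Z) (hZT : Z * T = 1) (hTZ : T * Z = 1) :
    entrySpan K T.toBlocks₂₁ * entrySpan K Z.toBlocks₁₂ ≤
      entrySpan K Z.toBlocks₁₂ * entrySpan K T.toBlocks₂₁ := by
  refine entrySpan_mul_le fun k j l i => ?_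
  have hM : ∀ l i k j, Z (Sum.inl l) (Sum.inr i) * T (Sum.inr k) (Sum.inl j) ∈
      entrySpan K Z.toBlocks₁₂ * entrySpan K T.toBlocks₂₁ := fun l i k j =>
    Submodule.mul_mem_mul (apply_mem_entrySpan Z.toBlocks₁₂ l i)
      (apply_mem_entrySpan T.toBlocks₂₁ k j)
  refine mem_of_triangular (ι := Fin m)
    (y := fun j l => T (Sum.inr k) (Sum.inl j) * Z (Sum.inl l) (Sum.inr i))
    (φ := fun l j => p (Sum.inl l) (Sum.inl j) * (1 + ordCoeff q l j))
    (e := fun a j => -ordCoeff q j a) (fun a => a)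
    (fun l j _ => mul_ne_zero (h.p0 _ _) (one_add_ordCoeff_ne_zero h.q0 h.one_add_ne _ _))
    (fun j => ?_) (fun a j haj he => ?_) (fun j l => ?_) j l
  · rw [h.p1, ordCoeff_self]; norm_num
  · by_contra hlt
    refine he ?_
    rw [ordCoeff_of_lt q (lt_of_le_of_ne (not_lt.1 hlt : j ≤ a) haj.symm), neg_zero]
  · have h1 := hZ.exchange h hZT hTZ (Sum.inr i) (Sum.inl j) (Sum.inr k) (Sum.inl l)
    have h2 := sum_idx_mul hTZ (Sum.inr k) (Sum.inr i)
    have h3 := sum_idx_mul hZT (Sum.inl l) (Sum.inl j)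
    simp only [par, Sum.elim_inl, Sum.elim_inr, mul_zero, mul_one, pow_zero, one_smul,
      Fintype.sum_sum_type, superCoeff_inl_inl, superCoeff_inr_inr, superCoeff_inr_inl,
      Sum.inl.injEq, Sum.inr.injEq, one_mul, pow_one, ← Finset.smul_sum] at h1 h2 h3
    -- The sums also run over indices of the wrong parity, with coefficient `q - 1`. They are
    -- eliminated through `T * Z = 1` and `Z * T = 1`; the constants `q - 1` this creates agree on
    -- both sides and cancel.
    rw [eq_sub_of_add_eq' h2, add_comm (∑ x, ordCoeff q x j • _), sum_ordCoeff_sub,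
      eq_sub_of_add_eq h3, sum_ordCoeff_sub'] at h1
    have h4 : (p (Sum.inl l) (Sum.inl j) * (1 + ordCoeff q l j)) •
        (T (Sum.inr k) (Sum.inl j) * Z (Sum.inl l) (Sum.inr i)) + (if l = j then
          ∑ a, -ordCoeff q j a • (T (Sum.inr k) (Sum.inl a) * Z (Sum.inl a) (Sum.inr i)) else 0) =
        (-1 * (p (Sum.inr i) (Sum.inr k) * (1 + ordCoeff q i k))) •
          (Z (Sum.inl l) (Sum.inr i) * T (Sum.inr k) (Sum.inl j)) -
        if k = i then
          ∑ c, ordCoeff q c i • (Z (Sum.inl l) (Sum.inr c) * T (Sum.inr c) (Sum.inl j)) else 0 := by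
      simp only [neg_smul, Finset.sum_neg_distrib] at h1 ⊢
      split_ifs at h1 ⊢ <;> linear_combination (norm := module) h1
    rw [h4]
    refine Submodule.sub_mem _ (Submodule.smul_mem _ _ (hM _ _ _ _)) ?_
    split_ifs
    · exact Submodule.sum_mem _ fun c _ => Submodule.smul_mem _ _ (hM _ _ _ _)
    · exact Submodule.zero_mem _

/-- Here the terms of the wrong parity have coefficient `0`, so no elimination is needed. The system
is triangular for the reversed order, whence the rank `n - a`. -/
theorem IsQuantumSuperMatrix.exchange_C (h : IsParam q p r) {Z T : Matrix (Idx m n) (Idx m n) S}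
    (hZ : IsQuantumSuperMatrix q p r Z) (hZT : Z * T = 1) (hTZ : T * Z = 1) :
    entrySpan K T.toBlocks₁₂ * entrySpan K Z.toBlocks₂₁ ≤
      entrySpan K Z.toBlocks₂₁ * entrySpan K T.toBlocks₁₂ := by
  refine entrySpan_mul_le fun k j l i => ?_
  have hM : ∀ l i k j, Z (Sum.inr l) (Sum.inl i) * T (Sum.inl k) (Sum.inr j) ∈
      entrySpan K Z.toBlocks₂₁ * entrySpan K T.toBlocks₁₂ := fun l i k j =>
    Submodule.mul_mem_mul (apply_mem_entrySpan Z.toBlocks₂₁ l i)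
      (apply_mem_entrySpan T.toBlocks₁₂ k j)
  refine mem_of_triangular (ι := Fin n)
    (y := fun j l => T (Sum.inl k) (Sum.inr j) * Z (Sum.inr l) (Sum.inl i))
    (φ := fun l j => -(p (Sum.inr l) (Sum.inr j) * (1 + ordCoeff q l j)))
    (e := fun a j => ordCoeff q a j) (fun a => n - a)
    (fun l j _ => neg_ne_zero.2
      (mul_ne_zero (h.p0 _ _) (one_add_ordCoeff_ne_zero h.q0 h.one_add_ne _ _)))
    (fun j => ?_) (fun a j haj he => ?_) (fun j l => ?_) j l
  · rw [h.p1, ordCoeff_self, one_mul, ← sub_eq_neg_add]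
    norm_num
  · have hja : j < a := by
      by_contra hlt
      exact he (ordCoeff_of_lt q (lt_of_le_of_ne (not_lt.1 hlt) haj))
    have : (j : ℕ) < a := hja
    omega
  · have h1 := hZ.exchange h hZT hTZ (Sum.inl i) (Sum.inr j) (Sum.inl k) (Sum.inr l)
    simp only [par, Sum.elim_inl, Sum.elim_inr, mul_zero, mul_one, pow_zero, one_smul,
      Fintype.sum_sum_type, superCoeff_inl_inl, superCoeff_inr_inr, superCoeff_inl_inr,
      Sum.inl.injEq, Sum.inr.injEq, one_mul, pow_one, zero_smul,
      Finset.sum_const_zero, add_zero, zero_add, neg_mul] at h1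
    rw [add_comm, h1]
    refine Submodule.add_mem _ ?_ (Submodule.smul_mem _ _ (hM _ _ _ _))
    split_ifs
    · exact Submodule.sum_mem _ fun c _ => Submodule.smul_mem _ _ (hM _ _ _ _)
    · exact Submodule.zero_mem _

theorem entrySpan_transpose {a b : Type} (M : Matrix a b S) :
    entrySpan K M.transpose = entrySpan K M := by
  unfold entrySpan
  congr 1
  ext x
  constructor
  · rintro ⟨y, rfl⟩; exact ⟨y.swap, rfl⟩
  · rintro ⟨y, rfl⟩; exact ⟨y.swap, rfl⟩

theorem IsQuantumSuperMatrix.nilpotent_B (h : IsParam q p r) {Z : Matrix (Idx m n) (Idx m n) S}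
    (hZ : IsQuantumSuperMatrix q p r Z) : ∃ N, entrySpan K Z.toBlocks₁₂ ^ N = ⊥ := by
  have hb := (hZ.blockRelations h).bb
  rw [h.Re_eq, h.Ro_eq] at hb
  refine entrySpan_pow_eq_bot (q := q) h.q0 h.one_add_ne
    (f := fun k l => p (Sum.inl l) (Sum.inl k) * (1 + ordCoeff q l k))
    (g := fun i j => p (Sum.inr i) (Sum.inr j) * (1 + ordCoeff q i j))
    (fun k => by rw [h.p1, one_mul, one_add_ordCoeff_self])
    (fun i j => mul_ne_zero (h.p0 _ _) (one_add_ordCoeff_ne_zero h.q0 h.one_add_ne _ _))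
    (fun k => by rw [h.p1, one_mul, one_add_ordCoeff_self]) fun k l i j => ?_
  have h1 := congrFun (congrFun hb (k, l)) (i, j)
  rw [twoTerm_mul_apply, mul_twoTerm_apply] at h1
  simpa only [neg_smul, ← sub_eq_add_neg, Matrix.kroneckerMap_apply] using h1

/-- In `cc` the even matrix acts on the columns, so straightening is applied to the transpose of
`C`. -/
theorem IsQuantumSuperMatrix.nilpotent_C (h : IsParam q p r) {Z : Matrix (Idx m n) (Idx m n) S}
    (hZ : IsQuantumSuperMatrix q p r Z) : ∃ N, entrySpan K Z.toBlocks₂₁ ^ N = ⊥ := by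
  have hc := (hZ.blockRelations h).cc
  rw [h.Re_eq, h.Ro_eq] at hc
  obtain ⟨N, hN⟩ := entrySpan_pow_eq_bot (q := q) (B := Z.toBlocks₂₁.transpose) h.q0 h.one_add_ne
    (f := fun k l => p (Sum.inl k) (Sum.inl l) * (1 + ordCoeff q k l))
    (g := fun i j => p (Sum.inr j) (Sum.inr i) * (1 + ordCoeff q j i))
    (fun k => by rw [h.p1, one_mul, one_add_ordCoeff_self])
    (fun i j => mul_ne_zero (h.p0 _ _) (one_add_ordCoeff_ne_zero h.q0 h.one_add_ne _ _))
    (fun k => by rw [h.p1, one_mul, one_add_ordCoeff_self]) fun k l i j => by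
      have h1 := congrFun (congrFun hc (i, j)) (k, l)
      rw [twoTerm_mul_apply, mul_twoTerm_apply] at h1
      simpa only [neg_smul, ← sub_eq_add_neg, Matrix.kroneckerMap_apply,
        Matrix.transpose_apply] using h1
  exact ⟨N, entrySpan_transpose (K := K) Z.toBlocks₂₁ ▸ hN⟩

theorem isUnit_of_mul_eq_one_sub {T : Type*} [Ring T] {x y z a b : T} (h1 : x * y = 1 - a)
    (h2 : z * x = 1 - b) (ha : IsNilpotent a) (hb : IsNilpotent b) : IsUnit x := by
  obtain ⟨u, hu⟩ := ha.isUnit_one_sub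
  obtain ⟨v, hv⟩ := hb.isUnit_one_sub
  refine isUnit_iff_exists_and_exists.2 ⟨⟨y * (↑u⁻¹ : T), ?_⟩, ⟨(↑v⁻¹ : T) * z, ?_⟩⟩
  · rw [← mul_assoc, h1, ← hu, Units.mul_inv]
  · rw [mul_assoc, h2, ← hv, Units.inv_mul]

theorem isNilpotent_matrix_mul {a b : Type} [Fintype a] [Fintype b] [DecidableEq a] [DecidableEq b]
    {M : Matrix a b S} {N : Matrix b a S} {X Y : Submodule K S} (hYX : Y * X ≤ X * Y)
    {k : ℕ} (hX : X ^ k = ⊥) (hM : ∀ i j, M i j ∈ X) (hN : ∀ i j, N i j ∈ Y) :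
    IsNilpotent (M * N) ∧ IsNilpotent (N * M) :=
  ⟨isNilpotent_of_mem (matrix_mul_mem hM hN) (mul_pow_eq_bot hYX hX),
    isNilpotent_of_mem (fun i j => hYX (matrix_mul_mem hN hM i j)) (mul_pow_eq_bot hYX hX)⟩

/-- The diagonal blocks of `Z T = 1` and `T Z = 1` show that `T₁₁` and `T₂₂` invert `A` and `D` on
both sides up to nilpotent errors. -/
theorem IsQuantumSuperMatrix.isUnit_blocks (h : IsParam q p r) {Z : Matrix (Idx m n) (Idx m n) S}
    (hZ : IsQuantumSuperMatrix q p r Z) (hu : IsUnit Z) :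
    IsUnit Z.toBlocks₁₁ ∧ IsUnit Z.toBlocks₂₂ := by
  obtain ⟨T, hZT, hTZ⟩ := isUnit_iff_exists.1 hu
  obtain ⟨N, hN⟩ := hZ.nilpotent_B h
  obtain ⟨N', hN'⟩ := hZ.nilpotent_C h
  obtain ⟨n1, n2⟩ := isNilpotent_matrix_mul (hZ.exchange_B h hZT hTZ) hN
    (apply_mem_entrySpan Z.toBlocks₁₂) (apply_mem_entrySpan T.toBlocks₂₁)
  obtain ⟨n3, n4⟩ := isNilpotent_matrix_mul (hZ.exchange_C h hZT hTZ) hN'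
    (apply_mem_entrySpan Z.toBlocks₂₁) (apply_mem_entrySpan T.toBlocks₁₂)
  rw [← Matrix.fromBlocks_toBlocks Z, ← Matrix.fromBlocks_toBlocks T, Matrix.fromBlocks_multiply,
    ← Matrix.fromBlocks_one, Matrix.fromBlocks_inj] at hZT hTZ
  exact ⟨isUnit_of_mul_eq_one_sub (eq_sub_of_add_eq hZT.1) (eq_sub_of_add_eq hTZ.1) n1 n4,
    isUnit_of_mul_eq_one_sub (eq_sub_of_add_eq' hZT.2.2.2) (eq_sub_of_add_eq' hTZ.2.2.2) n3 n2⟩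

end Units

/-! ### Block factorization -/

section SchurUnits

variable {S : Type v} [Ring S] {e o : Type} [Fintype e] [Fintype o] [DecidableEq e] [DecidableEq o]

theorem isUnit_fromBlocks_lower (G : Matrix o e S) :
    IsUnit (Matrix.fromBlocks (1 : Matrix e e S) 0 G (1 : Matrix o o S)) :=
  isUnit_iff_exists.2 ⟨Matrix.fromBlocks 1 0 (-G) 1, by simp [Matrix.fromBlocks_multiply],
    by simp [Matrix.fromBlocks_multiply]⟩

theorem isUnit_fromBlocks_upper (H : Matrix e o S) :
    IsUnit (Matrix.fromBlocks (1 : Matrix e e S) H 0 (1 : Matrix o o S)) :=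
  isUnit_iff_exists.2 ⟨Matrix.fromBlocks 1 (-H) 0 1, by simp [Matrix.fromBlocks_multiply],
    by simp [Matrix.fromBlocks_multiply]⟩

theorem isUnit_fromBlocks_diagonal {A : Matrix e e S} {D : Matrix o o S} (hA : IsUnit A) :
    IsUnit (Matrix.fromBlocks A 0 0 D) ↔ IsUnit D := by
  constructor
  · intro h
    obtain ⟨T, h1, h2⟩ := isUnit_iff_exists.1 h
    rw [← Matrix.fromBlocks_toBlocks T, Matrix.fromBlocks_multiply, ← Matrix.fromBlocks_one,
      Matrix.fromBlocks_inj] at h1 h2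
    exact isUnit_iff_exists.2 ⟨T.toBlocks₂₂, by simpa using h1.2.2.2, by simpa using h2.2.2.2⟩
  · intro hD
    obtain ⟨A', h1, h2⟩ := isUnit_iff_exists.1 hA
    obtain ⟨D', h3, h4⟩ := isUnit_iff_exists.1 hD
    exact isUnit_iff_exists.2 ⟨Matrix.fromBlocks A' 0 0 D',
      by simp [Matrix.fromBlocks_multiply, h1, h3], by simp [Matrix.fromBlocks_multiply, h2, h4]⟩

/-- Block Gauss decomposition: `Z` is unitriangular times block diagonal times unitriangular. -/
theorem isUnit_iff_isUnit_schur {Z : Matrix (e ⊕ o) (e ⊕ o) S} {A' : Matrix e e S}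
    (h1 : Z.toBlocks₁₁ * A' = 1) (h2 : A' * Z.toBlocks₁₁ = 1) :
    IsUnit Z ↔ IsUnit (Z.toBlocks₂₂ - Z.toBlocks₂₁ * A' * Z.toBlocks₁₂) := by
  have hZ : Z = Matrix.fromBlocks 1 0 (Z.toBlocks₂₁ * A') 1 *
      Matrix.fromBlocks Z.toBlocks₁₁ 0 0 (Z.toBlocks₂₂ - Z.toBlocks₂₁ * A' * Z.toBlocks₁₂) *
        Matrix.fromBlocks 1 (A' * Z.toBlocks₁₂) 0 1 := by
    conv_lhs => rw [← Matrix.fromBlocks_toBlocks Z]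
    rw [Matrix.fromBlocks_multiply, Matrix.fromBlocks_multiply, Matrix.fromBlocks_inj]
    refine ⟨by simp, ?_, ?_, ?_⟩
    · simp [← Matrix.mul_assoc, h1]
    · simp [Matrix.mul_assoc, h2]
    · simp only [Matrix.mul_zero, Matrix.one_mul, Matrix.mul_one, add_zero, Matrix.mul_assoc, h2]
      abel
  conv_lhs => rw [hZ]
  obtain ⟨L, hL⟩ := isUnit_fromBlocks_lower (Z.toBlocks₂₁ * A')
  obtain ⟨U, hU⟩ := isUnit_fromBlocks_upper (A' * Z.toBlocks₁₂)
  rw [← hL, ← hU, Units.isUnit_mul_units, Units.isUnit_units_mul,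
    isUnit_fromBlocks_diagonal (isUnit_iff_exists.2 ⟨A', h1, h2⟩)]

end SchurUnits

/-! ### Invertibility of `Z` from that of its diagonal blocks -/

section

variable {K : Type u} [Field K] [CharZero K] {m n : ℕ} {q : K} {p r : Idx m n → Idx m n → K}
  {S : Type v} [Ring S] [Algebra K S]

/-- Multiplying `ac` by `A'₁` on the left and `A'₂` on the right gives `C₂ R A'₂ = A'₁ Q C₁`. The
matrix `Q` only flips and rescales, so each product of entries of `A'` and `C` is isolated. -/
theorem IsQuantumSuperMatrix.exchange_A_inv (h : IsParam q p r)
    {Z : Matrix (Idx m n) (Idx m n) S} (hZ : IsQuantumSuperMatrix q p r Z)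
    {A' : Matrix (Fin m) (Fin m) S} (h1 : Z.toBlocks₁₁ * A' = 1) (h2 : A' * Z.toBlocks₁₁ = 1) :
    entrySpan K A' * entrySpan K Z.toBlocks₂₁ ≤ entrySpan K Z.toBlocks₂₁ * entrySpan K A' := by
  have hac := (hZ.blockRelations h).ac
  rw [h.Re_eq, ← leg₁_mul_leg₂, ← leg₁_mul_leg₂] at hac
  have hA₁ : leg₁ A' (Fin n) * leg₁ Z.toBlocks₁₁ (Fin n) = 1 := by rw [← leg₁_mul, h2, leg₁_one]
  have hA₂ : leg₂ (Fin m) Z.toBlocks₁₁ * leg₂ (Fin m) A' = 1 := by rw [← leg₂_mul, h1, leg₂_one]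
  have h3 := congrArg (fun M => leg₁ A' (Fin n) * M * leg₂ (Fin m) A') hac
  simp only [Matrix.mul_assoc, hA₂, Matrix.mul_one] at h3
  rw [← Matrix.mul_assoc (leg₁ A' _) (leg₁ _ _), hA₁, Matrix.one_mul] at h3
  refine entrySpan_mul_le fun k j l i => ?_
  have h4 := congrFun (congrFun h3 (k, l)) (i, j)
  rw [leg₂_mul_apply, leg₁_mul_apply] at h4
  simp only [twoTerm_mul_apply, PInv_mul_apply, leg₁_apply, leg₂_apply] at h4
  rw [Finset.sum_eq_single (f := fun x => A' k x * _) j (fun x _ hx => by simp [hx]) (by simp),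
    if_pos rfl, mul_smul_comm] at h4
  have hc : q * (p (Sum.inl j) (Sum.inr l))⁻¹ ≠ 0 := mul_ne_zero h.q0 (inv_ne_zero (h.p0 _ _))
  rw [← Submodule.smul_mem_iff _ hc, ← h4]
  refine Submodule.sum_mem _ fun x _ =>
    Submodule.mul_mem_mul (apply_mem_entrySpan _ _ _) (Submodule.add_mem _ ?_ ?_) <;>
  · refine Submodule.smul_mem _ _ ?_
    split_ifs
    · exact apply_mem_entrySpan _ _ _
    · exact Submodule.zero_mem _

theorem IsQuantumSuperMatrix.exchange_D_inv (h : IsParam q p r)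
    {Z : Matrix (Idx m n) (Idx m n) S} (hZ : IsQuantumSuperMatrix q p r Z)
    {D' : Matrix (Fin n) (Fin n) S} (h1 : Z.toBlocks₂₂ * D' = 1) (h2 : D' * Z.toBlocks₂₂ = 1) :
    entrySpan K D' * entrySpan K Z.toBlocks₂₁ ≤ entrySpan K Z.toBlocks₂₁ * entrySpan K D' := by
  have hcd := (hZ.blockRelations h).cd
  rw [h.Ro_eq, ← leg₁_mul_leg₂, ← leg₁_mul_leg₂] at hcd
  have hD₁ : leg₁ D' (Fin n) * leg₁ Z.toBlocks₂₂ (Fin n) = 1 := by rw [← leg₁_mul, h2, leg₁_one]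
  have hD₂ : leg₂ (Fin m) Z.toBlocks₂₂ * leg₂ (Fin m) D' = 1 := by rw [← leg₂_mul, h1, leg₂_one]
  have h3 := congrArg (fun M => leg₁ D' (Fin n) * M * leg₂ (Fin m) D') hcd
  simp only [Matrix.mul_assoc, hD₂, Matrix.mul_one, Matrix.mul_neg, Matrix.neg_mul] at h3
  rw [← Matrix.mul_assoc (leg₁ D' _) (leg₁ _ _), hD₁, Matrix.one_mul] at h3
  have hM : ∀ l i k j, Z.toBlocks₂₁ l i * D' k j ∈ entrySpan K Z.toBlocks₂₁ * entrySpan K D' :=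
    fun l i k j => Submodule.mul_mem_mul (apply_mem_entrySpan _ l i) (apply_mem_entrySpan _ k j)
  refine entrySpan_mul_le fun k j l i => ?_
  -- The relation is `D'₁ R' C₁ = -C₂ P D'₂`. Unlike `Q` above, `R'` mixes several products of
  -- entries of `D'` and `C`, so a triangular system appears.
  refine mem_of_triangular (ι := Fin n) (y := fun j l => D' k j * Z.toBlocks₂₁ l i)
    (φ := fun l j => -(p (Sum.inr l) (Sum.inr j) * (1 + ordCoeff q l j)))
    (e := fun a j => ordCoeff q a j) (fun a => n - a)
    (fun l j _ => neg_ne_zero.2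
      (mul_ne_zero (h.p0 _ _) (one_add_ordCoeff_ne_zero h.q0 h.one_add_ne _ _)))
    (fun j => ?_) (fun a j haj he => ?_) (fun j l => ?_) j l
  · rw [h.p1, ordCoeff_self, one_mul, ← sub_eq_neg_add]
    norm_num
  · have hja : j < a := by
      by_contra hlt
      exact he (ordCoeff_of_lt q (lt_of_le_of_ne (not_lt.1 hlt) haj))
    have : (j : ℕ) < a := hja
    omega
  · have h4 := congrFun (congrFun h3 (k, l)) (i, j)
    rw [leg₁_mul_apply, Matrix.neg_apply, leg₂_mul_apply] at h4
    simp only [twoTerm_mul_apply, leg₁_apply] at h4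
    have h5 : (-(p (Sum.inr l) (Sum.inr j) * (1 + ordCoeff q l j))) • (D' k j * Z.toBlocks₂₁ l i) +
        (if l = j then ∑ a, ordCoeff q a j • (D' k a * Z.toBlocks₂₁ a i) else 0) =
        ∑ x, D' k x * (ordCoeff q x l • (if l = j then Z.toBlocks₂₁ x i else 0) +
          (-(p (Sum.inr l) (Sum.inr x) * (1 + ordCoeff q l x))) •
            (if x = j then Z.toBlocks₂₁ l i else 0)) := by
      simp only [mul_add, mul_smul_comm, Finset.sum_add_distrib, mul_ite, mul_zero]
      rw [add_comm]
      congr 1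
      · split_ifs with hlj
        · subst hlj; rfl
        · simp
      · rw [Finset.sum_eq_single j (fun x _ hx => by simp [hx]) (by simp), if_pos rfl]
    rw [h5, h4]
    refine Submodule.neg_mem _ (Submodule.sum_mem _ fun x _ => ?_)
    have h6 : (sc S (PMat p) * leg₂ (Fin m) D') (k, x) (i, j) =
        p (Sum.inl x) (Sum.inr k) • (leg₂ (Fin m) D') (x, k) (i, j) := by
      rw [Matrix.mul_apply, Finset.sum_eq_single (x, k)]
      · simp [PMat, Algebra.smul_def]
      · rintro ⟨a, c⟩ - hac
        have : ¬ (x = a ∧ k = c) := fun h => hac (by rw [h.1, h.2])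
        simp [PMat, this]
      · simp
    rw [h6, leg₂_apply, mul_smul_comm]
    refine Submodule.smul_mem _ _ ?_
    split_ifs
    · exact hM _ _ _ _
    · rw [mul_zero]; exact Submodule.zero_mem _

theorem IsQuantumSuperMatrix.exchange_BC (h : IsParam q p r)
    {Z : Matrix (Idx m n) (Idx m n) S} (hZ : IsQuantumSuperMatrix q p r Z) :
    entrySpan K Z.toBlocks₁₂ * entrySpan K Z.toBlocks₂₁ ≤
      entrySpan K Z.toBlocks₂₁ * entrySpan K Z.toBlocks₁₂ := by
  refine entrySpan_mul_le fun k j l i => ?_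
  have h1 := congrFun (congrFun (hZ.blockRelations h).bc (k, l)) (i, j)
  rw [mul_PMat_apply, Matrix.neg_apply, PInv_mul_apply] at h1
  rw [← Submodule.smul_mem_iff _ (h.p0 (Sum.inl i) (Sum.inr j))]
  refine Eq.mpr (congrArg (· ∈ _) h1) (Submodule.neg_mem _ (Submodule.smul_mem _ _ ?_))
  exact Submodule.mul_mem_mul (apply_mem_entrySpan _ _ _) (apply_mem_entrySpan _ _ _)

theorem IsQuantumSuperMatrix.isUnit_of_blocks (h : IsParam q p r)
    {Z : Matrix (Idx m n) (Idx m n) S} (hZ : IsQuantumSuperMatrix q p r Z)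
    (hA : IsUnit Z.toBlocks₁₁) (hD : IsUnit Z.toBlocks₂₂) : IsUnit Z := by
  obtain ⟨A', hA1, hA2⟩ := isUnit_iff_exists.1 hA
  obtain ⟨D', hD1, hD2⟩ := isUnit_iff_exists.1 hD
  rw [isUnit_iff_isUnit_schur hA1 hA2]
  set B := Z.toBlocks₁₂
  set C := Z.toBlocks₂₁
  obtain ⟨N, hN⟩ := hZ.nilpotent_C h
  have hac := hZ.exchange_A_inv h hA1 hA2
  have hdc := hZ.exchange_D_inv h hD1 hD2
  have hbc := hZ.exchange_BC h
  have hle : entrySpan K D' * (entrySpan K A' * entrySpan K B) * entrySpan K C ≤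
      entrySpan K C * (entrySpan K D' * (entrySpan K A' * entrySpan K B)) := by
    set a := entrySpan K A'
    set b := entrySpan K B
    set c := entrySpan K C
    set d := entrySpan K D'
    calc d * (a * b) * c = d * a * (b * c) := by simp only [mul_assoc]
      _ ≤ d * a * (c * b) := by gcongr
      _ = d * (a * c) * b := by simp only [mul_assoc]
      _ ≤ d * (c * a) * b := mul_le_mul_left (mul_le_mul_right hac _) _
      _ = (d * c) * (a * b) := by simp only [mul_assoc]
      _ ≤ (c * d) * (a * b) := by gcongr
      _ = _ := by simp only [mul_assoc]
  -- The entries of `D'`, `A'` and `B` can all be moved to the right of those of `C`, so powers of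
  -- this product contain growing powers of the nilpotent span of `C`.
  have hnil : IsNilpotent (D' * C * (A' * B)) := by
    refine isNilpotent_of_mem (X := entrySpan K C * (entrySpan K D' * (entrySpan K A' *
      entrySpan K B))) (fun i j => ?_) (mul_pow_eq_bot hle hN)
    have h1 := matrix_mul_mem (matrix_mul_mem (apply_mem_entrySpan (K := K) D')
      (apply_mem_entrySpan C)) (matrix_mul_mem (apply_mem_entrySpan (K := K) A')
      (apply_mem_entrySpan B)) i j
    rw [← mul_assoc]
    exact mul_le_mul_left hdc _ h1
  have : Z.toBlocks₂₂ - C * A' * B = Z.toBlocks₂₂ * (1 - D' * C * (A' * B)) := by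
    rw [mul_sub, mul_one, Matrix.mul_assoc D', ← Matrix.mul_assoc Z.toBlocks₂₂, hD1,
      Matrix.one_mul, Matrix.mul_assoc]
  rw [this]
  exact hD.mul hnil.isUnit_one_sub

theorem IsQuantumSuperMatrix.isUnit_iff (h : IsParam q p r)
    {Z : Matrix (Idx m n) (Idx m n) S} (hZ : IsQuantumSuperMatrix q p r Z) :
    IsUnit Z ↔ IsUnit Z.toBlocks₁₁ ∧ IsUnit Z.toBlocks₂₂ :=
  ⟨hZ.isUnit_blocks h, fun hu => hZ.isUnit_of_blocks h hu.1 hu.2⟩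

end

/-! ### Hecke relations; determinants of the two diagonal blocks -/

section Hecke

variable {K : Type u} [Field K] {S : Type v} [Ring S] [Algebra K S]

theorem twoTerm_mul_self {ι : Type} [Fintype ι] [DecidableEq ι] {q : K} {e f : ι → ι → K}
    (he : ∀ i j, e i j + e j i = q - 1) (hf : ∀ i j, f i j * f j i - e i j * e j i = q) :
    twoTerm e f * twoTerm e f = (q - 1) • twoTerm e f + q • 1 := by
  ext ⟨k, l⟩ ⟨i, j⟩
  have h := twoTerm_mul_apply (S := K) e f (twoTerm e f) k l (i, j)
  have hid : sc K (twoTerm e f) = twoTerm e f := by ext; simp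
  rw [hid] at h
  rw [h, Matrix.add_apply, Matrix.smul_apply, Matrix.smul_apply]
  simp only [twoTerm, Matrix.of_apply, smul_eq_mul, Matrix.one_apply, Prod.mk.injEq]
  have h1 := he k l
  have h2 := hf k l
  by_cases hki : k = i
  · subst hki
    by_cases hlj : l = j
    · subst hlj
      by_cases hkl : k = l
      · subst hkl
        simp only [and_self, if_true, mul_one]
        linear_combination (e k k + f k k) * h1 + h2
      · simp only [and_self, hkl, Ne.symm hkl, if_true, if_false, mul_one, mul_zero, add_zero,
          zero_add]
        linear_combination e k l * h1 + h2
    · by_cases hkl : k = l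
      · subst hkl
        simp [hlj]
      · simp [hlj, Ne.symm hkl]
  · by_cases hli : l = i
    · subst hli
      by_cases hkj : k = j
      · subst hkj
        simp only [hki, Ne.symm hki, and_self, if_true, if_false, mul_one, mul_zero, add_zero,
          zero_add]
        linear_combination f l k * h1
      · simp [hki, hkj]
    · simp [hki, hli]

theorem algebraMap_one_apply {a : Type} [DecidableEq a] (i j : a) :
    algebraMap K S ((1 : Matrix a a K) i j) = (1 : Matrix a a S) i j := by
  simp only [Matrix.one_apply]
  split_ifs <;> simp

theorem sc_hecke {a : Type} [Fintype a] [DecidableEq a] {q : K} {R : Matrix a a K}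
    (h : R * R = (q - 1) • R + q • 1) :
    sc S R * sc S R = (q - 1) • sc S R + q • (1 : Matrix a a S) := by
  have h1 := congrArg (fun M => M.map (algebraMap K S)) h
  simp only [Matrix.map_mul] at h1
  rw [h1]
  ext i j
  simp only [Matrix.map_apply, Matrix.add_apply, Matrix.smul_apply, smul_eq_mul, map_add, map_mul,
    algebraMap_one_apply]
  rw [Algebra.smul_def, Algebra.smul_def]

variable [CharZero K] {m n : ℕ} {q : K} {p r : Idx m n → Idx m n → K}

theorem IsParam.Re_hecke (h : IsParam q p r) :
    Re q p r * Re q p r = (q - 1) • Re q p r + q • 1 := by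
  rw [h.Re_eq]
  refine twoTerm_mul_self (ordCoeff_add_swap q) fun i j => ?_
  linear_combination (1 + ordCoeff q i j) * (1 + ordCoeff q j i) *
    h.p_mul (Sum.inl i) (Sum.inl j) + ordCoeff_hecke q i j

theorem IsParam.Ro_hecke (h : IsParam q p r) :
    Ro q p r * Ro q p r = (q - 1) • Ro q p r + q • 1 := by
  rw [h.Ro_eq]
  refine twoTerm_mul_self (ordCoeff_add_swap q) fun i j => ?_
  linear_combination (1 + ordCoeff q i j) * (1 + ordCoeff q j i) *
    h.p_mul (Sum.inr i) (Sum.inr j) + ordCoeff_hecke q i j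

theorem IsParam.isQMat_even (h : IsParam q p r) {A : Matrix (Fin m) (Fin m) S}
    (hA : sc S (Re q p r) * (A ⊗ₖ A) = (A ⊗ₖ A) * sc S (Re q p r)) :
    IsQMat q (fun i j => p (Sum.inl i) (Sum.inl j)) A := by
  rw [h.Re_eq] at hA
  exact isQMat_iff.2 hA

/-- The eigenvalues of `R_o` are `q` and `-1`. Scaling by `-q⁻¹` turns them into `-1` and `q⁻¹`, and
the result is the standard Hecke matrix for `q⁻¹` with parameters `r⁻¹`, matching the coefficients
of `detOdd`. -/
theorem IsParam.isQMat_odd (h : IsParam q p r) {D : Matrix (Fin n) (Fin n) S}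
    (hD : sc S (Ro q p r) * (D ⊗ₖ D) = (D ⊗ₖ D) * sc S (Ro q p r)) :
    IsQMat q⁻¹ (fun i j => (r (Sum.inr i) (Sum.inr j))⁻¹) D := by
  have hq0 := h.q0
  have e1 : ∀ i j : Fin n, ordCoeff q⁻¹ i j = -q⁻¹ * ordCoeff q i j := by
    intro i j
    unfold ordCoeff
    split_ifs <;> field_simp <;> ring
  have e2 : ∀ i j : Fin n, (r (Sum.inr i) (Sum.inr j))⁻¹ * (1 + ordCoeff q⁻¹ i j) =
      -q⁻¹ * -(p (Sum.inr i) (Sum.inr j) * (1 + ordCoeff q i j)) := by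
    intro i j
    have hri := h.r0 (Sum.inr i) (Sum.inr j)
    rcases lt_trichotomy i j with hij | rfl | hij
    · have h1 := h.pr (Sum.inr i) (Sum.inr j) (by simpa using hij)
      rw [ordCoeff_of_lt _ hij, ordCoeff_of_lt _ hij]
      field_simp
      linear_combination -h1
    · rw [ordCoeff_self, ordCoeff_self, h.p1, h.r1]
      field_simp
      ring
    · have h1 := h.pr (Sum.inr j) (Sum.inr i) (by simpa using hij)
      have h2 := h.p_mul (Sum.inr i) (Sum.inr j)
      have h3 := h.r_mul (Sum.inr i) (Sum.inr j)
      rw [ordCoeff_of_gt _ hij, ordCoeff_of_gt _ hij]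
      field_simp
      linear_combination p (Sum.inr i) (Sum.inr j) * r (Sum.inr i) (Sum.inr j) * h1 -
        h2 * (r (Sum.inr i) (Sum.inr j) * r (Sum.inr j) (Sum.inr i)) - h3
  rw [h.Ro_eq] at hD
  intro i j k l
  have h1 := congrFun (congrFun hD (k, l)) (i, j)
  rw [twoTerm_mul_apply, mul_twoTerm_apply] at h1
  have h2 := congrArg ((-q⁻¹) • ·) h1
  simp only [smul_add, smul_smul] at h2
  change ordCoeff q⁻¹ k l • (D k i * D l j) +
      ((r (Sum.inr l) (Sum.inr k))⁻¹ * (1 + ordCoeff q⁻¹ l k)) • (D l i * D k j) =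
    ordCoeff q⁻¹ i j • (D k i * D l j) +
      ((r (Sum.inr i) (Sum.inr j))⁻¹ * (1 + ordCoeff q⁻¹ i j)) • (D k j * D l i)
  rw [e2, e2, e1, e1]
  exact h2

theorem IsParam.isUnit_detEven_iff (h : IsParam q p r) {A : Matrix (Fin m) (Fin m) S}
    (hA : sc S (Re q p r) * (A ⊗ₖ A) = (A ⊗ₖ A) * sc S (Re q p r)) :
    IsUnit (detEven p A) ↔ IsUnit A := by
  rw [detEven, detWith_eq_qdet fun i j => p (Sum.inl i) (Sum.inl j)]
  have hA' := h.isQMat_even hA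
  exact ⟨hA'.isUnit_of_isUnit_qdet (r := fun i j => r (Sum.inl i) (Sum.inl j)) h.q0 h.hq
    h.one_add_ne (fun _ _ => h.p_mul _ _) (fun _ => h.p1 _) (fun _ _ => h.r_mul _ _)
    (fun _ => h.r1 _) (fun i j hij => h.pr _ _ (by simpa using hij)),
    hA'.isUnit_qdet_of_isUnit h.q0 h.one_add_ne (fun _ _ => h.p_mul _ _) (fun _ => h.p1 _)⟩

theorem IsParam.isUnit_detOdd_iff (h : IsParam q p r) {D : Matrix (Fin n) (Fin n) S}
    (hD : sc S (Ro q p r) * (D ⊗ₖ D) = (D ⊗ₖ D) * sc S (Ro q p r)) :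
    IsUnit (detOdd r D) ↔ IsUnit D := by
  rw [detOdd, detWith_eq_qdet fun i j => (r (Sum.inr i) (Sum.inr j))⁻¹]
  have hD' := h.isQMat_odd hD
  have hq0 := h.q0
  have h1 : 1 + q⁻¹ ≠ 0 := fun h0 => h.one_add_ne (by
    field_simp at h0
    linear_combination h0)
  have hr : ∀ i j : Fin n, (r (Sum.inr i) (Sum.inr j))⁻¹ * (r (Sum.inr j) (Sum.inr i))⁻¹ = 1 :=
    fun i j => by rw [← mul_inv, h.r_mul, inv_one]
  have hp : ∀ i j : Fin n, (p (Sum.inr i) (Sum.inr j))⁻¹ * (p (Sum.inr j) (Sum.inr i))⁻¹ = 1 :=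
    fun i j => by rw [← mul_inv, h.p_mul, inv_one]
  -- The parameters for the transpose are `p⁻¹`, because `r⁻¹ p⁻¹ = q⁻¹` for `i < j`.
  refine ⟨hD'.isUnit_of_isUnit_qdet (r := fun i j => (p (Sum.inr i) (Sum.inr j))⁻¹)
    (inv_ne_zero hq0) (fun k hk hqk => ?_) h1 hr (fun i => by rw [h.r1, inv_one]) hp
    (fun i => by rw [h.p1, inv_one]) (fun i j hij => ?_),
    hD'.isUnit_qdet_of_isUnit (inv_ne_zero hq0) h1 hr (fun i => by rw [h.r1, inv_one])⟩
  · rw [inv_pow, inv_eq_one] at hqk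
    rw [h.hq k hk hqk, inv_one]
  · rw [← mul_inv, mul_comm, h.pr _ _ (by simpa using hij)]

theorem IsQuantumSuperMatrix.schur (h : IsParam q p r) {Z : Matrix (Idx m n) (Idx m n) S}
    (hZ : IsQuantumSuperMatrix q p r Z) {A' : Matrix (Fin m) (Fin m) S}
    (h1 : Z.toBlocks₁₁ * A' = 1) (h2 : A' * Z.toBlocks₁₁ = 1) :
    sc S (Ro q p r) * ((Z.toBlocks₂₂ - Z.toBlocks₂₁ * A' * Z.toBlocks₁₂) ⊗ₖ
        (Z.toBlocks₂₂ - Z.toBlocks₂₁ * A' * Z.toBlocks₁₂)) =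
      ((Z.toBlocks₂₂ - Z.toBlocks₂₁ * A' * Z.toBlocks₁₂) ⊗ₖ
        (Z.toBlocks₂₂ - Z.toBlocks₂₁ * A' * Z.toBlocks₁₂)) * sc S (Ro q p r) := by
  have hq0 := h.q0
  have hR := sc_hecke (S := S) h.Re_hecke
  set R := sc S (Re q p r) with hRdef
  -- The inverse of `R`, read off from `R * R = (q - 1) • R + q • 1`.
  set Ri := q⁻¹ • (R - (q - 1) • (1 : Matrix (Fin m × Fin m) (Fin m × Fin m) S)) with hRi
  have hRRi : R * Ri = 1 := by
    rw [hRi, mul_smul_comm, mul_sub, hR, mul_smul_comm, mul_one, add_sub_cancel_left, smul_smul,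
      inv_mul_cancel₀ hq0, one_smul]
  have hRiR : Ri * R = 1 := by
    rw [hRi, smul_mul_assoc, sub_mul, hR, smul_mul_assoc, one_mul, add_sub_cancel_left, smul_smul,
      inv_mul_cancel₀ hq0, one_smul]
  have hRi2 : (q - 1) • Ri + q • (Ri * Ri) = 1 := by
    have : q • (Ri * Ri) = Ri * (R - (q - 1) • 1) := by
      nth_rewrite 2 [hRi]
      rw [mul_smul_comm, smul_smul, mul_inv_cancel₀ hq0, one_smul]
    rw [this, mul_sub, hRiR, mul_smul_comm, mul_one, add_sub_cancel]
  have hPQ : sc S (PMat p) * sc S (q • PInv p) = q • 1 := by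
    rw [← Matrix.map_mul, Matrix.mul_smul, PMat_mul_PInv p h.p0]
    ext i j
    simp only [Matrix.map_apply, Matrix.smul_apply, smul_eq_mul, map_mul, algebraMap_one_apply]
    rw [Algebra.smul_def]
  exact (hZ.blockRelations h).schur hq0 hRRi hRiR hRi2 (sc_hecke h.Ro_hecke) hPQ h1
    (by rw [Matrix.mul_assoc, h2, Matrix.mul_one])

end Hecke

/-! ### Compatibility with algebra homomorphisms -/

section Maps

variable {K : Type u} [Field K] {S : Type v} [Ring S] [Algebra K S] {T : Type w} [Ring T]
  [Algebra K T] (φ : S →ₐ[K] T)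

theorem map_matrix_mul {a b c : Type} [Fintype b] (M : Matrix a b S) (N : Matrix b c S) :
    (M * N).map φ = M.map φ * N.map φ := by
  ext i j
  simp [Matrix.mul_apply]

theorem map_matrix_one {a : Type} [DecidableEq a] : (1 : Matrix a a S).map φ = 1 :=
  Matrix.map_one _ (map_zero φ) (map_one φ)

theorem map_kronecker {a b c d : Type} (M : Matrix a b S) (N : Matrix c d S) :
    (M ⊗ₖ N).map φ = M.map φ ⊗ₖ N.map φ := by
  ext i j
  simp

theorem map_sc {a b : Type} (M : Matrix a b K) : (sc S M).map φ = sc T M := by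
  ext i j
  simp

theorem map_sc_mul {a b c e f : Type} [Fintype b] [Fintype e] (M : Matrix a (b × e) K)
    (X : Matrix b c S) (Y : Matrix e f S) :
    (sc S M * (X ⊗ₖ Y)).map φ = sc T M * (X.map φ ⊗ₖ Y.map φ) := by
  rw [map_matrix_mul, map_kronecker, map_sc]

theorem map_mul_sc {a b c e f : Type} [Fintype b] [Fintype e] (M : Matrix (b × e) a K)
    (X : Matrix c b S) (Y : Matrix f e S) :
    ((X ⊗ₖ Y) * sc S M).map φ = (X.map φ ⊗ₖ Y.map φ) * sc T M := by
  rw [map_matrix_mul, map_kronecker, map_sc]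

theorem map_matrix_neg {a b : Type} (M : Matrix a b S) : (-M).map φ = -M.map φ := by
  ext
  simp

theorem map_matrix_sub {a b : Type} (M N : Matrix a b S) : (M - N).map φ = M.map φ - N.map φ := by
  ext
  simp

theorem map_matrix_smul {a b : Type} (c : K) (M : Matrix a b S) : (c • M).map φ = c • M.map φ := by
  ext
  simp

theorem map_detWith {k : ℕ} (c : Fin k → Fin k → K) (A : Matrix (Fin k) (Fin k) S) :
    φ (detWith c A) = detWith c (A.map φ) := by
  simp only [detWith, map_sum, map_mul, AlgHom.commutes, map_list_prod, List.map_ofFn]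
  rfl

theorem isUnit_map_matrix {a : Type} [Fintype a] [DecidableEq a] {M : Matrix a a S}
    (h : IsUnit M) : IsUnit (M.map φ) := by
  obtain ⟨N, h1, h2⟩ := isUnit_iff_exists.1 h
  exact isUnit_iff_exists.2 ⟨N.map φ, by rw [← map_matrix_mul, h1, map_matrix_one],
    by rw [← map_matrix_mul, h2, map_matrix_one]⟩

variable {m n : ℕ} {q : K} {p r : Idx m n → Idx m n → K}

theorem map_zLHS (Z : Matrix (Idx m n) (Idx m n) S) (i j k l : Idx m n) :
    φ (zLHS q p r Z i j k l) = zLHS q p r (Z.map φ) i j k l := by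
  simp only [zLHS, map_sum, map_mul, map_pow, map_neg, map_one, AlgHom.commutes, Matrix.map_apply]

theorem map_zRHS (Z : Matrix (Idx m n) (Idx m n) S) (i j k l : Idx m n) :
    φ (zRHS q p r Z i j k l) = zRHS q p r (Z.map φ) i j k l := by
  simp only [zRHS, map_sum, map_mul, map_pow, map_neg, map_one, AlgHom.commutes, Matrix.map_apply]

theorem IsQuantumSuperMatrix.map {Z : Matrix (Idx m n) (Idx m n) S}
    (hZ : IsQuantumSuperMatrix q p r Z) : IsQuantumSuperMatrix q p r (Z.map φ) := fun i j k l => by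
  rw [← map_zLHS, ← map_zRHS, hZ i j k l]

end Maps

/-! ### Universal properties of the presented algebras -/

section BlockAlgebra

variable {K : Type u} [Field K] {m n : ℕ} {q : K} {p r : Idx m n → Idx m n → K}

theorem entryRel_iff {F : Type v} [Ring F] [Algebra K F] {S : Type w} [Ring S] [Algebra K S]
    (φ : F →ₐ[K] S) {a b : Type} {M N : Matrix a b F} :
    (∀ u v, EntryRel M N u v → φ u = φ v) ↔ M.map φ = N.map φ := by
  constructor
  · intro h
    ext i j
    exact h _ _ ⟨i, j⟩
  · rintro h _ _ ⟨i, j⟩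
    exact congrFun (congrFun h i) j

theorem entryRel_iff_of_map {F : Type v} [Ring F] [Algebra K F] {S : Type w} [Ring S] [Algebra K S]
    (φ : F →ₐ[K] S) {a b : Type} {M N : Matrix a b F} {M' N' : Matrix a b S}
    (hM : M.map φ = M') (hN : N.map φ = N') :
    (∀ u v, EntryRel M N u v → φ u = φ v) ↔ M' = N' := by
  rw [entryRel_iff, hM, hN]

theorem blockRel_iff {S : Type v} [Ring S] [Algebra K S] (φ : FreeBlocks K m n →ₐ[K] S) :
    (∀ u v, BlockRel q p r u v → φ u = φ v) ↔
      BlockRelations q (sc S (Re q p r)) (sc S (Ro q p r)) (sc S (PMat p)) (sc S (q • PInv p))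
        (gA.map φ) (gB.map φ) (gC.map φ) (gD.map φ) := by
  constructor
  · intro h
    exact
      { aa := (entryRel_iff_of_map φ (map_sc_mul φ _ _ _)
          (map_mul_sc φ _ _ _)).1 fun u v huv => h u v (.aa huv)
        bb := (entryRel_iff_of_map φ (map_sc_mul φ _ _ _)
          (map_mul_sc φ _ _ _)).1 fun u v huv => h u v (.bb huv)
        cc := (entryRel_iff_of_map φ (map_mul_sc φ _ _ _)
          (map_sc_mul φ _ _ _)).1 fun u v huv => h u v (.cc huv)
        dd := (entryRel_iff_of_map φ (map_sc_mul φ _ _ _)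
          (map_mul_sc φ _ _ _)).1 fun u v huv => h u v (.dd huv)
        ab := (entryRel_iff_of_map φ (map_sc_mul φ _ _ _)
          (map_mul_sc φ _ _ _)).1 fun u v huv => h u v (.ab huv)
        ac := (entryRel_iff_of_map φ (map_mul_sc φ _ _ _)
          (map_sc_mul φ _ _ _)).1 fun u v huv => h u v (.ac huv)
        cd := (entryRel_iff_of_map φ (map_sc_mul φ _ _ _)
          ((map_matrix_neg φ _).trans (congrArg Neg.neg (map_mul_sc φ _ _ _)))).1 fun u v huv => h u v (.cd huv)
        bd := (entryRel_iff_of_map φ ((map_matrix_neg φ _).trans (congrArg Neg.neg (map_mul_sc φ _ _ _)))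
          (map_sc_mul φ _ _ _)).1 fun u v huv => h u v (.bd huv)
        ad := (entryRel_iff_of_map φ ((map_matrix_sub φ _ _).trans (congrArg₂ (· - ·) (map_mul_sc φ _ _ _) (map_sc_mul φ _ _ _)))
          ((map_matrix_smul φ _ _).trans (congrArg _ (map_kronecker φ _ _)))).1 fun u v huv => h u v (.ad huv)
        bc := (entryRel_iff_of_map φ (map_mul_sc φ _ _ _)
          ((map_matrix_neg φ _).trans (congrArg Neg.neg (map_sc_mul φ _ _ _)))).1 fun u v huv => h u v (.bc huv) }
  · rintro h u v (huv | huv | huv | huv | huv | huv | huv | huv | huv | huv)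
    · exact (entryRel_iff_of_map φ (map_sc_mul φ _ _ _)
        (map_mul_sc φ _ _ _)).2 h.aa u v huv
    · exact (entryRel_iff_of_map φ (map_sc_mul φ _ _ _)
        (map_mul_sc φ _ _ _)).2 h.bb u v huv
    · exact (entryRel_iff_of_map φ (map_mul_sc φ _ _ _)
        (map_sc_mul φ _ _ _)).2 h.cc u v huv
    · exact (entryRel_iff_of_map φ (map_sc_mul φ _ _ _)
        (map_mul_sc φ _ _ _)).2 h.dd u v huv
    · exact (entryRel_iff_of_map φ (map_sc_mul φ _ _ _)
        (map_mul_sc φ _ _ _)).2 h.ab u v huv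
    · exact (entryRel_iff_of_map φ (map_mul_sc φ _ _ _)
        (map_sc_mul φ _ _ _)).2 h.ac u v huv
    · exact (entryRel_iff_of_map φ (map_sc_mul φ _ _ _)
        ((map_matrix_neg φ _).trans (congrArg Neg.neg (map_mul_sc φ _ _ _)))).2 h.cd u v huv
    · exact (entryRel_iff_of_map φ ((map_matrix_neg φ _).trans (congrArg Neg.neg (map_mul_sc φ _ _ _)))
        (map_sc_mul φ _ _ _)).2 h.bd u v huv
    · exact (entryRel_iff_of_map φ ((map_matrix_sub φ _ _).trans (congrArg₂ (· - ·) (map_mul_sc φ _ _ _) (map_sc_mul φ _ _ _)))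
        ((map_matrix_smul φ _ _).trans (congrArg _ (map_kronecker φ _ _)))).2 h.ad u v huv
    · exact (entryRel_iff_of_map φ (map_mul_sc φ _ _ _)
        ((map_matrix_neg φ _).trans (congrArg Neg.neg (map_sc_mul φ _ _ _)))).2 h.bc u v huv

theorem isQuantumSuperMatrix_blockZ [CharZero K] (h : IsParam q p r) :
    IsQuantumSuperMatrix q p r (blockZ q p r) :=
  BlockRelations.isQuantumSuperMatrix h
    ((blockRel_iff (BlockAlg.mk q p r)).1 fun _ _ huv => RingQuot.mkAlgHom_rel K huv)

theorem BlockAlg.exists_lift [CharZero K] (h : IsParam q p r) {S : Type v} [Ring S] [Algebra K S]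
    {Z : Matrix (Idx m n) (Idx m n) S} (hZ : IsQuantumSuperMatrix q p r Z) :
    ∃ φ : BlockAlg q p r →ₐ[K] S, (blockZ q p r).map φ = Z := by
  set f : FreeBlocks K m n →ₐ[K] S := FreeAlgebra.lift K fun x => Z x.1 x.2 with hf
  have hfZ : genZ.map f = Z := by
    ext i j
    simp [hf, genZ]
  have hrel : ∀ u v, BlockRel q p r u v → f u = f v := by
    rw [blockRel_iff]
    have := hZ.blockRelations h
    rw [← hfZ] at this
    exact this
  refine ⟨RingQuot.liftAlgHom K ⟨f, fun u v => hrel u v⟩, ?_⟩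
  rw [← hfZ]
  ext i j
  exact RingQuot.liftAlgHom_mkAlgHom_apply K f (fun u v => hrel u v) (genZ i j)

theorem BlockAlg.hom_ext {S : Type v} [Ring S] [Algebra K S] {f g : BlockAlg q p r →ₐ[K] S}
    (h : (blockZ q p r).map f = (blockZ q p r).map g) : f = g := by
  refine RingQuot.ringQuot_ext' K f g (FreeAlgebra.hom_ext (funext fun x => ?_))
  exact congrFun (congrFun h x.1) x.2

end BlockAlgebra

section Adjoin

variable {K : Type u} [Field K] {S : Type v} [Ring S] [Algebra K S]

theorem AdjoinInv.isUnit_of (x : S) : IsUnit (AdjoinInv.of K x x) := by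
  refine isUnit_iff_exists.2 ⟨AdjoinInv.mk K x (FreeAlgebra.ι K none), ?_, ?_⟩
  · have h := AdjoinInv.mk_rel K x .mul_inv
    rwa [map_mul, map_one] at h
  · have h := AdjoinInv.mk_rel K x .inv_mul
    rwa [map_mul, map_one] at h

theorem AdjoinInv.exists_lift {x : S} {T : Type w} [Ring T] [Algebra K T] (f : S →ₐ[K] T)
    (hx : IsUnit (f x)) : ∃ g : AdjoinInv K x →ₐ[K] T, g.comp (AdjoinInv.of K x) = f := by
  obtain ⟨y, h1, h2⟩ := isUnit_iff_exists.1 hx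
  set F : FreeAlgebra K (Option S) →ₐ[K] T := FreeAlgebra.lift K fun o => o.elim y f with hF
  have hs : ∀ s, F (FreeAlgebra.ι K (some s)) = f s := fun s => by simp [hF]
  have hn : F (FreeAlgebra.ι K none) = y := by simp [hF]
  have hrel : ∀ ⦃a b⦄, AdjoinInvRel K x a b → F a = F b := by
    rintro _ _ (⟨s, t⟩ | ⟨s, t⟩ | ⟨c⟩ | _ | _)
    · simp only [map_add, hs]
    · simp only [map_mul, hs]
    · simp only [hs, AlgHom.commutes]
    · rw [map_mul, hs, hn, h1, map_one]
    · rw [map_mul, hs, hn, h2, map_one]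
  refine ⟨RingQuot.liftAlgHom K ⟨F, hrel⟩, AlgHom.ext fun s => ?_⟩
  exact (RingQuot.liftAlgHom_mkAlgHom_apply K F hrel _).trans (hs s)

/-- The image of the adjoined generator is forced, as two-sided inverses are unique. -/
theorem AdjoinInv.hom_ext {x : S} {T : Type w} [Ring T] [Algebra K T] {f g : AdjoinInv K x →ₐ[K] T}
    (h : f.comp (AdjoinInv.of K x) = g.comp (AdjoinInv.of K x)) : f = g := by
  have hs : ∀ s, f (AdjoinInv.mk K x (FreeAlgebra.ι K (some s))) =
    g (AdjoinInv.mk K x (FreeAlgebra.ι K (some s))) := fun s => AlgHom.congr_fun h s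
  refine RingQuot.ringQuot_ext' K f g (FreeAlgebra.hom_ext (funext fun o => ?_))
  cases o with
  | some s => exact hs s
  | none =>
    have h1 := AdjoinInv.mk_rel K x .mul_inv
    have h2 := AdjoinInv.mk_rel K x .inv_mul
    rw [map_mul, map_one] at h1 h2
    have h3 := congrArg f h2
    have h4 := congrArg g h1
    rw [map_mul, map_one, hs] at h3
    rw [map_mul, map_one] at h4
    exact left_inv_eq_right_inv h3 h4

end Adjoin

/-! ### The function algebra represents invertible quantum super matrices -/

section FunctionAlgebra

variable {K : Type u} [Field K] {m n : ℕ} {q : K} {p r : Idx m n → Idx m n → K}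

theorem isQuantumSuperMatrix_glZ : IsQuantumSuperMatrix q p r (glZ q p r) := fun i j k l => by
  have h := RingQuot.mkAlgHom_rel K (GLRel.z (q := q) (p := p) (r := r) i j k l)
  have h' : GLAlg.mk q p r (zLHS q p r freeZ i j k l) = GLAlg.mk q p r (zRHS q p r freeZ i j k l) := h
  rwa [map_zLHS, map_zRHS] at h'

/-- A matrix with its signs changed as in the definition of the quantum general linear super
group. -/
def superTwist {S : Type v} [Ring S] (T : Matrix (Idx m n) (Idx m n) S) :
    Matrix (Idx m n) (Idx m n) S :=
  Matrix.of fun k i => (-1) ^ (par i * (par k + 1)) * T k i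

theorem superTwist_superTwist {S : Type v} [Ring S] (T : Matrix (Idx m n) (Idx m n) S) :
    superTwist (superTwist T) = T := by
  ext k i
  simp only [superTwist, Matrix.of_apply]
  rw [← mul_assoc, ← pow_add, Even.neg_one_pow ⟨_, rfl⟩, one_mul]

theorem superTwist_map {S : Type v} [Ring S] [Algebra K S] {T : Type w} [Ring T] [Algebra K T]
    (φ : S →ₐ[K] T) (M : Matrix (Idx m n) (Idx m n) S) :
    (superTwist M).map φ = superTwist (M.map φ) := by
  ext
  simp [superTwist]

theorem sum_mul_superTwist {S : Type v} [Ring S] (Z T : Matrix (Idx m n) (Idx m n) S)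
    (i j : Idx m n) :
    ∑ k, (-1) ^ (par i * (par k + 1)) * (Z j k * T k i) = (Z * superTwist T) j i := by
  rw [Matrix.mul_apply]
  refine Finset.sum_congr rfl fun k _ => ?_
  rw [superTwist, Matrix.of_apply, ← mul_assoc, ← mul_assoc,
    (((Commute.one_right (Z j k)).neg_right).pow_right _).eq]

theorem sum_superTwist_mul {S : Type v} [Ring S] (Z T : Matrix (Idx m n) (Idx m n) S)
    (i j : Idx m n) :
    ∑ k, (-1) ^ (par k * (par j + 1)) * (T j k * Z k i) = (superTwist T * Z) j i := by
  rw [Matrix.mul_apply]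
  refine Finset.sum_congr rfl fun k _ => ?_
  rw [superTwist, Matrix.of_apply, ← mul_assoc]

theorem freeT_relations {S : Type v} [Ring S] [Algebra K S] (φ : FreeZT K m n →ₐ[K] S)
    (i j : Idx m n) :
    (φ (∑ k, (-1) ^ (par i * (par k + 1)) * (freeZ j k * freeT k i)) =
        (freeZ.map φ * superTwist (freeT.map φ)) j i) ∧
      (φ (∑ k, (-1) ^ (par k * (par j + 1)) * (freeT j k * freeZ k i)) =
        (superTwist (freeT.map φ) * freeZ.map φ) j i) ∧
      φ (if i = j then 1 else 0) = (1 : Matrix (Idx m n) (Idx m n) S) j i := by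
  refine ⟨?_, ?_, ?_⟩
  · rw [← sum_mul_superTwist]
    simp
  · rw [← sum_superTwist_mul]
    simp
  · rw [Matrix.one_apply]
    by_cases hij : i = j
    · simp [hij]
    · simp [hij, Ne.symm hij]

theorem isUnit_glZ : IsUnit (glZ q p r) := by
  refine isUnit_iff_exists.2 ⟨superTwist (freeT.map (GLAlg.mk q p r)), ?_, ?_⟩
  · ext j i
    obtain ⟨h1, -, h3⟩ := freeT_relations (GLAlg.mk q p r) i j
    exact h1.symm.trans ((RingQuot.mkAlgHom_rel K (GLRel.zt i j)).trans h3)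
  · ext j i
    obtain ⟨-, h2, h3⟩ := freeT_relations (GLAlg.mk q p r) i j
    exact h2.symm.trans ((RingQuot.mkAlgHom_rel K (GLRel.tz i j)).trans h3)

theorem GLAlg.exists_lift {S : Type v} [Ring S] [Algebra K S]
    {Z : Matrix (Idx m n) (Idx m n) S} (hZ : IsQuantumSuperMatrix q p r Z) (hu : IsUnit Z) :
    ∃ φ : GLAlg q p r →ₐ[K] S, (glZ q p r).map φ = Z := by
  obtain ⟨T, h1, h2⟩ := isUnit_iff_exists.1 hu
  set f : FreeZT K m n →ₐ[K] S := FreeAlgebra.lift K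
    (Sum.elim (fun x => Z x.1 x.2) fun x => superTwist T x.1 x.2) with hf
  have hfZ : freeZ.map f = Z := by
    ext i j
    simp [hf, freeZ]
  have hfT : superTwist (freeT.map f) = T := by
    rw [← superTwist_superTwist T]
    congr 1
    ext i j
    simp [hf, freeT]
  have hrel : ∀ ⦃u v⦄, GLRel q p r u v → f u = f v := by
    rintro _ _ (⟨i, j, k, l⟩ | ⟨i, j⟩ | ⟨i, j⟩)
    · rw [map_zLHS, map_zRHS, hfZ, hZ i j k l]
    · obtain ⟨e1, -, e3⟩ := freeT_relations f i j
      rw [e1, e3, hfZ, hfT, h1]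
    · obtain ⟨-, e2, e3⟩ := freeT_relations f i j
      rw [e2, e3, hfZ, hfT, h2]
  refine ⟨RingQuot.liftAlgHom K ⟨f, hrel⟩, ?_⟩
  rw [← hfZ]
  ext i j
  exact RingQuot.liftAlgHom_mkAlgHom_apply K f hrel (freeZ i j)

/-- The generators `t` are, up to sign, the entries of the inverse of `glZ`, so their images are
determined by those of the `z`. -/
theorem GLAlg.hom_ext {S : Type v} [Ring S] [Algebra K S] {f g : GLAlg q p r →ₐ[K] S}
    (h : (glZ q p r).map f = (glZ q p r).map g) : f = g := by
  obtain ⟨T, h1, h2⟩ := isUnit_iff_exists.1 (isUnit_glZ (q := q) (p := p) (r := r))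
  have hT : superTwist (freeT.map (GLAlg.mk q p r)) = T := by
    refine left_inv_eq_right_inv (a := glZ q p r) ?_ h1
    ext j i
    obtain ⟨-, h2, h3⟩ := freeT_relations (GLAlg.mk q p r) i j
    exact h2.symm.trans ((RingQuot.mkAlgHom_rel K (GLRel.tz i j)).trans h3)
  have hfg : T.map f = T.map g := by
    have hf := congrArg (fun M => M.map f) h2
    have hg := congrArg (fun M => M.map g) h1
    simp only [map_matrix_mul, map_matrix_one] at hf hg
    rw [h] at hf
    exact left_inv_eq_right_inv hf hg
  have ht : (freeT.map (GLAlg.mk q p r)).map f = (freeT.map (GLAlg.mk q p r)).map g := by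
    rw [← superTwist_superTwist (freeT.map (GLAlg.mk q p r)), hT, superTwist_map, superTwist_map,
      hfg]
  refine RingQuot.ringQuot_ext' K f g (FreeAlgebra.hom_ext (funext fun x => ?_))
  rcases x with x | x
  · exact congrFun (congrFun h x.1) x.2
  · exact congrFun (congrFun ht x.1) x.2

end FunctionAlgebra

/-! ### Comparison of the universal algebras -/

section Universal

variable {K : Type u} [Field K] {m n : ℕ} {q : K} {p r : Idx m n → Idx m n → K}

/-- `X` is the universal algebra over which `Z` is an invertible quantum super matrix. -/
structure IsUniversal (q : K) (p r : Idx m n → Idx m n → K) (X : Type u) [Ring X] [Algebra K X]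
    (Z : Matrix (Idx m n) (Idx m n) X) : Prop where
  quantum : IsQuantumSuperMatrix q p r Z
  isUnit : IsUnit Z
  exists_lift : ∀ (Y : Type u) [Ring Y] [Algebra K Y] (W : Matrix (Idx m n) (Idx m n) Y),
    IsQuantumSuperMatrix q p r W → IsUnit W → ∃ φ : X →ₐ[K] Y, Z.map φ = W
  hom_ext : ∀ f : X →ₐ[K] X, Z.map f = Z → f = AlgHom.id K X

theorem IsUniversal.exists_algEquiv {X Y : Type u} [Ring X] [Algebra K X] [Ring Y] [Algebra K Y]
    {Z : Matrix (Idx m n) (Idx m n) X} {W : Matrix (Idx m n) (Idx m n) Y}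
    (hX : IsUniversal q p r X Z) (hY : IsUniversal q p r Y W) :
    ∃ φ : X ≃ₐ[K] Y, ∀ i j, φ (Z i j) = W i j := by
  obtain ⟨f, hf⟩ := hX.exists_lift Y W hY.quantum hY.isUnit
  obtain ⟨g, hg⟩ := hY.exists_lift X Z hX.quantum hX.isUnit
  have hf' : ∀ i j, f (Z i j) = W i j := fun i j => congrFun (congrFun hf i) j
  have hg' : ∀ i j, g (W i j) = Z i j := fun i j => congrFun (congrFun hg i) j
  refine ⟨AlgEquiv.ofAlgHom f g (hY.hom_ext _ ?_) (hX.hom_ext _ ?_), hf'⟩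
  · ext i j
    simp [hf', hg']
  · ext i j
    simp [hf', hg']

theorem isUniversal_glZ : IsUniversal q p r (GLAlg q p r) (glZ q p r) where
  quantum := isQuantumSuperMatrix_glZ
  isUnit := isUnit_glZ
  exists_lift _ _ _ _ hW hu := GLAlg.exists_lift hW hu
  hom_ext _ hf := GLAlg.hom_ext (hf.trans (Matrix.map_id _).symm)

variable [CharZero K]

theorem isQuantumSuperMatrix_zA (h : IsParam q p r) : IsQuantumSuperMatrix q p r (zA q p r) :=
  (isQuantumSuperMatrix_blockZ h).map _

theorem isUnit_zA_toBlocks₁₁ (h : IsParam q p r) : IsUnit (zA q p r).toBlocks₁₁ := by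
  refine (h.isUnit_detEven_iff ((isQuantumSuperMatrix_zA h).blockRelations h).aa).1 ?_
  have h1 := AdjoinInv.isUnit_of (K := K) (detEven p (blockZ q p r).toBlocks₁₁)
  rwa [show AdjoinInv.of K _ (detEven p (blockZ q p r).toBlocks₁₁) =
    detEven p (zA q p r).toBlocks₁₁ from map_detWith _ _ _] at h1

/-- Inverting the determinant of `A` is the same as inverting `A`, so `LocA` represents quantum
super matrices whose even block is invertible. -/
theorem LocA.exists_lift (h : IsParam q p r) {S : Type v} [Ring S] [Algebra K S]
    {Z : Matrix (Idx m n) (Idx m n) S} (hZ : IsQuantumSuperMatrix q p r Z)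
    (hA : IsUnit Z.toBlocks₁₁) : ∃ φ : LocA q p r →ₐ[K] S, (zA q p r).map φ = Z := by
  obtain ⟨f, hf⟩ := BlockAlg.exists_lift h hZ
  have hdet : IsUnit (f (detEven p (blockZ q p r).toBlocks₁₁)) := by
    rw [detEven, map_detWith]
    have h1 := (h.isUnit_detEven_iff (hZ.blockRelations h).aa).2 hA
    rw [← hf] at h1
    exact h1
  obtain ⟨g, hg⟩ := AdjoinInv.exists_lift f hdet
  refine ⟨g, ?_⟩
  rw [← hf, ← hg]
  rfl

theorem LocA.hom_ext {S : Type v} [Ring S] [Algebra K S] {f g : LocA q p r →ₐ[K] S}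
    (h : (zA q p r).map f = (zA q p r).map g) : f = g :=
  AdjoinInv.hom_ext (BlockAlg.hom_ext h)

/-- Adjoining an inverse of `x` to `LocA` gives a universal algebra, if the image of `x` under every
homomorphism is a unit exactly when the image of the generic matrix is one. -/
theorem isUniversal_adjoinInv (h : IsParam q p r) (x : LocA q p r)
    (hx : ∀ (S : Type u) [Ring S] [Algebra K S] (φ : LocA q p r →ₐ[K] S),
      IsUnit (φ x) ↔ IsUnit ((zA q p r).map φ)) :
    IsUniversal q p r (AdjoinInv K x) ((zA q p r).map (AdjoinInv.of K x)) where
  quantum := (isQuantumSuperMatrix_zA h).map _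
  isUnit := (hx _ _).1 (AdjoinInv.isUnit_of x)
  exists_lift Y _ _ W hW hu := by
    obtain ⟨f, hf⟩ := LocA.exists_lift h hW (hW.isUnit_blocks h hu).1
    obtain ⟨g, hg⟩ := AdjoinInv.exists_lift f ((hx Y f).2 (by rwa [hf]))
    refine ⟨g, ?_⟩
    rw [← hf, ← hg]
    rfl
  hom_ext f hf := AdjoinInv.hom_ext (LocA.hom_ext hf)

/-- The even block is already invertible over `LocA`, so invertibility of `Z` comes down to that of
`D`, hence to its determinant. -/
theorem isUniversal_zAD (h : IsParam q p r) : IsUniversal q p r (LocAD q p r) (zAD q p r) := by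
  refine isUniversal_adjoinInv h _ fun S _ _ φ => ?_
  have hZ := (isQuantumSuperMatrix_zA h).map φ
  have hA : IsUnit ((zA q p r).map φ).toBlocks₁₁ := isUnit_map_matrix φ (isUnit_zA_toBlocks₁₁ h)
  rw [hZ.isUnit_iff h, and_iff_right hA, ← h.isUnit_detOdd_iff (hZ.blockRelations h).dd, detOdd,
    map_detWith]
  rfl

/-- The same with `D` replaced by the Schur complement, whose determinant detects its invertibility
because it satisfies the relation of `D`. -/
theorem isUniversal_zSchur (h : IsParam q p r) :
    IsUniversal q p r (LocSchur q p r) (zSchur q p r) := by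
  refine isUniversal_adjoinInv h _ fun S _ _ φ => ?_
  have hZ := (isQuantumSuperMatrix_zA h).map φ
  have hA := isUnit_zA_toBlocks₁₁ h
  have h1 : ((zA q p r).map φ).toBlocks₁₁ * (Ring.inverse (zA q p r).toBlocks₁₁).map φ = 1 := by
    have := map_matrix_mul φ (zA q p r).toBlocks₁₁ (Ring.inverse (zA q p r).toBlocks₁₁)
    rw [Ring.mul_inverse_cancel _ hA, map_matrix_one] at this
    exact this.symm
  have h2 : (Ring.inverse (zA q p r).toBlocks₁₁).map φ * ((zA q p r).map φ).toBlocks₁₁ = 1 := by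
    have := map_matrix_mul φ (Ring.inverse (zA q p r).toBlocks₁₁) (zA q p r).toBlocks₁₁
    rw [Ring.inverse_mul_cancel _ hA, map_matrix_one] at this
    exact this.symm
  rw [isUnit_iff_isUnit_schur h1 h2, ← h.isUnit_detOdd_iff (hZ.schur h h1 h2), detOdd, map_detWith,
    schurA, map_matrix_sub, map_matrix_mul, map_matrix_mul]
  rfl

end Universal

end QSuper

end

theorem mainTheorem1 {K : Type*} [Field K] [CharZero K] (m n : ℕ)
    (q : K) (hq0 : q ≠ 0) (hq : ∀ k : ℕ, 0 < k → q ^ k = 1 → q = 1)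
    (p r : QSuper.Idx m n → QSuper.Idx m n → K)
    (hp0 : ∀ i j, p i j ≠ 0) (hp : ∀ i j, p j i = (p i j)⁻¹) (hp1 : ∀ i, p i i = 1)
    (hr0 : ∀ i j, r i j ≠ 0) (hr : ∀ i j, r j i = (r i j)⁻¹) (hr1 : ∀ i, r i i = 1)
    (hpr : ∀ i j, toLex i < toLex j → p i j * r i j = q) :
    IsUnit (QSuper.zA q p r).toBlocks₁₁ ∧
    (∃ φ : QSuper.GLAlg q p r ≃ₐ[K] QSuper.LocSchur q p r,
      ∀ i j, φ (QSuper.glZ q p r i j) = QSuper.zSchur q p r i j) ∧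
    (∃ φ : QSuper.GLAlg q p r ≃ₐ[K] QSuper.LocAD q p r,
      ∀ i j, φ (QSuper.glZ q p r i j) = QSuper.zAD q p r i j) ∧
    (∀ (S : Type*) [Ring S] [Algebra K S]
      (Z : Matrix (QSuper.Idx m n) (QSuper.Idx m n) S),
      QSuper.IsQuantumSuperMatrix q p r Z →
        (IsUnit Z ↔ IsUnit Z.toBlocks₁₁ ∧ IsUnit Z.toBlocks₂₂)) := by
  have h : QSuper.IsParam q p r := ⟨hq0, hq, hp0, hp, hp1, hr0, hr, hr1, hpr⟩
  exact ⟨QSuper.isUnit_zA_toBlocks₁₁ h,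
    QSuper.isUniversal_glZ.exists_algEquiv (QSuper.isUniversal_zSchur h),
    QSuper.isUniversal_glZ.exists_algEquiv (QSuper.isUniversal_zAD h),
    fun _ _ _ _ hZ => hZ.isUnit_iff h⟩
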